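/- Let $G=(V,E)$ be any (simple) graph, possibly infinite and possibly disconnected. **Notation.** For finite $X\subseteq V$ let $\mathcal C_X$ be the set of components of $G-X$. An end $\omega$ is an equivalence class of rays, two rays being equivalent if for every finite $X$ they have tails in the same component of $G-X$; that component is $C(X,\omega)$, and $\Omega$ is the set of ends. An $\aleph_0$-tangle is a consistent orientation of all separations $\{A,B\}$ of $G$ with $A\cap B$ finite that includes no finite star $\{(A_i,B_i)\}$ with $\bigcap_i B_i$ finite; $\Theta$ is the set of these. Each end $\omega$ is identified with the tangle $\{(A,B): C(A\cap B,\omega)\subseteq G[B\setminus A]\}$. We also write $G$ for the 1-complex of $G$, where a basic open neighbourhood of a vertex $v$ is $\{v\}$ together with an arbitrary half-open initial segment at $v$ of every edge at $v$, and inner edge points have the neighbourhoods inherited from $(0,1)$. Let $\mathring E$ be the set of all inner edge points, and $\mathring E(v)$ the set of inner points of edges at $v$. For $\mathcal C\subseteq\mathcal C_X$ let $P(X,\mathcal C)\subseteq G$ consist of the components in $\mathcal C$ and the inner points of all edges between $X$ and these components. The space $|G|_\Omega=G\sqcup\Omega$ has the topology generated by the open sets of $G$ and the sets $P(X,\mathcal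 C)\cup\{\omega: C(X,\omega)\in\mathcal C\}$; the space $|G|_\Theta=G\sqcup\Theta$ has the topology generated by the open sets of $G$ and the sets $P(X,\mathcal C)\cup\{\tau\in\Theta: (V\setminus\bigcup_{C\in\mathcal C}V(C),\ X\cup\bigcup_{C\in\mathcal C}V(C))\in\tau\}$. A compactification of a space $Y$ is a compact space $K$ with an embedding $h\colon Y\to K$ onto a dense subspace; its remainder is $K\setminus h[Y]$. We write $K\le K'$ ($K$ is coarser than $K'$) if some continuous $f\colon K'\to K$ satisfies $f\circ h'=h$; $K$ is a quotient of $K'$ if such an $f$ can be chosen to be a quotient map, and $K,K'$ are equivalent if it can be chosen to be a homeomorphism. An $\Omega$-compactification of $G$ is a compactification $\alpha G$ of $|G|_\Omega$ such that $\alpha G\setminus\mathring E$ is a Hausdorff compactification of $|G|_\Omega\setminus\mathring E$; it is one-point if $|\alpha G\setminus|G|_\Omega|=1$. A set $M\subseteq\alpha G$ is crude if $M\cap\mathring E=\bigcup_{v\in M\cap V}\mathring E(v)$, and $\alpha G$ is crude if its topology has a basis consisting of the basic open sets of $G$ and of crude sets. The coarsest (crude) $\Omega$-compactification is one that is coarser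 than every (crude) $\Omega$-compactification. $G$ is tough if $\mathcal C_X$ is finite for every finite $X\subseteq V$, and end-tough if for every end $\omega$ there is a finite $X\subseteq V$ such that the graph $C(X,\omega)$ is tough. **Theorem.** 1. If $G$ is tough, then $|G|_\Omega$ is an $\Omega$-compactification of $G$, and every $\Omega$-compactification of $G$ is equivalent to $|G|_\Omega$. 2. If $G$ is end-tough but not tough, then $G$ has a crude one-point $\Omega$-compactification which is the coarsest crude $\Omega$-compactification of $G$, which is a quotient of every crude $\Omega$-compactification of $G$, and which is not equivalent to $|G|_\Theta$. 3. If $G$ is neither tough nor end-tough, then $G$ has no $\Omega$-compactification with remainder (in the sense of $\alpha G\setminus|G|_\Omega$) of size at most one. Moreover, $G$ has no coarsest $\Omega$-compactification, and there is no coarsest one among the crude $\Omega$-compactifications of $G$ either. In particular, $|G|_\Theta$ is the coarsest $\Omega$-compactification of $G$ if and only if $G$ is tough. -/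

import Mathlib

universe u v v' w

namespace GraphEnds

open Set Topology

/-! ### Compactifications -/

section Compactifications

variable {X : Type*} [TopologicalSpace X]

/-- `(K, h)` is a compactification of `X`: the space `K` is compact and `h` is an embedding of `X`
as a dense subspace. -/
structure IsCompactification {K : Type*} [TopologicalSpace K] (h : X → K) : Prop where
  compact : CompactSpace K
  embedding : IsEmbedding h
  dense : DenseRange h

/-- `(K, h) ≤ (K', h')`: there is a continuous `f : K' → K` with `f ∘ h' = h`. -/
def IsCoarser {K K' : Type*} [TopologicalSpace K] [TopologicalSpace K']
    (h : X → K) (h' : X → K') : Prop :=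
  ∃ f : K' → K, Continuous f ∧ f ∘ h' = h

/-- `(K, h)` and `(K', h')` are topologically equivalent: there is a homeomorphism `f : K' → K`
with `f ∘ h' = h`. -/
def AreEquivalent {K K' : Type*} [TopologicalSpace K] [TopologicalSpace K']
    (h : X → K) (h' : X → K') : Prop :=
  ∃ f : K' ≃ₜ K, f ∘ h' = h

/-- `(K, h)` is a quotient of `(K', h')`: some `f : K' → K` with `f ∘ h' = h` is a (topological)
quotient map. -/
def IsQuotientOf {K K' : Type*} [TopologicalSpace K] [TopologicalSpace K']
    (h : X → K) (h' : X → K') : Prop :=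
  ∃ f : K' → K, IsQuotientMap f ∧ f ∘ h' = h

end Compactifications

variable {V : Type u}

/-! ### Rays and ends -/

/-- A ray of `G`: a one-way infinite path. -/
structure Ray (G : SimpleGraph V) where
  vertex : ℕ → V
  injective : Function.Injective vertex
  adj : ∀ n, G.Adj (vertex n) (vertex (n + 1))

/-- Some tail of the ray `r` has all its vertices in `S`. -/
def Ray.TailIn {G : SimpleGraph V} (r : Ray G) (S : Set V) : Prop :=
  ∃ n, ∀ m, n ≤ m → r.vertex m ∈ S

theorem Ray.TailIn.inter {G : SimpleGraph V} {r : Ray G} {S T : Set V}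
    (hS : r.TailIn S) (hT : r.TailIn T) : r.TailIn (S ∩ T) := by
  obtain ⟨n, hn⟩ := hS
  obtain ⟨k, hk⟩ := hT
  exact ⟨max n k, fun m hm => ⟨hn m (le_of_max_le_left hm), hk m (le_of_max_le_right hm)⟩⟩

theorem Ray.TailIn.mono {G : SimpleGraph V} {r : Ray G} {S T : Set V}
    (hS : r.TailIn S) (h : S ⊆ T) : r.TailIn T := by
  obtain ⟨n, hn⟩ := hS
  exact ⟨n, fun m hm => h (hn m hm)⟩

theorem Ray.TailIn.infinite {G : SimpleGraph V} {r : Ray G} {S : Set V}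
    (hS : r.TailIn S) : S.Infinite := by
  obtain ⟨n, hn⟩ := hS
  refine Set.infinite_of_injective_forall_mem (f := fun k => r.vertex (n + k)) ?_ ?_
  · intro a b hab
    have := r.injective hab
    omega
  · intro k
    exact hn _ (Nat.le_add_right _ _)

theorem Ray.tailIn_compl {G : SimpleGraph V} (r : Ray G) {S : Set V} (hS : S.Finite) :
    r.TailIn Sᶜ := by
  have hfin : (r.vertex ⁻¹' S).Finite := hS.preimage r.injective.injOn
  obtain ⟨n, hn⟩ := hfin.bddAbove
  exact ⟨n + 1, fun m hm hmem => by have := hn hmem; omega⟩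

theorem Ray.exists_component {G : SimpleGraph V} (r : Ray G) (X : Finset V) :
    ∃ C : G.ComponentCompl (X : Set V), r.TailIn (C : Set V) := by
  obtain ⟨n, hn⟩ := r.tailIn_compl X.finite_toSet
  refine ⟨G.componentComplMk (hn n le_rfl), n, fun m hm => ?_⟩
  induction m, hm using Nat.le_induction with
  | base => exact G.componentComplMk_mem _
  | succ k hk ih =>
    exact SimpleGraph.ComponentCompl.mem_of_adj _ _ ih (hn (k + 1) (by omega)) (r.adj k)

theorem Ray.component_unique {G : SimpleGraph V} (r : Ray G) {X : Finset V}
    {C D : G.ComponentCompl (X : Set V)} (hC : r.TailIn (C : Set V)) (hD : r.TailIn (D : Set V)) :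
    C = D := by
  by_contra hne
  have hdisj : Disjoint (C : Set V) (D : Set V) :=
    SimpleGraph.ComponentCompl.pairwise_disjoint hne
  have := (hC.inter hD).infinite
  rw [hdisj.inter_eq] at this
  exact this Set.finite_empty

/-- Two rays are equivalent if for every finite `X ⊆ V` both have a tail in the same component
of `G - X`. -/
def raySetoid (G : SimpleGraph V) : Setoid (Ray G) where
  r r s := ∀ X : Finset V, ∃ C : G.ComponentCompl (X : Set V),
    r.TailIn (C : Set V) ∧ s.TailIn (C : Set V)
  iseqv :=
    { refl := fun r X => by
        obtain ⟨C, hC⟩ := r.exists_component X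
        exact ⟨C, hC, hC⟩
      symm := fun h X => by
        obtain ⟨C, hC, hC'⟩ := h X
        exact ⟨C, hC', hC⟩
      trans := fun {r s t} h h' X => by
        obtain ⟨C, hr, hs⟩ := h X
        obtain ⟨D, hs', ht⟩ := h' X
        obtain rfl := s.component_unique hs hs'
        exact ⟨C, hr, ht⟩ }

/-- The set `Ω(G)` of ends of `G`: the equivalence classes of rays. -/
def Ends (G : SimpleGraph V) : Type u := Quotient (raySetoid G)

/-- `C(X, ω)`: the component of `G - X` in which every ray of the end `ω` has a tail. -/
noncomputable def Ends.component {G : SimpleGraph V} (ω : Ends G) (X : Finset V) :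
    G.ComponentCompl (X : Set V) :=
  Quotient.lift (s := raySetoid G) (fun r : Ray G => (r.exists_component X).choose)
    (fun r s h => by
      obtain ⟨C, hr, hs⟩ := h X
      exact (r.component_unique (r.exists_component X).choose_spec hr).trans
        (s.component_unique hs (s.exists_component X).choose_spec)) ω

theorem Ends.tailIn_component {G : SimpleGraph V} (r : Ray G) (X : Finset V) :
    r.TailIn (Ends.component (Quotient.mk (raySetoid G) r) X : Set V) :=
  (r.exists_component X).choose_spec

/-! ### Toughness -/

/-- `G` is tough: deleting any finite set of vertices leaves only finitely many components. -/
def IsTough (G : SimpleGraph V) : Prop :=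
  ∀ X : Finset V, Finite (G.ComponentCompl (X : Set V))

/-- `G` is end-tough: every end lives in a component `C(X, ω)` (an induced subgraph of `G`) that
is tough, for some finite `X`. -/
def IsEndTough (G : SimpleGraph V) : Prop :=
  ∀ ω : Ends G, ∃ X : Finset V, IsTough (G.induce (ω.component X : Set V))

/-! ### Finite order separations and `ℵ₀`-tangles -/

/-- `p = (A, B)` is an oriented finite order separation of `G`. -/
def IsSeparation (G : SimpleGraph V) (p : Set V × Set V) : Prop :=
  (p.1 ∩ p.2).Finite ∧ p.1 ∪ p.2 = univ ∧ ∀ x ∈ p.1 \ p.2, ∀ y ∈ p.2 \ p.1, ¬ G.Adj x y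

/-- The partial ordering of oriented separations: `(A, B) ≤ (C, D)` iff `A ⊆ C` and `B ⊇ D`. -/
def SepLE (p q : Set V × Set V) : Prop := p.1 ⊆ q.1 ∧ q.2 ⊆ p.2

/-- `O` is an orientation of the set of all finite order separations of `G`: it consists of
oriented finite order separations and contains precisely one of the orientations `(A, B)`, `(B, A)`
of each finite order separation `{A, B}`. -/
def IsOrientation (G : SimpleGraph V) (O : Set (Set V × Set V)) : Prop :=
  (∀ p ∈ O, IsSeparation G p) ∧
    ∀ p, IsSeparation G p → ∃! q, q ∈ O ∧ (q = p ∨ q = p.swap)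

/-- `O` is consistent: no two distinct `(B, A)` and `(C, D)` in `O` satisfy `(A, B) < (C, D)`. -/
def IsConsistent (O : Set (Set V × Set V)) : Prop :=
  ∀ p ∈ O, ∀ q ∈ O, p ≠ q → ¬ (SepLE p.swap q ∧ p.swap ≠ q)

/-- `σ` is a star: any two distinct `(A, B)` and `(D, C)` in `σ` satisfy `(A, B) ≤ (C, D)`. -/
def IsStar (G : SimpleGraph V) (σ : Set (Set V × Set V)) : Prop :=
  (∀ p ∈ σ, IsSeparation G p) ∧ ∀ p ∈ σ, ∀ q ∈ σ, p ≠ q → SepLE p q.swap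

/-- The interior of a star: the intersection of all its big sides. -/
def starInterior (σ : Set (Set V × Set V)) : Set V := ⋂ p ∈ σ, p.2

/-- `τ` is an `ℵ₀`-tangle of `G`: a consistent orientation of the set of all finite order
separations that has no finite star of finite interior as a subset. -/
structure IsTangle (G : SimpleGraph V) (τ : Set (Set V × Set V)) : Prop where
  orientation : IsOrientation G τ
  consistent : IsConsistent τ
  avoids : ∀ σ, IsStar G σ → σ.Finite → (starInterior σ).Finite → ¬ σ ⊆ τ

/-- The set `Θ(G)` of `ℵ₀`-tangles of `G`. -/
def Tangles (G : SimpleGraph V) : Type u := {τ : Set (Set V × Set V) // IsTangle G τ}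

/-- The set `V[𝒞]` of the vertices of the components in `𝒞 ⊆ 𝒞_X`. -/
def vertexUnion {G : SimpleGraph V} {X : Finset V} (𝒞 : Set (G.ComponentCompl (X : Set V))) :
    Set V :=
  ⋃ C ∈ 𝒞, (C : Set V)

/-- The oriented separation `s_{X → 𝒞} = (V \ V[𝒞], X ∪ V[𝒞])`. -/
def sepTowards {G : SimpleGraph V} (X : Finset V) (𝒞 : Set (G.ComponentCompl (X : Set V))) :
    Set V × Set V :=
  ((vertexUnion 𝒞)ᶜ, (X : Set V) ∪ vertexUnion 𝒞)

/-- The ultrafilter `U(τ, X) = {𝒞 ⊆ 𝒞_X | s_{X → 𝒞} ∈ τ}` on `𝒞_X` that the tangle `τ` induces,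
as a set of subsets of `𝒞_X`. -/
def Tangles.ultra {G : SimpleGraph V} (τ : Tangles G) (X : Finset V) :
    Set (Set (G.ComponentCompl (X : Set V))) :=
  {𝒞 | sepTowards X 𝒞 ∈ τ.1}

/-- `τ_ω`: the set of all oriented finite order separations `(A, B)` with
`C(A ∩ B, ω) ⊆ G[B \ A]`. -/
def endTangleSet {G : SimpleGraph V} (ω : Ends G) : Set (Set V × Set V) :=
  {p | ∃ hp : IsSeparation G p, (ω.component hp.1.toFinset : Set V) ⊆ p.2 \ p.1}

theorem Ray.tailIn_sides {G : SimpleGraph V} (r : Ray G) {p : Set V × Set V}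
    (hp : IsSeparation G p) : r.TailIn (p.1 \ p.2) ∨ r.TailIn (p.2 \ p.1) := by
  obtain ⟨n, hn⟩ := r.tailIn_compl hp.1
  have key : ∀ m, n ≤ m → r.vertex m ∈ p.1 \ p.2 ∨ r.vertex m ∈ p.2 \ p.1 := by
    intro m hm
    have h1 := hn m hm
    have h2 : r.vertex m ∈ p.1 ∪ p.2 := hp.2.1 ▸ mem_univ _
    simp only [mem_compl_iff, mem_inter_iff, mem_union, mem_sdiff] at *
    tauto
  rcases key n le_rfl with h | h
  · left
    refine ⟨n, fun m hm => ?_⟩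
    induction m, hm using Nat.le_induction with
    | base => exact h
    | succ k hk ih =>
      rcases key (k + 1) (by omega) with h' | h'
      · exact h'
      · exact absurd (r.adj k) (hp.2.2 _ ih _ h')
  · right
    refine ⟨n, fun m hm => ?_⟩
    induction m, hm using Nat.le_induction with
    | base => exact h
    | succ k hk ih =>
      rcases key (k + 1) (by omega) with h' | h'
      · exact absurd (r.adj k).symm (hp.2.2 _ h' _ ih)
      · exact h'

theorem component_subset_of_mem {G : SimpleGraph V} {p : Set V × Set V} (hp : IsSeparation G p)
    {X : Finset V} (hX : p.1 ∩ p.2 ⊆ X) (C : G.ComponentCompl (X : Set V)) {x : V} (hxC : x ∈ C)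
    (hx : x ∈ p.2 \ p.1) : (C : Set V) ⊆ p.2 \ p.1 := by
  intro y hyC
  obtain ⟨hx', hxC'⟩ := hxC
  obtain ⟨hy', hyC'⟩ := hyC
  have hreach := SimpleGraph.ConnectedComponent.exact (hxC'.trans hyC'.symm)
  have gen : ∀ (a b : ((X : Set V)ᶜ : Set V)) (q : (G.induce ((X : Set V)ᶜ)).Walk a b),
      (a : V) ∈ p.2 \ p.1 → (b : V) ∈ p.2 \ p.1 := by
    intro a b q
    induction q with
    | nil => exact id
    | @cons a c b hac q ih =>
      intro ha
      apply ih
      have hc : (c : V) ∉ p.1 ∩ p.2 := fun h => c.2 (hX h)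
      have hc' : (c : V) ∈ p.1 ∪ p.2 := hp.2.1 ▸ mem_univ _
      have hadj : G.Adj (a : V) (c : V) := hac
      by_contra hcon
      refine hp.2.2 (c : V) ?_ (a : V) ha hadj.symm
      simp only [mem_inter_iff, mem_union, mem_sdiff] at *
      tauto
  obtain ⟨q⟩ := hreach
  exact gen _ _ q hx

theorem mem_endTangleSet_iff {G : SimpleGraph V} (r : Ray G) (p : Set V × Set V) :
    p ∈ endTangleSet (Quotient.mk (raySetoid G) r) ↔ IsSeparation G p ∧ r.TailIn (p.2 \ p.1) := by
  constructor
  · rintro ⟨hp, h⟩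
    exact ⟨hp, (Ends.tailIn_component r _).mono h⟩
  · rintro ⟨hp, h⟩
    refine ⟨hp, ?_⟩
    obtain ⟨n, hn⟩ := h.inter (Ends.tailIn_component r hp.1.toFinset)
    exact component_subset_of_mem hp (by simp) _ (hn n le_rfl).2 (hn n le_rfl).1

theorem IsSeparation.swap {G : SimpleGraph V} {p : Set V × Set V} (hp : IsSeparation G p) :
    IsSeparation G p.swap :=
  ⟨by simpa [inter_comm] using hp.1, by simpa [union_comm] using hp.2.1,
    fun x hx y hy h => hp.2.2 y hy x hx h.symm⟩

theorem Ray.not_tailIn_both {G : SimpleGraph V} (r : Ray G) {S T : Set V} (h : S ∩ T = ∅)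
    (hS : r.TailIn S) (hT : r.TailIn T) : False := by
  have := (hS.inter hT).infinite
  rw [h] at this
  exact this Set.finite_empty

theorem isTangle_endTangleSet {G : SimpleGraph V} (ω : Ends G) : IsTangle G (endTangleSet ω) := by
  induction ω using Quotient.inductionOn with
  | _ r =>
  refine ⟨⟨fun p hp => ((mem_endTangleSet_iff r p).1 hp).1, fun p hp => ?_⟩, ?_, ?_⟩
  · rcases r.tailIn_sides hp with h | h
    · refine ⟨p.swap, ⟨(mem_endTangleSet_iff r _).2 ⟨hp.swap, h⟩, Or.inr rfl⟩, ?_⟩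
      rintro q ⟨hq, rfl | rfl⟩
      · exact (r.not_tailIn_both (by ext; simp; tauto) h ((mem_endTangleSet_iff r _).1 hq).2).elim
      · rfl
    · refine ⟨p, ⟨(mem_endTangleSet_iff r _).2 ⟨hp, h⟩, Or.inl rfl⟩, ?_⟩
      rintro q ⟨hq, rfl | rfl⟩
      · rfl
      · exact (r.not_tailIn_both (by ext; simp; tauto) h ((mem_endTangleSet_iff r _).1 hq).2).elim
  · rintro p hp q hq - ⟨⟨h1, h2⟩, -⟩
    have hp' := ((mem_endTangleSet_iff r p).1 hp).2
    have hq' := ((mem_endTangleSet_iff r q).1 hq).2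
    refine r.not_tailIn_both ?_ hp' hq'
    ext x
    simp only [Prod.fst_swap, Prod.snd_swap] at h1 h2
    simp only [mem_inter_iff, mem_sdiff, mem_empty_iff_false, iff_false]
    rintro ⟨⟨ha, -⟩, -, hb⟩
    exact hb (h1 ha)
  · intro σ _ hfin hint hsub
    have : ∀ σ' : Set (Set V × Set V), σ'.Finite → σ' ⊆ σ → r.TailIn (starInterior σ') := by
      intro σ' hσ'
      induction σ', hσ' using Set.Finite.induction_on with
      | empty => exact fun _ => ⟨0, fun m _ => by simp [starInterior]⟩
      | @insert p s hps hs ih =>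
        intro hsub'
        have h1 := ih ((subset_insert _ _).trans hsub')
        have h2 := ((mem_endTangleSet_iff r p).1 (hsub (hsub' (mem_insert _ _)))).2
        refine (h2.inter h1).mono ?_
        rintro x ⟨hx, hx'⟩
        simp only [starInterior, mem_iInter, mem_insert_iff] at hx' ⊢
        rintro q (rfl | hq)
        · exact hx.1
        · exact hx' q hq
    exact (this σ hfin subset_rfl).infinite hint

/-- The end tangle `τ_ω` of the end `ω`. -/
def Ends.tangle {G : SimpleGraph V} (ω : Ends G) : Tangles G :=
  ⟨endTangleSet ω, isTangle_endTangleSet ω⟩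

/-! ### The 1-complex of a graph -/

/-- The point set `V ⊔ ⨆ e̊` of the 1-complex of `G`: the vertices, and for every edge `e` a copy
`e̊` of the open unit interval consisting of the inner edge points of `e`. The parameter `t` of an
inner edge point runs from `(Quot.out e).1` to `(Quot.out e).2`, the two endvertices of `e` in an
arbitrarily chosen order. -/
inductive Complex (G : SimpleGraph V) : Type u
  | vertex (x : V) : Complex G
  | inner (e : G.edgeSet) (t : Ioo (0 : ℝ) 1) : Complex G

open Classical in
/-- The distance, in the copy `[x, y]` of `[0, 1]`, of the inner point of `e = xy` with parameter
`t` from the endvertex `x` of `e`. -/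
noncomputable def distFrom {G : SimpleGraph V} (x : V) (e : G.edgeSet) (t : Ioo (0 : ℝ) 1) : ℝ :=
  if x = (Quot.out (e : Sym2 V)).1 then t else 1 - t

/-- The basic open neighbourhood `⋃_{e ∈ E(x)} [x, i_e)` of the vertex `x`, where `i_e` is the
inner point of the edge `e` at distance `i e` from `x`. -/
def openStar {G : SimpleGraph V} (x : V) (i : G.edgeSet → Ioo (0 : ℝ) 1) : Set (Complex G) :=
  {Complex.vertex x} ∪
    {p | ∃ (e : G.edgeSet) (t : Ioo (0 : ℝ) 1), x ∈ (e : Sym2 V) ∧ distFrom x e t < i e ∧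
      p = Complex.inner e t}

/-- The basic open sets of the 1-complex: the open stars around vertices and the open intervals
of inner points of an edge. -/
def basicOpens (G : SimpleGraph V) : Set (Set (Complex G)) :=
  {U | ∃ (x : V) (i : G.edgeSet → Ioo (0 : ℝ) 1), U = openStar x i} ∪
    {U | ∃ (e : G.edgeSet) (a b : ℝ), U = Complex.inner e '' {t | a < (t : ℝ) ∧ (t : ℝ) < b}}

/-- The topology of the 1-complex. -/
instance (G : SimpleGraph V) : TopologicalSpace (Complex G) :=
  TopologicalSpace.generateFrom (basicOpens G)

/-- `⋃ 𝒞 ∪ E̊(X, ⋃ 𝒞)`: the vertices and the inner edge points of the components in `𝒞 ⊆ 𝒞_X`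
together with the inner points of the edges between `X` and these components. -/
def complexPart {G : SimpleGraph V} (X : Finset V) (𝒞 : Set (G.ComponentCompl (X : Set V))) :
    Set (Complex G) :=
  Complex.vertex '' vertexUnion 𝒞 ∪
    {p | ∃ (e : G.edgeSet) (t : Ioo (0 : ℝ) 1), p = Complex.inner e t ∧
      ((∃ C ∈ 𝒞, ∀ x ∈ (e : Sym2 V), x ∈ (C : Set V)) ∨
        ∃ x ∈ X, ∃ y ∈ vertexUnion 𝒞, (e : Sym2 V) = s(x, y))}

/-! ### The spaces `|G|_Ω` and `|G|_Θ` -/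

/-- The point set `G ⊔ Ω` of `|G|_Ω`. -/
inductive EndSpace (G : SimpleGraph V) : Type u
  | ofComplex (p : Complex G) : EndSpace G
  | ofEnd (ω : Ends G) : EndSpace G

/-- `O_{|G|_Ω}(X, 𝒞) = ⋃ 𝒞 ∪ E̊(X, ⋃ 𝒞) ∪ Ω(X, 𝒞)`. -/
def EndSpace.nhd {G : SimpleGraph V} (X : Finset V) (𝒞 : Set (G.ComponentCompl (X : Set V))) :
    Set (EndSpace G) :=
  EndSpace.ofComplex '' complexPart X 𝒞 ∪ EndSpace.ofEnd '' {ω | ω.component X ∈ 𝒞}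

/-- The topology of `|G|_Ω`, generated by the open sets of `G` and the sets `O_{|G|_Ω}(X, 𝒞)`. -/
instance (G : SimpleGraph V) : TopologicalSpace (EndSpace G) :=
  TopologicalSpace.generateFrom
    ({W | ∃ U : Set (Complex G), IsOpen U ∧ W = EndSpace.ofComplex '' U} ∪
      {W | ∃ (X : Finset V) (𝒞 : Set (G.ComponentCompl (X : Set V))), W = EndSpace.nhd X 𝒞})

/-- The point set `G ⊔ Θ` of the tangle compactification `|G|_Θ`. -/
inductive TangleSpace (G : SimpleGraph V) : Type u
  | ofComplex (p : Complex G) : TangleSpace G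
  | ofTangle (τ : Tangles G) : TangleSpace G

/-- `O_{|G|_Θ}(X, 𝒞) = ⋃ 𝒞 ∪ E̊(X, ⋃ 𝒞) ∪ {τ | 𝒞 ∈ U(τ, X)}`. -/
def TangleSpace.nhd {G : SimpleGraph V} (X : Finset V)
    (𝒞 : Set (G.ComponentCompl (X : Set V))) : Set (TangleSpace G) :=
  TangleSpace.ofComplex '' complexPart X 𝒞 ∪ TangleSpace.ofTangle '' {τ | 𝒞 ∈ τ.ultra X}

/-- The topology of `|G|_Θ`, generated by the open sets of `G` and the sets `O_{|G|_Θ}(X, 𝒞)`. -/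
instance (G : SimpleGraph V) : TopologicalSpace (TangleSpace G) :=
  TopologicalSpace.generateFrom
    ({W | ∃ U : Set (Complex G), IsOpen U ∧ W = TangleSpace.ofComplex '' U} ∪
      {W | ∃ (X : Finset V) (𝒞 : Set (G.ComponentCompl (X : Set V))), W = TangleSpace.nhd X 𝒞})

/-- The canonical map `|G|_Ω → |G|_Θ`, which is the identity on `G` and sends each end to its end
tangle. -/
def toTangleSpace (G : SimpleGraph V) : EndSpace G → TangleSpace G
  | EndSpace.ofComplex p => TangleSpace.ofComplex p
  | EndSpace.ofEnd ω => TangleSpace.ofTangle ω.tangle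

/-! ### `Ω`-compactifications -/

/-- The set `E̊` of all inner edge points, as a subset of `|G|_Ω`. -/
def innerPoints (G : SimpleGraph V) : Set (EndSpace G) :=
  {q | ∃ (e : G.edgeSet) (t : Ioo (0 : ℝ) 1), q = EndSpace.ofComplex (Complex.inner e t)}

/-- The set `E̊(x)` of all inner points of edges at the vertex `x`, as a subset of `|G|_Ω`. -/
def innerPointsAt (G : SimpleGraph V) (x : V) : Set (EndSpace G) :=
  {q | ∃ (e : G.edgeSet) (t : Ioo (0 : ℝ) 1), x ∈ (e : Sym2 V) ∧
    q = EndSpace.ofComplex (Complex.inner e t)}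

theorem mapsTo_compl_image {α β : Type*} {h : α → β} (hinj : Function.Injective h) (s : Set α) :
    MapsTo h sᶜ (h '' s)ᶜ := by
  rintro x hx ⟨y, hy, hxy⟩
  exact hx (hinj hxy ▸ hy)

/-- `(K, h)` is an `Ω`-compactification of `G`: it is a compactification of `|G|_Ω` such that
`K \ E̊`, with the restriction of `h`, is a Hausdorff compactification of `|G|_Ω \ E̊`. -/
structure IsOmegaCompactification {G : SimpleGraph V} {K : Type v} [TopologicalSpace K]
    (h : EndSpace G → K) : Prop where
  isCompactification : IsCompactification h
  restrict : IsCompactification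
    ((mapsTo_compl_image isCompactification.embedding.injective (innerPoints G)).restrict h
      (innerPoints G)ᶜ (h '' innerPoints G)ᶜ)
  t2 : T2Space ↥(h '' innerPoints G)ᶜ

/-- A subset `M` of a space `K` that contains `|G|_Ω` (via `h`) is crude if
`M ∩ E̊ = ⋃_{x ∈ M ∩ V} E̊(x)`. -/
def IsCrudeSet {G : SimpleGraph V} {K : Type v} (h : EndSpace G → K) (M : Set K) : Prop :=
  M ∩ h '' innerPoints G =
    ⋃ x ∈ {x : V | h (EndSpace.ofComplex (Complex.vertex x)) ∈ M}, h '' innerPointsAt G x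

/-- The space `K ⊇ |G|_Ω` is crude: it has a basis consisting of the basic open sets of `G` and of
sets that are crude. -/
def IsCrude {G : SimpleGraph V} {K : Type v} [TopologicalSpace K] (h : EndSpace G → K) : Prop :=
  ∃ 𝓜 : Set (Set K), (∀ M ∈ 𝓜, IsCrudeSet h M) ∧
    TopologicalSpace.IsTopologicalBasis
      ({W | ∃ U ∈ basicOpens G, W = h '' (EndSpace.ofComplex '' U)} ∪ 𝓜)

/-- `(K, h)` is the coarsest `Ω`-compactification of `G` (among those in the universe `w`). -/
def IsCoarsestOmega {G : SimpleGraph V} {K : Type v} [TopologicalSpace K]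
    (h : EndSpace G → K) : Prop :=
  IsOmegaCompactification h ∧
    ∀ (K' : Type w) [TopologicalSpace K'] (h' : EndSpace G → K'),
      IsOmegaCompactification h' → IsCoarser h h'

/-- `(K, h)` is the coarsest crude `Ω`-compactification of `G` (among those in the
universe `w`). -/
def IsCoarsestCrudeOmega {G : SimpleGraph V} {K : Type v} [TopologicalSpace K]
    (h : EndSpace G → K) : Prop :=
  IsOmegaCompactification h ∧ IsCrude h ∧
    ∀ (K' : Type w) [TopologicalSpace K'] (h' : EndSpace G → K'),
      IsOmegaCompactification h' → IsCrude h' → IsCoarser h h'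

end GraphEnds

open GraphEnds

/-! Let Z be |G|_Ω without the inner edge points: the space of vertices and ends. It is Hausdorff,
its vertices are isolated, and the theorem reduces to its compactifications. Deleting E̊ turns an
Ω-compactification into a Hausdorff compactification of Z with the same remainder; conversely
`CrudeExtension` glues the edges back onto any Hausdorff compactification of Z and gives a crude
Ω-compactification.

Z is compact iff G is tough (`IsTough.isCompact`, `isTough_of_isCompact`), and locally compact iff G
is end-tough (`IsEndTough.weaklyLocallyCompactSpace`, `isEndTough_of_locallyCompactSpace`). To get
compactness from toughness, note that an ultrafilter on Z without a vertex singleton selects a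
component of G - Y for every finite Y. The selection is a direction, `exists_end_of_direction` finds
an end defining it, and the ultrafilter converges to that end.

If Z is compact, its image in K \ E̊ is closed and dense, so nothing is added. If Z is locally
compact but not compact, the crude extension of its one-point compactification lies below every
crude Ω-compactification (`isQuotientOf_onePointMap`). If the remainder has at most one point, Z is
open in a compact Hausdorff space, so G is end-tough. A coarsest K always has such a small remainder
(`IsOmegaCompactification.subsingleton_compl_range`): identify two remainder points in K \ E̊ and
extend crudely; a map from this extension back to K would yield a self-map of K \ E̊ that is the
identity on a dense set and yet identifies the two points.

For |G|_Θ, an infinite 𝒞_X carries two distinct free ultrafilters, which give two tangles that are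
not ends; in a tough graph every tangle is an end tangle, so |G|_Θ is |G|_Ω. -/

namespace GraphEnds

open Set Topology

/-! ### Compactifications of locally compact spaces -/

section Topology

variable {X : Type*} {Y : Type v} [TopologicalSpace X] [TopologicalSpace Y] {j : X → Y}

/-- A weakly locally compact space is open in each of its Hausdorff compactifications. -/
theorem IsCompactification.isOpenEmbedding [WeaklyLocallyCompactSpace X] [T2Space Y]
    (hj : IsCompactification j) : IsOpenEmbedding j := by
  refine ⟨hj.embedding, isOpen_iff_mem_nhds.2 ?_⟩
  rintro _ ⟨x, rfl⟩
  obtain ⟨N, hN, hNx⟩ := exists_compact_mem_nhds x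
  obtain ⟨O, hON, hO, hxO⟩ := mem_nhds_iff.1 hNx
  obtain ⟨W, hW, rfl⟩ := hj.embedding.isInducing.isOpen_iff.1 hO
  refine Filter.mem_of_superset (hW.mem_nhds hxO) ?_
  have hcl : closure (j '' N) ⊆ range j := by
    rw [(hN.image hj.embedding.continuous).isClosed.closure_eq]
    exact image_subset_range j N
  -- Density puts `W` inside the closure of its trace on `X`; that trace lies in `j '' N`, which is
  -- compact and hence closed.
  refine (hj.dense.open_subset_closure_inter hW).trans ((closure_mono ?_).trans hcl)
  rintro _ ⟨hz, z, rfl⟩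
  exact ⟨z, hON hz, rfl⟩

/-- A space is locally compact if it has a Hausdorff compactification with at most one additional
point. -/
theorem IsCompactification.locallyCompactSpace [T2Space Y] (hj : IsCompactification j)
    (hr : (range j)ᶜ.Subsingleton) : LocallyCompactSpace X := by
  have := hj.compact
  have hopen : IsOpen (range j) := by
    rw [← isClosed_compl_iff]
    exact hr.isClosed
  exact (IsOpenEmbedding.mk hj.embedding hopen).locallyCompactSpace

/-- The one-point compactification is coarser than every Hausdorff compactification. -/
theorem IsCompactification.continuous_extend_infty [WeaklyLocallyCompactSpace X] [T2Space Y]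
    (hj : IsCompactification j) :
    Continuous (Function.extend j ((↑) : X → OnePoint X) fun _ => OnePoint.infty) := by
  have hinj := hj.embedding.injective
  -- An open set containing ∞ pulls back to the complement of a compact set; any other is an open
  -- subset of `X`, and `j` is an open map.
  refine continuous_def.2 fun M hM => ?_
  by_cases hM' : OnePoint.infty ∈ M
  · have hc := ((OnePoint.isOpen_iff_of_mem hM').1 hM).2
    convert (hc.image hj.embedding.continuous).isClosed.isOpen_compl using 1
    ext y
    by_cases hy : ∃ x, j x = y
    · obtain ⟨x, rfl⟩ := hy
      rw [mem_preimage, hinj.extend_apply, mem_compl_iff, hinj.mem_set_image]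
      simp
    · rw [mem_preimage, Function.extend_apply' _ _ _ hy]
      exact iff_of_true hM' fun ⟨x, _, hx⟩ => hy ⟨x, hx⟩
  · have ho := (OnePoint.isOpen_iff_of_notMem hM').1 hM
    convert hj.isOpenEmbedding.isOpenMap _ ho using 1
    ext y
    by_cases hy : ∃ x, j x = y
    · obtain ⟨x, rfl⟩ := hy
      rw [mem_preimage, hinj.extend_apply, hinj.mem_set_image]
      simp
    · rw [mem_preimage, Function.extend_apply' _ _ _ hy]
      exact iff_of_false hM' fun ⟨x, _, hx⟩ => hy ⟨x, hx⟩

/-! ### Identifying two points of a Hausdorff space -/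

/-- The equivalence relation that identifies `p` with `q`. -/
def identify (p q : Y) : Setoid Y where
  r a b := a = b ∨ ((a = p ∨ a = q) ∧ (b = p ∨ b = q))
  iseqv := ⟨fun _ => Or.inl rfl, by grind, by grind⟩

theorem isOpen_image_identify {p q : Y} {W : Set Y} (hW : IsOpen W) (h : p ∈ W ↔ q ∈ W) :
    IsOpen (Quotient.mk (identify p q) '' W) ∧
      Quotient.mk (identify p q) ⁻¹' (Quotient.mk (identify p q) '' W) = W := by
  have key : Quotient.mk (identify p q) ⁻¹' (Quotient.mk (identify p q) '' W) = W := by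
    refine subset_antisymm ?_ (subset_preimage_image _ _)
    rintro a ⟨b, hb, hab⟩
    rcases Quotient.exact hab with rfl | ⟨rfl | rfl, rfl | rfl⟩
    · exact hb
    · exact hb
    · exact h.1 hb
    · exact h.2 hb
    · exact hb
  refine ⟨?_, key⟩
  refine isQuotientMap_quotient_mk'.isOpen_preimage.1 ?_
  exact key.symm ▸ hW

/-- The separating sets must be saturated. If one point is in the class of `p` and `q`, separate the
other point from both and combine; if neither is, remove `p` and `q` from both sets. -/
instance t2Space_identify [T2Space Y] (p q : Y) : T2Space (Quotient (identify p q)) := by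
  have sep : ∀ a b : Y, Quotient.mk (identify p q) a ≠ Quotient.mk (identify p q) b →
      ∃ U W : Set Y, IsOpen U ∧ IsOpen W ∧ (p ∈ U ↔ q ∈ U) ∧ (p ∈ W ↔ q ∈ W) ∧ a ∈ U ∧ b ∈ W ∧
        Disjoint U W := by
    intro a b hne
    have hab : ¬ (identify p q).r a b := fun h => hne (Quotient.sound h)
    have hab' : a ≠ b := fun h => hab (Or.inl h)
    have hsep : ∀ a b : Y, a ≠ p → a ≠ q → (b = p ∨ b = q) → ∃ U W : Set Y, IsOpen U ∧ IsOpen W ∧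
        (p ∈ U ↔ q ∈ U) ∧ (p ∈ W ↔ q ∈ W) ∧ a ∈ U ∧ b ∈ W ∧ Disjoint U W := by
      intro a b hp hq hb
      obtain ⟨U₁, W₁, hU₁, hW₁, ha₁, hp₁, hd₁⟩ := t2_separation hp
      obtain ⟨U₂, W₂, hU₂, hW₂, ha₂, hq₂, hd₂⟩ := t2_separation hq
      refine ⟨U₁ ∩ U₂, W₁ ∪ W₂, hU₁.inter hU₂, hW₁.union hW₂, iff_of_false ?_ ?_,
        iff_of_true (Or.inl hp₁) (Or.inr hq₂), ⟨ha₁, ha₂⟩, ?_, ?_⟩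
      · exact fun h => disjoint_left.1 hd₁ h.1 hp₁
      · exact fun h => disjoint_left.1 hd₂ h.2 hq₂
      · rcases hb with rfl | rfl
        exacts [Or.inl hp₁, Or.inr hq₂]
      · rw [disjoint_left]
        rintro x ⟨h1, h2⟩ (h | h)
        exacts [disjoint_left.1 hd₁ h1 h, disjoint_left.1 hd₂ h2 h]
    by_cases ha : a = p ∨ a = q
    · by_cases hb : b = p ∨ b = q
      · exact absurd (Or.inr ⟨ha, hb⟩) hab
      · rw [not_or] at hb
        obtain ⟨U, W, hU, hW, h1, h2, h3, h4, h5⟩ := hsep b a hb.1 hb.2 ha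
        exact ⟨W, U, hW, hU, h2, h1, h4, h3, h5.symm⟩
    · rw [not_or] at ha
      by_cases hb : b = p ∨ b = q
      · exact hsep a b ha.1 ha.2 hb
      · rw [not_or] at hb
        obtain ⟨U, W, hU, hW, h1, h2, h3⟩ := t2_separation hab'
        have hc : IsOpen ({p, q}ᶜ : Set Y) := (Set.toFinite {p, q}).isClosed.isOpen_compl
        exact ⟨U ∩ {p, q}ᶜ, W ∩ {p, q}ᶜ, hU.inter hc, hW.inter hc, by simp, by simp,
          ⟨h1, by simp [ha.1, ha.2]⟩, ⟨h2, by simp [hb.1, hb.2]⟩,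
          h3.mono inter_subset_left inter_subset_left⟩
  refine ⟨fun a b => ?_⟩
  induction a using Quotient.inductionOn with
  | _ a =>
  induction b using Quotient.inductionOn with
  | _ b =>
  intro hne
  obtain ⟨U, W, hU, hW, hUs, hWs, ha, hb, hd⟩ := sep a b hne
  refine ⟨_, _, (isOpen_image_identify hU hUs).1, (isOpen_image_identify hW hWs).1,
    mem_image_of_mem _ ha, mem_image_of_mem _ hb, ?_⟩
  rw [disjoint_left]
  rintro _ ⟨x, hx, rfl⟩ hx'
  have : x ∈ Quotient.mk (identify p q) ⁻¹' (Quotient.mk (identify p q) '' W) := hx'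
  rw [(isOpen_image_identify hW hWs).2] at this
  exact disjoint_left.1 hd hx this

/-- Identifying two points of the remainder of a Hausdorff compactification gives another
compactification. -/
theorem IsCompactification.identify [T2Space Y] (hj : IsCompactification j) {p q : Y}
    (hp : p ∉ range j) (hq : q ∉ range j) :
    IsCompactification (Quotient.mk (identify p q) ∘ j) := by
  have := hj.compact
  have hcont : Continuous (Quotient.mk (GraphEnds.identify p q)) := continuous_quotient_mk'
  refine ⟨inferInstance, ⟨⟨le_antisymm (hcont.comp hj.embedding.continuous).le_induced ?_⟩, ?_⟩,
    (Quotient.mk_surjective.denseRange).comp hj.dense hcont⟩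
  · intro O hO
    obtain ⟨W, hW, rfl⟩ := hj.embedding.isInducing.isOpen_iff.1 hO
    have hc : IsOpen ({p, q}ᶜ : Set Y) := (Set.toFinite {p, q}).isClosed.isOpen_compl
    -- Removing `p` and `q` makes `W` saturated and does not change its preimage under `j`.
    obtain ⟨h1, h2⟩ := isOpen_image_identify (p := p) (q := q) (hW.inter hc) (by simp)
    refine ⟨_, h1, ?_⟩
    rw [preimage_comp, h2, preimage_inter, inter_eq_left]
    rintro x - (hx | hx)
    exacts [hp ⟨x, hx⟩, hq ⟨x, hx⟩]
  · intro x y hxy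
    rcases Quotient.exact hxy with h | ⟨h | h, -⟩
    exacts [hj.embedding.injective h, absurd ⟨x, h⟩ hp, absurd ⟨x, h⟩ hq]

end Topology

variable {V : Type u}

/-! ### Rays and ends from directions -/

open Filter in
/-- A sequence of vertices whose consecutive terms are equal or adjacent and that takes every value
only finitely often has a subsequence that is a ray. -/
theorem exists_ray_of_lazy_walk {G : SimpleGraph V} (w : ℕ → V)
    (hadj : ∀ k, w k = w (k + 1) ∨ G.Adj (w k) (w (k + 1)))
    (hfin : ∀ v, ∀ᶠ k in atTop, w k ≠ v) :
    ∃ (r : Ray G) (t : ℕ → ℕ), StrictMono t ∧ ∀ n, r.vertex n = w (t n) := by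
  have hlast : ∀ k, ∃ m, k ≤ m ∧ w m = w k ∧ ∀ j, m < j → w j ≠ w k := by
    intro k
    obtain ⟨N, hN⟩ := eventually_atTop.1 (hfin (w k))
    classical
    let m := Nat.findGreatest (fun m => w m = w k) (max k N)
    have hm : w m = w k :=
      Nat.findGreatest_spec (P := fun m => w m = w k) (le_max_left k N) rfl
    refine ⟨m, Nat.le_findGreatest (le_max_left _ _) rfl, hm, fun j hj hjk => ?_⟩
    by_cases h : j ≤ max k N
    · exact absurd (Nat.le_findGreatest (P := fun m => w m = w k) h hjk) (not_le.2 hj)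
    · exact hN j (by omega) hjk
  choose last hle heq hne using hlast
  -- Loop erasure: jump to the last visit of the current vertex, take one step, jump again. No
  -- vertex recurs after its last visit.
  let t : ℕ → ℕ := fun n => Nat.rec (last 0) (fun _ k => last (k + 1)) n
  have ht : ∀ n, t (n + 1) = last (t n + 1) := fun n => rfl
  have hmono : StrictMono t := strictMono_nat_of_lt_succ fun n => by
    rw [ht]; exact hle (t n + 1)
  have hexit : ∀ n j, t n < j → w j ≠ w (t n) := by
    intro n j hj
    cases n with
    | zero => rw [show w (t 0) = w 0 from heq 0]; exact hne 0 j hj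
    | succ n => rw [ht, heq]; exact hne _ j (by rwa [← ht])
  refine ⟨⟨fun n => w (t n), ?_, ?_⟩, t, hmono, fun n => rfl⟩
  · intro a b hab
    by_contra h
    rcases lt_or_gt_of_ne h with h | h
    · exact hexit a _ (hmono h) hab.symm
    · exact hexit b _ (hmono h) hab
  · intro n
    have h1 := hexit n (t n + 1) (by omega)
    show G.Adj (w (t n)) (w (t (n + 1)))
    rw [ht, heq]
    exact (hadj (t n)).resolve_left fun h => h1 h.symm

open Filter in
/-- Concatenating walks such that every vertex lies on only finitely many of them and passing to a
subsequence gives a ray in every component that contains infinitely many of the break points. -/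
theorem exists_ray_of_walks {G : SimpleGraph V} (x : ℕ → V) (p : ∀ n, G.Walk (x n) (x (n + 1)))
    (hfin : ∀ v, ∀ᶠ n in atTop, v ∉ (p n).support) :
    ∃ r : Ray G, ∀ (Z : Finset V) (C : G.ComponentCompl (Z : Set V)),
      (∃ᶠ n in atTop, x n ∈ C) → r.TailIn (C : Set V) := by
  -- The pair `(n, i)` stands for position `i` on the walk `p n`. Passing to the next walk repeats a
  -- vertex, which is why lazy walks are allowed.
  let step : ℕ × ℕ → ℕ × ℕ := fun s =>
    if s.2 < (p s.1).length then (s.1, s.2 + 1) else (s.1 + 1, 0)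
  let s : ℕ → ℕ × ℕ := fun k => step^[k] (0, 0)
  have hs : ∀ k, s (k + 1) = step (s k) := fun k => Function.iterate_succ_apply' _ _ _
  have hlen : ∀ k, (s k).2 ≤ (p (s k).1).length := by
    intro k
    induction k with
    | zero => exact Nat.zero_le _
    | succ k ih =>
      rw [hs]
      by_cases h : (s k).2 < (p (s k).1).length
      · rw [show step (s k) = _ from if_pos h]
        exact h
      · rw [show step (s k) = _ from if_neg h]
        exact Nat.zero_le _
  have hmono : Monotone fun k => (s k).1 := by
    refine monotone_nat_of_le_succ fun k => ?_
    simp only [hs, step]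
    split_ifs <;> simp
  have hreach : ∀ n, ∃ k, s k = (n, 0) := by
    intro n
    induction n with
    | zero => exact ⟨0, rfl⟩
    | succ n ih =>
      obtain ⟨k, hk⟩ := ih
      have : ∀ i, i ≤ (p n).length → s (k + i) = (n, i) := by
        intro i
        induction i with
        | zero => exact fun _ => hk
        | succ i ih =>
          intro hi
          rw [← add_assoc, hs, ih (by omega)]
          simp only [step]
          rw [if_pos (by omega)]
      refine ⟨k + (p n).length + 1, ?_⟩
      rw [hs, this _ le_rfl]
      simp [step]
  let w : ℕ → V := fun k => (p (s k).1).getVert (s k).2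
  have hwfin : ∀ v, ∀ᶠ k in atTop, w k ≠ v := by
    intro v
    obtain ⟨N, hN⟩ := eventually_atTop.1 (hfin v)
    obtain ⟨K, hK⟩ := hreach N
    refine eventually_atTop.2 ⟨K, fun k hk hwv => ?_⟩
    have h1 : N ≤ (s k).1 := by have := hmono hk; simpa [hK] using this
    exact hN _ h1 (hwv ▸ SimpleGraph.Walk.getVert_mem_support _ _)
  have hadj : ∀ k, w k = w (k + 1) ∨ G.Adj (w k) (w (k + 1)) := by
    have hcongr : ∀ a b : ℕ × ℕ, a = b → (p a.1).getVert a.2 = (p b.1).getVert b.2 := by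
      rintro _ _ rfl
      rfl
    intro k
    by_cases h : (s k).2 < (p (s k).1).length
    · have e : s (k + 1) = ((s k).1, (s k).2 + 1) := (hs k).trans (if_pos h)
      have hw : w (k + 1) = (p (s k).1).getVert ((s k).2 + 1) :=
        hcongr _ _ e
      exact Or.inr (hw ▸ (p (s k).1).adj_getVert_succ h)
    · have e : s (k + 1) = ((s k).1 + 1, 0) := (hs k).trans (if_neg h)
      have hw : w (k + 1) = x ((s k).1 + 1) :=
        (hcongr _ _ e).trans (SimpleGraph.Walk.getVert_zero _)
      left
      rw [hw]
      simp only [w]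
      rw [le_antisymm (hlen k) (not_lt.1 h), SimpleGraph.Walk.getVert_length]
  obtain ⟨r, t, ht, hr⟩ := exists_ray_of_lazy_walk w hadj hwfin
  refine ⟨r, fun Z C hC => ?_⟩
  -- From some time on the walk avoids the finite set `Z`; if it is in `C` after that time, it stays
  -- there.
  have hZ : ∀ᶠ k in atTop, w k ∉ (Z : Set V) := by
    have : ∀ᶠ k in atTop, ∀ z ∈ Z, w k ≠ z := (eventually_all_finset Z).2 fun z _ => hwfin z
    filter_upwards [this] with k hk hkz using hk _ hkz rfl
  obtain ⟨N, hN⟩ := eventually_atTop.1 hZ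
  obtain ⟨n, hn, hnC⟩ := frequently_atTop.1 hC ((s N).1 + 1)
  obtain ⟨K, hK⟩ := hreach n
  have hNK : N ≤ K := by
    by_contra h
    have := hmono (not_le.1 h).le
    simp only [hK] at this
    omega
  have hwK : w K ∈ C := by simpa [w, hK] using hnC
  have htail : ∀ k, K ≤ k → w k ∈ C := by
    intro k hk
    induction k, hk using Nat.le_induction with
    | base => exact hwK
    | succ k hk ih =>
      rcases hadj k with h | h
      · rwa [← h]
      · exact SimpleGraph.ComponentCompl.mem_of_adj _ _ ih (hN _ (by omega)) h
  exact ⟨K, fun m hm => by rw [hr]; exact htail _ (hm.trans (ht.le_apply))⟩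

/-- Two vertices of the same component of `G - X` are joined by a walk in that component. -/
theorem exists_walk_in_component {G : SimpleGraph V} {X : Set V} (C : G.ComponentCompl X) {a b : V}
    (ha : a ∈ C) (hb : b ∈ C) : ∃ p : G.Walk a b, ∀ z ∈ p.support, z ∈ C := by
  obtain ⟨ha', haC⟩ := ha
  obtain ⟨hb', hbC⟩ := hb
  obtain ⟨q⟩ := SimpleGraph.ConnectedComponent.exact (haC.trans hbC.symm)
  classical
  let ι : G.induce Xᶜ →g G := ⟨Subtype.val, fun h => h⟩
  refine ⟨q.map ι, fun z hz => ?_⟩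
  rw [SimpleGraph.Walk.support_map, List.mem_map] at hz
  obtain ⟨y, hy, rfl⟩ := hz
  exact ⟨y.2, (SimpleGraph.ConnectedComponent.sound ⟨(q.takeUntil y hy).reverse⟩).trans haC⟩

/-- A walk that avoids `X` stays in one component of `G - X`. -/
theorem mem_component_of_walk {G : SimpleGraph V} {X : Set V} (C : G.ComponentCompl X) {a b : V}
    (p : G.Walk a b) (hp : ∀ z ∈ p.support, z ∉ X) (ha : a ∈ C) : b ∈ C := by
  induction p with
  | nil => exact ha
  | cons h q ih =>
    refine ih (fun z hz => hp z (by simp [hz])) ?_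
    exact SimpleGraph.ComponentCompl.mem_of_adj _ _ ha (hp _ (by simp)) h

theorem component_eq_of_mem {G : SimpleGraph V} {X : Set V} {C D : G.ComponentCompl X} {a : V}
    (hC : a ∈ C) (hD : a ∈ D) : C = D :=
  hC.choose_spec.symm.trans hD.choose_spec

theorem Ends.component_eq_of_tailIn {G : SimpleGraph V} {r : Ray G} {X : Finset V}
    {C : G.ComponentCompl (X : Set V)} (h : r.TailIn (C : Set V)) :
    Ends.component (Quotient.mk (raySetoid G) r) X = C :=
  r.component_unique (Ends.tailIn_component r X) h

/-- The components `C(X, ω)` of an end decrease as `X` grows. -/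
theorem Ends.component_anti {G : SimpleGraph V} (ω : Ends G) {X Y : Finset V} (h : X ⊆ Y) :
    (ω.component Y : Set V) ⊆ ω.component X := by
  induction ω using Quotient.inductionOn with
  | _ r =>
  have hXY : (X : Set V) ⊆ Y := Finset.coe_subset.2 h
  have := Ends.component_eq_of_tailIn (X := X) ((Ends.tailIn_component r Y).mono
    (SimpleGraph.ComponentCompl.subset_hom _ hXY))
  rw [this]
  exact SimpleGraph.ComponentCompl.subset_hom _ hXY

theorem Ends.ext_component {G : SimpleGraph V} {ω ω' : Ends G}
    (h : ∀ X : Finset V, ω.component X = ω'.component X) : ω = ω' := by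
  induction ω using Quotient.inductionOn with
  | _ r =>
  induction ω' using Quotient.inductionOn with
  | _ r' =>
  exact Quotient.sound fun X => ⟨_, Ends.tailIn_component r X,
    h X ▸ Ends.tailIn_component r' X⟩

/-! ### Directions come from ends -/

section Directions

open Filter

variable {G : SimpleGraph V} (f : ∀ X : Finset V, G.ComponentCompl (X : Set V))

/-- If infinitely many vertices cannot be separated from a direction by a finite set, then the
direction is defined by an end. -/
theorem exists_end_of_infinite_dominating
    (hinf : {v : V | ∀ X : Finset V, v ∉ X → v ∈ f X}.Infinite) :
    ∃ ω : Ends G, ∀ X, ω.component X = f X := by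
  classical
  set D : Set V := {v : V | ∀ X : Finset V, v ∉ X → v ∈ f X} with hD
  -- A state `(X, x)` consists of the current dominating vertex `x` and a finite set `X` of vertices
  -- to avoid. The next walk runs inside `f X` to a new dominating vertex `y`, and all its vertices
  -- except `y` join `X`.
  let S := {s : Finset V × V // s.2 ∈ D ∧ s.2 ∉ s.1}
  have hstep : ∀ s : S, ∃ (s' : S) (p : G.Walk s.1.2 s'.1.2), s.1.1 ⊆ s'.1.1 ∧ s.1.2 ∈ s'.1.1 ∧
      (∀ z ∈ p.support, z ∉ s.1.1) ∧ ∀ z ∈ p.support, z ∈ s'.1.1 ∨ z = s'.1.2 := by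
    rintro ⟨⟨X, x⟩, hx, hxX⟩
    obtain ⟨y, hy, hyX⟩ := hinf.exists_notMem_finset (insert x X)
    rw [Finset.mem_insert, not_or] at hyX
    obtain ⟨p, hp⟩ := exists_walk_in_component (f X) (hx X hxX) (hy X hyX.2)
    refine ⟨⟨((X ∪ p.support.toFinset).erase y, y), hy, by simp⟩, p, ?_, ?_, ?_, ?_⟩
    · intro z hz
      refine Finset.mem_erase.2 ⟨?_, Finset.mem_union_left _ hz⟩
      rintro rfl
      exact hyX.2 hz
    · exact Finset.mem_erase.2 ⟨Ne.symm hyX.1, by simp⟩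
    · exact fun z hz => SimpleGraph.ComponentCompl.notMem_of_mem (hp z hz)
    · intro z hz
      by_cases h : z = y
      · exact Or.inr h
      · exact Or.inl (Finset.mem_erase.2 ⟨h, by simp [hz]⟩)
  choose next p hsub hmem havoid hsupp using hstep
  obtain ⟨x₀, hx₀⟩ := hinf.nonempty
  let s : ℕ → S := fun n => Nat.rec ⟨(∅, x₀), hx₀, by simp⟩ (fun _ s => next s) n
  have hs : ∀ n, s (n + 1) = next (s n) := fun n => rfl
  have hmono : Monotone fun n => (s n).1.1 :=
    monotone_nat_of_le_succ fun n => by rw [hs]; exact hsub _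
  obtain ⟨r, hr⟩ := exists_ray_of_walks (fun n => (s n).1.2) (fun n => p (s n)) (by
    intro v
    by_cases h : ∃ n, v ∈ (s n).1.1
    · obtain ⟨n, hn⟩ := h
      exact eventually_atTop.2 ⟨n, fun m hm hv => havoid _ v hv (hmono hm hn)⟩
    · push Not at h
      -- Every vertex of the `n`th walk enters the avoided set at stage `n + 1`, except its last
      -- one, which enters at stage `n + 2`.
      refine Eventually.of_forall fun n hv => ?_
      rcases hsupp _ v hv with h' | h'
      · exact h (n + 1) h'
      · exact h (n + 2) (by rw [h']; exact hmem _))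
  refine ⟨Quotient.mk _ r, fun Z => Ends.component_eq_of_tailIn (hr Z _ ?_)⟩
  refine Eventually.frequently ?_
  have : ∀ z, ∀ᶠ n in atTop, (s n).1.2 ≠ z := by
    intro z
    by_cases h : ∃ n, (s n).1.2 = z
    · obtain ⟨n, rfl⟩ := h
      refine eventually_atTop.2 ⟨n + 1, fun m hm he => ?_⟩
      exact (s m).2.2 (he ▸ hmono hm (hmem _))
    · push Not at h
      exact Eventually.of_forall h
  filter_upwards [(eventually_all_finset Z).2 fun z _ => this z] with n hn
  exact (s n).2.1 Z fun hz => hn _ hz rfl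

/-- If only finitely many vertices cannot be separated from a direction by a finite set, then the
direction is defined by an end. -/
theorem exists_end_of_finite_dominating (hf : ∀ X Y : Finset V, X ⊆ Y → (f Y : Set V) ⊆ f X)
    (hfin : {v : V | ∀ X : Finset V, v ∉ X → v ∈ f X}.Finite) :
    ∃ ω : Ends G, ∀ X, ω.component X = f X := by
  classical
  let D : Finset V := hfin.toFinset
  have hsep : ∀ v ∉ D, ∃ X : Finset V, v ∉ X ∧ v ∉ f X := by
    intro v hv
    simpa [D] using hv
  choose! S hS hS' using hsep
  -- `S v` separates `v` from the direction. Once these sets are added, no vertex of `X` outside `D`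
  -- has a neighbour in `f (next X)`; this is `hnbr`.
  let next : Finset V → Finset V := fun X => X ∪ (X \ D).biUnion S
  obtain ⟨x₀, hx₀⟩ := (f D).nonempty
  let X : ℕ → Finset V := fun n => Nat.rec (insert x₀ D) (fun _ X => next X) n
  have hX : ∀ n, X (n + 1) = next (X n) := fun n => rfl
  have hmono : Monotone X :=
    monotone_nat_of_le_succ fun n => by rw [hX]; exact Finset.subset_union_left
  have hDX : ∀ n, D ⊆ X n := fun n => (Finset.subset_insert _ _).trans (hmono (Nat.zero_le n))
  have hnbr : ∀ n, ∀ y ∈ X n, y ∉ D → ∀ z ∈ f (X (n + 1)), ¬ G.Adj z y := by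
    intro n y hy hyD z hz hzy
    have hsub : S y ⊆ X (n + 1) :=
      (Finset.subset_biUnion_of_mem S (Finset.mem_sdiff.2 ⟨hy, hyD⟩)).trans
        Finset.subset_union_right
    exact hS' y hyD (SimpleGraph.ComponentCompl.mem_of_adj _ _ (hf _ _ hsub hz) (hS y hyD) hzy)
  -- The sets `f (X n)` have empty intersection. A walk in `f D` from a common vertex to `x₀` cannot
  -- leave the intersection: on leaving it would enter some `X n` outside `D` from a vertex of `f (X
  -- (n + 1))`, against `hnbr`. But `x₀` is in `X 0`.
  have hempty : ∀ z, ∃ n, z ∉ f (X n) := by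
    by_contra! hcon
    obtain ⟨z, hz⟩ := hcon
    have hzD : z ∈ f D := hf _ _ (hDX 0) (hz 0)
    obtain ⟨p, hp⟩ := exists_walk_in_component (f D) hzD hx₀
    have key : ∀ {a b : V} (p : G.Walk a b), (∀ v ∈ p.support, v ∈ f D) →
        (∀ n, a ∈ f (X n)) → ∀ n, b ∈ f (X n) := by
      intro a b p
      induction p with
      | nil => exact fun _ h => h
      | @cons a c b h q ih =>
        intro hq ha
        refine ih (fun v hv => hq v (by simp [hv])) fun n => ?_
        have hc : c ∉ D := fun hc =>
          SimpleGraph.ComponentCompl.notMem_of_mem (hq c (by simp)) (by simpa using hc)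
        refine SimpleGraph.ComponentCompl.mem_of_adj _ _ (ha n) (fun hcX => ?_) h
        exact hnbr n c hcX hc a (ha (n + 1)) h
    exact SimpleGraph.ComponentCompl.notMem_of_mem (key p hp hz 0)
      (Finset.mem_coe.2 (Finset.mem_insert_self _ _))
  have hanti : ∀ z, ∀ᶠ n in atTop, z ∉ f (X n) := by
    intro z
    obtain ⟨n, hn⟩ := hempty z
    exact eventually_atTop.2 ⟨n, fun m hm h => hn (hf _ _ (hmono hm) h)⟩
  have hne : ∀ n, ∃ x, x ∈ f (X n) := fun n => (f (X n)).nonempty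
  choose x hx using hne
  have hwalk : ∀ n, ∃ p : G.Walk (x n) (x (n + 1)), ∀ z ∈ p.support, z ∈ f (X n) := fun n =>
    exists_walk_in_component _ (hx n) (hf _ _ (hmono n.le_succ) (hx (n + 1)))
  choose p hp using hwalk
  obtain ⟨r, hr⟩ := exists_ray_of_walks x p fun v =>
    (hanti v).mono fun n hn h => hn (hp n v h)
  refine ⟨Quotient.mk _ r, fun Z => Ends.component_eq_of_tailIn (hr Z _ ?_)⟩
  refine Eventually.frequently ?_
  filter_upwards [(eventually_all_finset Z).2 fun z _ => hanti z] with n hn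
  -- Since `f (X n)` misses `Z`, it lies in one component of G - Z. That component is `f Z`, as `f
  -- (X n ∪ Z)` is contained in both `f (X n)` and `f Z`.
  obtain ⟨y, hy⟩ := (f (X n ∪ Z)).nonempty
  obtain ⟨q, hq⟩ := exists_walk_in_component (f (X n)) (hf _ _ Finset.subset_union_left hy) (hx n)
  exact mem_component_of_walk (f Z) q (fun z hz hzZ => hn z hzZ (hq z hz))
    (hf _ _ Finset.subset_union_right hy)

/-- Every direction of a graph is defined by an end. -/
theorem exists_end_of_direction (hf : ∀ X Y : Finset V, X ⊆ Y → (f Y : Set V) ⊆ f X) :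
    ∃ ω : Ends G, ∀ X, ω.component X = f X := by
  by_cases h : {v : V | ∀ X : Finset V, v ∉ X → v ∈ f X}.Finite
  · exact exists_end_of_finite_dominating f hf h
  · exact exists_end_of_infinite_dominating f h

end Directions

/-! ### The topology of the 1-complex -/

section Complex

variable {G : SimpleGraph V}

@[simp]
theorem vertex_mem_openStar {x y : V} {i : G.edgeSet → Ioo (0 : ℝ) 1} :
    Complex.vertex y ∈ openStar x i ↔ y = x := by
  simp [openStar]

@[simp]
theorem inner_mem_openStar {x : V} {i : G.edgeSet → Ioo (0 : ℝ) 1} {e : G.edgeSet}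
    {t : Ioo (0 : ℝ) 1} :
    Complex.inner e t ∈ openStar x i ↔ x ∈ (e : Sym2 V) ∧ distFrom x e t < i e := by
  simp only [openStar, mem_union, mem_singleton_iff, mem_ofPred_eq, reduceCtorEq, false_or]
  constructor
  · rintro ⟨e', t', h1, h2, h3⟩
    cases h3
    exact ⟨h1, h2⟩
  · rintro ⟨h1, h2⟩
    exact ⟨e, t, h1, h2, rfl⟩

/-- The basic open interval of inner points of the edge `e` with parameters between `a` and `b`. -/
def edgeInterval (e : G.edgeSet) (a b : ℝ) : Set (Complex G) :=
  Complex.inner e '' {t | a < (t : ℝ) ∧ (t : ℝ) < b}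

@[simp]
theorem vertex_notMem_edgeInterval {x : V} {e : G.edgeSet} {a b : ℝ} :
    Complex.vertex x ∉ edgeInterval e a b := by
  simp [edgeInterval]

@[simp]
theorem inner_mem_edgeInterval {e e' : G.edgeSet} {a b : ℝ} {t : Ioo (0 : ℝ) 1} :
    Complex.inner e' t ∈ edgeInterval e a b ↔ e' = e ∧ a < (t : ℝ) ∧ (t : ℝ) < b := by
  simp only [edgeInterval, mem_image, mem_ofPred_eq]
  constructor
  · rintro ⟨t', h, h'⟩
    cases h'
    exact ⟨rfl, h⟩
  · rintro ⟨rfl, h⟩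
    exact ⟨t, h, rfl⟩

theorem openStar_mem_basicOpens (x : V) (i : G.edgeSet → Ioo (0 : ℝ) 1) :
    openStar x i ∈ basicOpens G :=
  Or.inl ⟨x, i, rfl⟩

theorem edgeInterval_mem_basicOpens (e : G.edgeSet) (a b : ℝ) :
    edgeInterval e a b ∈ basicOpens G :=
  Or.inr ⟨e, a, b, rfl⟩

theorem isOpen_openStar (x : V) (i : G.edgeSet → Ioo (0 : ℝ) 1) : IsOpen (openStar x i) :=
  TopologicalSpace.isOpen_generateFrom_of_mem (openStar_mem_basicOpens x i)

/-- Inner edge points have small intervals inside every basic open set that contains them. -/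
theorem exists_edgeInterval_subset {B : Set (Complex G)} (hB : B ∈ basicOpens G) {e : G.edgeSet}
    {t : Ioo (0 : ℝ) 1} (ht : Complex.inner e t ∈ B) :
    ∃ a b : ℝ, Complex.inner e t ∈ edgeInterval e a b ∧ edgeInterval e a b ⊆ B := by
  rcases hB with ⟨x, i, rfl⟩ | ⟨e', a, b, rfl⟩
  · rw [inner_mem_openStar] at ht
    obtain ⟨hx, hd⟩ := ht
    by_cases h : x = (Quot.out (e : Sym2 V)).1
    · rw [distFrom, if_pos h] at hd
      refine ⟨-1, i e, by simpa using ⟨by linarith [t.2.1], hd⟩, ?_⟩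
      rintro _ ⟨s, hs, rfl⟩
      rw [inner_mem_openStar, distFrom, if_pos h]
      exact ⟨hx, hs.2⟩
    · rw [distFrom, if_neg h] at hd
      refine ⟨1 - i e, 2, by simpa using ⟨by linarith, by linarith [t.2.2]⟩, ?_⟩
      rintro _ ⟨s, hs, rfl⟩
      rw [inner_mem_openStar, distFrom, if_neg h]
      exact ⟨hx, by linarith [hs.1]⟩
  · obtain ⟨rfl, -⟩ := inner_mem_edgeInterval.1 ht
    exact ⟨a, b, ht, subset_rfl⟩

/-- The basic open sets form a basis of the topology of the 1-complex. -/
theorem isTopologicalBasis_basicOpens (G : SimpleGraph V) :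
    TopologicalSpace.IsTopologicalBasis (basicOpens G) where
  eq_generateFrom := rfl
  sUnion_eq := by
    refine eq_univ_of_forall fun p => ?_
    rcases p with x | ⟨e, t⟩
    · exact ⟨_, openStar_mem_basicOpens x fun _ => ⟨1 / 2, by norm_num, by norm_num⟩, by simp⟩
    · exact ⟨_, edgeInterval_mem_basicOpens e (-1) 2,
        by simpa using ⟨by linarith [t.2.1], by linarith [t.2.2]⟩⟩
  exists_subset_inter := by
    intro B₁ h₁ B₂ h₂ p hp
    rcases p with x | ⟨e, t⟩
    · have key : ∀ B ∈ basicOpens G, Complex.vertex x ∈ B →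
          ∃ i : G.edgeSet → Ioo (0 : ℝ) 1, B = openStar x i := by
        rintro B (⟨y, i, rfl⟩ | ⟨e, a, b, rfl⟩) hx
        · rw [vertex_mem_openStar] at hx
          exact ⟨i, by rw [hx]⟩
        · exact absurd hx vertex_notMem_edgeInterval
      obtain ⟨i, rfl⟩ := key B₁ h₁ hp.1
      obtain ⟨j, rfl⟩ := key B₂ h₂ hp.2
      refine ⟨_, openStar_mem_basicOpens x fun e => min (i e) (j e), by simp, ?_⟩
      rintro (y | ⟨e, t⟩) hq
      · simpa using hq
      · rw [inner_mem_openStar] at hq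
        have h1 : ((min (i e) (j e) : Ioo (0 : ℝ) 1) : ℝ) ≤ i e :=
          Subtype.coe_le_coe.2 (min_le_left _ _)
        have h2 : ((min (i e) (j e) : Ioo (0 : ℝ) 1) : ℝ) ≤ j e :=
          Subtype.coe_le_coe.2 (min_le_right _ _)
        exact ⟨inner_mem_openStar.2 ⟨hq.1, hq.2.trans_le h1⟩,
          inner_mem_openStar.2 ⟨hq.1, hq.2.trans_le h2⟩⟩
    · obtain ⟨a, b, hab, hs⟩ := exists_edgeInterval_subset h₁ hp.1
      obtain ⟨c, d, hcd, hs'⟩ := exists_edgeInterval_subset h₂ hp.2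
      rw [inner_mem_edgeInterval] at hab hcd
      refine ⟨_, edgeInterval_mem_basicOpens e (max a c) (min b d), ?_, ?_⟩
      · rw [inner_mem_edgeInterval]
        exact ⟨rfl, max_lt hab.2.1 hcd.2.1, lt_min hab.2.2 hcd.2.2⟩
      · rintro _ ⟨s, hs₀, rfl⟩
        exact ⟨hs (inner_mem_edgeInterval.2 ⟨rfl, (le_max_left _ _).trans_lt hs₀.1,
          hs₀.2.trans_le (min_le_left _ _)⟩), hs' (inner_mem_edgeInterval.2 ⟨rfl,
          (le_max_right _ _).trans_lt hs₀.1, hs₀.2.trans_le (min_le_right _ _)⟩)⟩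

/-- A union of vertices and full edges that contains all edges at its vertices is open. -/
theorem isOpen_of_edges {U : Set (Complex G)}
    (hv : ∀ x, Complex.vertex x ∈ U → ∀ (e : G.edgeSet) t, x ∈ (e : Sym2 V) → Complex.inner e t ∈ U)
    (he : ∀ (e : G.edgeSet) t s, Complex.inner e t ∈ U → Complex.inner e s ∈ U) : IsOpen U := by
  rw [(isTopologicalBasis_basicOpens G).isOpen_iff]
  rintro (x | ⟨e, t⟩) hp
  · refine ⟨_, openStar_mem_basicOpens x fun _ => ⟨1 / 2, by norm_num, by norm_num⟩, by simp, ?_⟩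
    rintro (y | ⟨e, t⟩) hq
    · rw [vertex_mem_openStar] at hq
      rwa [hq]
    · exact hv x hp e t (inner_mem_openStar.1 hq).1
  · refine ⟨_, edgeInterval_mem_basicOpens e (-1) 2,
      by simpa using ⟨by linarith [t.2.1], by linarith [t.2.2]⟩, ?_⟩
    rintro _ ⟨s, -, rfl⟩
    exact he e t s hp

theorem vertex_mem_complexPart {X : Finset V} {𝒞 : Set (G.ComponentCompl (X : Set V))} {x : V} :
    Complex.vertex x ∈ complexPart X 𝒞 ↔ x ∈ vertexUnion 𝒞 := by
  simp [complexPart]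

theorem mem_vertexUnion {X : Finset V} {𝒞 : Set (G.ComponentCompl (X : Set V))} {x : V} :
    x ∈ vertexUnion 𝒞 ↔ ∃ C ∈ 𝒞, x ∈ C := by
  simp [vertexUnion]

/-- An edge with one end in a component of G - X has its other end in the same component or in X. -/
theorem inner_mem_complexPart {X : Finset V} {𝒞 : Set (G.ComponentCompl (X : Set V))}
    {e : G.edgeSet} {t : Ioo (0 : ℝ) 1} :
    Complex.inner e t ∈ complexPart X 𝒞 ↔ ∃ x ∈ (e : Sym2 V), x ∈ vertexUnion 𝒞 := by
  constructor
  · rintro (⟨x, -, h⟩ | ⟨e', t', h, h'⟩)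
    · cases h
    · cases h
      rcases h' with ⟨C, hC, hx⟩ | ⟨x, -, y, hy, he⟩
      · obtain ⟨x, hxe⟩ : ∃ x, x ∈ (e : Sym2 V) := ⟨_, Sym2.out_fst_mem _⟩
        exact ⟨x, hxe, mem_vertexUnion.2 ⟨C, hC, hx x hxe⟩⟩
      · exact ⟨y, by simp [he], hy⟩
  · rintro ⟨x, hxe, hx⟩
    obtain ⟨y, hy⟩ := Sym2.mem_iff_exists.1 hxe
    refine Or.inr ⟨e, t, rfl, ?_⟩
    obtain ⟨C, hC, hxC⟩ := mem_vertexUnion.1 hx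
    have hadj : G.Adj x y := by
      rw [← SimpleGraph.mem_edgeSet, ← hy]
      exact e.2
    by_cases hyX : y ∈ X
    · exact Or.inr ⟨y, hyX, x, hx, by rw [hy, Sym2.eq_swap]⟩
    · refine Or.inl ⟨C, hC, fun z hz => ?_⟩
      rw [hy, Sym2.mem_iff] at hz
      rcases hz with rfl | rfl
      · exact hxC
      · exact SimpleGraph.ComponentCompl.mem_of_adj _ _ hxC (by simpa using hyX) hadj

theorem isOpen_complexPart (X : Finset V) (𝒞 : Set (G.ComponentCompl (X : Set V))) :
    IsOpen (complexPart X 𝒞) := by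
  refine isOpen_of_edges (fun x hx e t hxe => ?_) fun e t s h => ?_
  · exact inner_mem_complexPart.2 ⟨x, hxe, vertex_mem_complexPart.1 hx⟩
  · exact inner_mem_complexPart.2 (inner_mem_complexPart.1 h)

end Complex

/-! ### The topology of `|G|_Ω` -/

section EndSpace

variable {G : SimpleGraph V}

theorem EndSpace.ofComplex_injective :
    Function.Injective (EndSpace.ofComplex : Complex G → EndSpace G) :=
  fun _ _ h => EndSpace.ofComplex.inj h

theorem EndSpace.vertex_mem_nhd {X : Finset V} {𝒞 : Set (G.ComponentCompl (X : Set V))} {x : V} :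
    EndSpace.ofComplex (Complex.vertex x) ∈ EndSpace.nhd X 𝒞 ↔ x ∈ vertexUnion 𝒞 := by
  simp [EndSpace.nhd, vertex_mem_complexPart]

theorem EndSpace.inner_mem_nhd {X : Finset V} {𝒞 : Set (G.ComponentCompl (X : Set V))}
    {e : G.edgeSet} {t : Ioo (0 : ℝ) 1} :
    EndSpace.ofComplex (Complex.inner e t) ∈ EndSpace.nhd X 𝒞 ↔
      ∃ x ∈ (e : Sym2 V), x ∈ vertexUnion 𝒞 := by
  simp only [EndSpace.nhd, mem_union, mem_image, EndSpace.ofComplex.injEq, exists_eq_right,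
    reduceCtorEq, and_false, exists_false, or_false, inner_mem_complexPart]

theorem EndSpace.ofEnd_mem_nhd {X : Finset V} {𝒞 : Set (G.ComponentCompl (X : Set V))}
    {ω : Ends G} : EndSpace.ofEnd ω ∈ EndSpace.nhd X 𝒞 ↔ ω.component X ∈ 𝒞 := by
  simp [EndSpace.nhd]

theorem EndSpace.nhd_mono {X : Finset V} {𝒞 𝒟 : Set (G.ComponentCompl (X : Set V))}
    (h : 𝒞 ⊆ 𝒟) : EndSpace.nhd X 𝒞 ⊆ EndSpace.nhd X 𝒟 := by
  have hu : vertexUnion 𝒞 ⊆ vertexUnion 𝒟 := biUnion_subset_biUnion_left h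
  rintro ((x | ⟨e, t⟩) | ω) hp
  · exact EndSpace.vertex_mem_nhd.2 (hu (EndSpace.vertex_mem_nhd.1 hp))
  · obtain ⟨x, hx, hx'⟩ := EndSpace.inner_mem_nhd.1 hp
    exact EndSpace.inner_mem_nhd.2 ⟨x, hx, hu hx'⟩
  · exact EndSpace.ofEnd_mem_nhd.2 (h (EndSpace.ofEnd_mem_nhd.1 hp))

theorem EndSpace.nhd_singleton_anti {X Y : Finset V} {C : G.ComponentCompl (X : Set V)}
    {D : G.ComponentCompl (Y : Set V)} (hXY : X ⊆ Y) (h : (D : Set V) ⊆ C) :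
    EndSpace.nhd Y {D} ⊆ EndSpace.nhd X {C} := by
  have hu : vertexUnion {D} ⊆ vertexUnion {C} := by simpa [vertexUnion] using h
  rintro ((x | ⟨e, t⟩) | ω) hp
  · exact EndSpace.vertex_mem_nhd.2 (hu (EndSpace.vertex_mem_nhd.1 hp))
  · obtain ⟨x, hx, hx'⟩ := EndSpace.inner_mem_nhd.1 hp
    exact EndSpace.inner_mem_nhd.2 ⟨x, hx, hu hx'⟩
  · rw [EndSpace.ofEnd_mem_nhd, mem_singleton_iff] at hp ⊢
    obtain ⟨x, hx⟩ := D.nonempty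
    exact component_eq_of_mem (ω.component_anti hXY (hp ▸ hx)) (h hx)

theorem EndSpace.isOpen_nhd (X : Finset V) (𝒞 : Set (G.ComponentCompl (X : Set V))) :
    IsOpen (EndSpace.nhd X 𝒞) :=
  TopologicalSpace.isOpen_generateFrom_of_mem (Or.inr ⟨X, 𝒞, rfl⟩)

theorem EndSpace.isOpenEmbedding_ofComplex :
    IsOpenEmbedding (EndSpace.ofComplex : Complex G → EndSpace G) := by
  refine .of_continuous_injective_isOpenMap ?_ EndSpace.ofComplex_injective fun U hU =>
    TopologicalSpace.isOpen_generateFrom_of_mem (Or.inl ⟨U, hU, rfl⟩)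
  refine continuous_generateFrom_iff.2 ?_
  rintro W (⟨U, hU, rfl⟩ | ⟨X, 𝒞, rfl⟩)
  · rwa [preimage_image_eq _ EndSpace.ofComplex_injective]
  · convert isOpen_complexPart X 𝒞 using 1
    ext p
    simp [EndSpace.nhd]

/-- Among the generating sets only those of the form `nhd` contain ends, and an intersection of two
neighbourhoods is handled by passing to `X ∪ Y`, where the component of `ω` shrinks. -/
theorem EndSpace.mem_nhds_ofEnd {ω : Ends G} {W : Set (EndSpace G)} :
    W ∈ 𝓝 (EndSpace.ofEnd ω) ↔ ∃ X : Finset V, EndSpace.nhd X {ω.component X} ⊆ W := by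
  classical
  constructor
  · intro hW
    obtain ⟨O, hOW, hO, hω⟩ := mem_nhds_iff.1 hW
    suffices ∃ X : Finset V, EndSpace.nhd X {ω.component X} ⊆ O from
      this.imp fun X hX => hX.trans hOW
    clear hOW
    induction hO with
    | basic s hs =>
      rcases hs with ⟨U, hU, rfl⟩ | ⟨X, 𝒞, rfl⟩
      · obtain ⟨_, _, h⟩ := hω
        cases h
      · exact ⟨X, EndSpace.nhd_mono (singleton_subset_iff.2 (EndSpace.ofEnd_mem_nhd.1 hω))⟩
    | univ => exact ⟨∅, subset_univ _⟩
    | inter s t _ _ ihs iht =>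
      obtain ⟨X, hX⟩ := ihs hω.1
      obtain ⟨Y, hY⟩ := iht hω.2
      exact ⟨X ∪ Y, subset_inter
        ((EndSpace.nhd_singleton_anti Finset.subset_union_left
          (ω.component_anti Finset.subset_union_left)).trans hX)
        ((EndSpace.nhd_singleton_anti Finset.subset_union_right
          (ω.component_anti Finset.subset_union_right)).trans hY)⟩
    | sUnion S _ ih =>
      obtain ⟨s, hs, hωs⟩ := hω
      obtain ⟨X, hX⟩ := ih s hs hωs
      exact ⟨X, hX.trans (subset_sUnion_of_mem hs)⟩
  · rintro ⟨X, hX⟩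
    exact Filter.mem_of_superset ((EndSpace.isOpen_nhd X _).mem_nhds
      (EndSpace.ofEnd_mem_nhd.2 (mem_singleton _))) hX

theorem inner_mem_innerPoints (e : G.edgeSet) (t : Ioo (0 : ℝ) 1) :
    EndSpace.ofComplex (Complex.inner e t) ∈ innerPoints G :=
  ⟨e, t, rfl⟩

theorem vertex_notMem_innerPoints (x : V) :
    EndSpace.ofComplex (Complex.vertex x) ∈ (innerPoints G)ᶜ := by
  rintro ⟨e, t, h⟩
  cases h

theorem ofEnd_notMem_innerPoints (ω : Ends G) : EndSpace.ofEnd ω ∈ (innerPoints G)ᶜ := by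
  rintro ⟨e, t, h⟩
  cases h

theorem inner_mem_innerPointsAt {x : V} {e : G.edgeSet} {t : Ioo (0 : ℝ) 1} :
    EndSpace.ofComplex (Complex.inner e t) ∈ innerPointsAt G x ↔ x ∈ (e : Sym2 V) := by
  constructor
  · rintro ⟨e', t', h, h'⟩
    cases h'
    exact h
  · exact fun h => ⟨e, t, h, rfl⟩

theorem innerPointsAt_subset (x : V) : innerPointsAt G x ⊆ innerPoints G := by
  rintro _ ⟨e, t, -, rfl⟩
  exact inner_mem_innerPoints e t

theorem isOpen_innerPoints (G : SimpleGraph V) : IsOpen (innerPoints G) := by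
  have : innerPoints G = EndSpace.ofComplex '' {p | ∃ e t, p = Complex.inner e t} := by
    ext p
    constructor
    · rintro ⟨e, t, rfl⟩
      exact ⟨_, ⟨e, t, rfl⟩, rfl⟩
    · rintro ⟨_, ⟨e, t, rfl⟩, rfl⟩
      exact ⟨e, t, rfl⟩
  rw [this]
  refine EndSpace.isOpenEmbedding_ofComplex.isOpenMap _ (isOpen_of_edges ?_ ?_)
  · rintro x ⟨e, t, h⟩
    cases h
  · exact fun e _ s _ => ⟨e, s, rfl⟩

/-- The open star around the vertex `x` that contains the half of every edge at `x`. -/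
def halfStar (G : SimpleGraph V) (x : V) : Set (EndSpace G) :=
  EndSpace.ofComplex '' openStar x fun _ => ⟨1 / 2, by norm_num, by norm_num⟩

theorem isOpen_halfStar (x : V) : IsOpen (halfStar G x) :=
  EndSpace.isOpenEmbedding_ofComplex.isOpenMap _ (isOpen_openStar _ _)

theorem vertex_mem_halfStar (x : V) : EndSpace.ofComplex (Complex.vertex x) ∈ halfStar G x :=
  ⟨_, by simp, rfl⟩

theorem eq_vertex_of_mem_halfStar {x : V} {p : EndSpace G} (h : p ∈ halfStar G x)
    (hp : p ∈ (innerPoints G)ᶜ) : p = EndSpace.ofComplex (Complex.vertex x) := by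
  obtain ⟨y | ⟨e, t⟩, hy, rfl⟩ := h
  · rw [vertex_mem_openStar.1 hy]
  · exact absurd (inner_mem_innerPoints e t) hp

/-- The points of `|G|_Ω` that are not inner edge points are the vertices and the ends. -/
theorem vertex_or_end_of_notMem_innerPoints {p : EndSpace G} (hp : p ∈ (innerPoints G)ᶜ) :
    (∃ x, p = EndSpace.ofComplex (Complex.vertex x)) ∨ ∃ ω, p = EndSpace.ofEnd ω := by
  rcases p with (x | ⟨e, t⟩) | ω
  · exact Or.inl ⟨x, rfl⟩
  · exact absurd (inner_mem_innerPoints e t) hp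
  · exact Or.inr ⟨ω, rfl⟩

/-- Half-stars isolate the vertices, and distinct ends have distinct components for some `X`.
Deleting the inner edge points matters: in |G|_Ω an end cannot be separated from a vertex with a
neighbour in every C(X, ω), because neighbourhoods of ends contain whole edges. -/
instance t2Space_compl_innerPoints (G : SimpleGraph V) : T2Space ↥(innerPoints G)ᶜ := by
  have key : ∀ (x : V) (q : EndSpace G), q ≠ EndSpace.ofComplex (Complex.vertex x) →
      q ∈ (innerPoints G)ᶜ → ∃ U W : Set (EndSpace G), IsOpen U ∧ IsOpen W ∧
        EndSpace.ofComplex (Complex.vertex x) ∈ U ∧ q ∈ W ∧ U ∩ W ∩ (innerPoints G)ᶜ = ∅ := by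
    intro x q hne hq
    rcases vertex_or_end_of_notMem_innerPoints hq with ⟨y, rfl⟩ | ⟨ω, rfl⟩
    · refine ⟨_, _, isOpen_halfStar x, isOpen_halfStar y, vertex_mem_halfStar x,
        vertex_mem_halfStar y, eq_empty_of_forall_notMem ?_⟩
      rintro p ⟨⟨h1, h2⟩, h3⟩
      exact hne ((eq_vertex_of_mem_halfStar h2 h3).symm.trans (eq_vertex_of_mem_halfStar h1 h3))
    · refine ⟨_, _, isOpen_halfStar x, EndSpace.isOpen_nhd {x} {ω.component {x}},
        vertex_mem_halfStar x, EndSpace.ofEnd_mem_nhd.2 rfl, eq_empty_of_forall_notMem ?_⟩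
      rintro p ⟨⟨h1, h2⟩, h3⟩
      rw [eq_vertex_of_mem_halfStar h1 h3, EndSpace.vertex_mem_nhd, mem_vertexUnion] at h2
      obtain ⟨C, -, hC⟩ := h2
      exact SimpleGraph.ComponentCompl.notMem_of_mem hC (by simp)
  have sep : ∀ p q : EndSpace G, p ≠ q → p ∈ (innerPoints G)ᶜ → q ∈ (innerPoints G)ᶜ →
      ∃ U W : Set (EndSpace G), IsOpen U ∧ IsOpen W ∧ p ∈ U ∧ q ∈ W ∧
        U ∩ W ∩ (innerPoints G)ᶜ = ∅ := by
    intro p q hne hp hq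
    rcases vertex_or_end_of_notMem_innerPoints hp with ⟨x, rfl⟩ | ⟨ω, rfl⟩
    · exact key x q hne.symm hq
    rcases vertex_or_end_of_notMem_innerPoints hq with ⟨y, rfl⟩ | ⟨ω', rfl⟩
    · obtain ⟨U, W, hU, hW, h1, h2, h3⟩ := key y _ hne hp
      exact ⟨W, U, hW, hU, h2, h1, by rwa [inter_comm W]⟩
    · have : ∃ X : Finset V, ω.component X ≠ ω'.component X := by
        by_contra! h
        exact hne (congrArg _ (Ends.ext_component h))
      obtain ⟨X, hX⟩ := this
      refine ⟨_, _, EndSpace.isOpen_nhd X {ω.component X}, EndSpace.isOpen_nhd X {ω'.component X},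
        EndSpace.ofEnd_mem_nhd.2 rfl, EndSpace.ofEnd_mem_nhd.2 rfl, eq_empty_of_forall_notMem ?_⟩
      rintro p ⟨⟨h1, h2⟩, h3⟩
      rcases vertex_or_end_of_notMem_innerPoints h3 with ⟨z, rfl⟩ | ⟨ω'', rfl⟩
      · rw [EndSpace.vertex_mem_nhd, mem_vertexUnion] at h1 h2
        obtain ⟨C, rfl, hC⟩ := h1
        obtain ⟨D, rfl, hD⟩ := h2
        exact hX (component_eq_of_mem hC hD)
      · rw [EndSpace.ofEnd_mem_nhd, mem_singleton_iff] at h1 h2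
        exact hX (h1.symm.trans h2)
  refine ⟨fun p q hne => ?_⟩
  obtain ⟨U, W, hU, hW, h1, h2, h3⟩ := sep p q (fun h => hne (Subtype.ext h)) p.2 q.2
  refine ⟨_, _, hU.preimage continuous_subtype_val, hW.preimage continuous_subtype_val, h1, h2, ?_⟩
  rw [disjoint_iff_inter_eq_empty]
  refine eq_empty_of_forall_notMem fun z hz => ?_
  have : (z : EndSpace G) ∈ U ∩ W ∩ (innerPoints G)ᶜ := ⟨hz, z.2⟩
  rw [h3] at this
  exact this

/-- Only finitely many components of `G - Y` contain a vertex of a given compact set of vertices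
and ends. -/
theorem finite_components_of_isCompact {S : Set (EndSpace G)} (hS : IsCompact S)
    (hS' : S ⊆ (innerPoints G)ᶜ) (Y : Finset V) :
    {D : G.ComponentCompl (Y : Set V) |
      ∃ x ∈ D, EndSpace.ofComplex (Complex.vertex x) ∈ S}.Finite := by
  refine hS.induction_on (p := fun S => {D : G.ComponentCompl (Y : Set V) |
      ∃ x ∈ D, EndSpace.ofComplex (Complex.vertex x) ∈ S}.Finite) (by simp) ?_ ?_ ?_
  · exact fun s t hst ht => ht.subset fun D ⟨x, hx, hxs⟩ => ⟨x, hx, hst hxs⟩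
  · intro s t hs ht
    refine (hs.union ht).subset ?_
    rintro D ⟨x, hx, hxs | hxt⟩
    exacts [Or.inl ⟨x, hx, hxs⟩, Or.inr ⟨x, hx, hxt⟩]
  -- Locally at most one component is involved: a vertex is isolated, and the vertices of `nhd Y
  -- {C(Y, ω)}` all lie in C(Y, ω).
  · intro p hp
    rcases vertex_or_end_of_notMem_innerPoints (hS' hp) with ⟨x, rfl⟩ | ⟨ω, rfl⟩
    · refine ⟨_, mem_nhdsWithin_of_mem_nhds ((isOpen_halfStar x).mem_nhds (vertex_mem_halfStar x)),
        Set.Subsingleton.finite ?_⟩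
      rintro D ⟨y, hy, hyx⟩ D' ⟨y', hy', hyx'⟩
      have h := (eq_vertex_of_mem_halfStar hyx (vertex_notMem_innerPoints _)).trans
        (eq_vertex_of_mem_halfStar hyx' (vertex_notMem_innerPoints _)).symm
      cases h
      exact component_eq_of_mem hy hy'
    · refine ⟨_, mem_nhdsWithin_of_mem_nhds ((EndSpace.isOpen_nhd Y {ω.component Y}).mem_nhds
        (EndSpace.ofEnd_mem_nhd.2 rfl)), (finite_singleton (ω.component Y)).subset ?_⟩
      rintro D ⟨y, hy, hyx⟩
      rw [EndSpace.vertex_mem_nhd, mem_vertexUnion] at hyx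
      obtain ⟨C, rfl, hC⟩ := hyx
      exact component_eq_of_mem hy hC

open Filter in
/-- If only finitely many components of `G - Y` lie in the components in `𝒞 ⊆ 𝒞_X`, for every
finite `Y ⊇ X`, then the vertices and ends in the components in `𝒞` form a compact set. -/
theorem isCompact_nhd {X : Finset V} {𝒞 : Set (G.ComponentCompl (X : Set V))}
    (hfin : ∀ Y : Finset V, X ⊆ Y →
      {D : G.ComponentCompl (Y : Set V) | (D : Set V) ⊆ vertexUnion 𝒞}.Finite) :
    IsCompact (EndSpace.nhd X 𝒞 ∩ (innerPoints G)ᶜ) := by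
  classical
  refine isCompact_iff_ultrafilter_le_nhds'.2 fun U hU => ?_
  -- An ultrafilter containing a vertex singleton converges to that vertex. Any other contains, by
  -- finiteness, `nhd Y {D}` for a component `D` of G - Y.
  by_cases hv : ∃ x, {EndSpace.ofComplex (Complex.vertex x)} ∈ U
  · obtain ⟨x, hx⟩ := hv
    obtain ⟨q, hqx, hq⟩ := U.nonempty_of_mem (inter_mem hx hU)
    obtain rfl := mem_singleton_iff.1 hqx
    refine ⟨_, hq, ?_⟩
    exact (le_principal_iff.2 hx).trans (principal_singleton _ ▸ pure_le_nhds _)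
  push Not at hv
  have hbig : ∀ Y : Finset V, X ⊆ Y →
      ∃ D : G.ComponentCompl (Y : Set V), EndSpace.nhd Y {D} ∈ U := by
    intro Y hXY
    have hcov : EndSpace.nhd X 𝒞 ∩ (innerPoints G)ᶜ ⊆
        (⋃ x ∈ (Y : Set V), {EndSpace.ofComplex (Complex.vertex x)}) ∪
        ⋃ D ∈ {D : G.ComponentCompl (Y : Set V) | (D : Set V) ⊆ vertexUnion 𝒞},
          EndSpace.nhd Y {D} := by
      rintro p ⟨hp, hp'⟩
      rcases vertex_or_end_of_notMem_innerPoints hp' with ⟨x, rfl⟩ | ⟨ω, rfl⟩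
      · by_cases hx : x ∈ (Y : Set V)
        · exact Or.inl (mem_biUnion hx rfl)
        · obtain ⟨C, hC, hxC⟩ := mem_vertexUnion.1 (EndSpace.vertex_mem_nhd.1 hp)
          refine Or.inr (mem_biUnion (x := G.componentComplMk hx) ?_ ?_)
          · have hXY' : (X : Set V) ⊆ Y := Finset.coe_subset.2 hXY
            have := SimpleGraph.ComponentCompl.subset_hom (G.componentComplMk hx) hXY'
            rw [component_eq_of_mem (this (G.componentComplMk_mem hx)) hxC] at this
            exact fun y hy => mem_vertexUnion.2 ⟨C, hC, this hy⟩
          · exact EndSpace.vertex_mem_nhd.2 (mem_vertexUnion.2 ⟨_, rfl, G.componentComplMk_mem hx⟩)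
      · refine Or.inr (mem_biUnion (x := ω.component Y) ?_ (EndSpace.ofEnd_mem_nhd.2 rfl))
        exact fun y hy => mem_vertexUnion.2
          ⟨_, EndSpace.ofEnd_mem_nhd.1 hp, ω.component_anti hXY hy⟩
    rcases Ultrafilter.union_mem_iff.1 (mem_of_superset hU hcov) with h | h
    · obtain ⟨x, -, hx⟩ := (Ultrafilter.finite_biUnion_mem_iff Y.finite_toSet).1 h
      exact absurd hx (hv x)
    · obtain ⟨D, -, hD⟩ := (Ultrafilter.finite_biUnion_mem_iff (hfin Y hXY)).1 h
      exact ⟨D, hD⟩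
  -- Finiteness is only known for supersets of `X`; for general `Y`, take the component of G - Y
  -- that contains the one selected for `X ∪ Y`.
  have hall : ∀ Y : Finset V, ∃ D : G.ComponentCompl (Y : Set V), EndSpace.nhd Y {D} ∈ U := by
    intro Y
    obtain ⟨D, hD⟩ := hbig (X ∪ Y) Finset.subset_union_left
    have hsub : (Y : Set V) ⊆ ↑(X ∪ Y) := Finset.coe_subset.2 Finset.subset_union_right
    exact ⟨D.hom hsub, mem_of_superset hD (EndSpace.nhd_singleton_anti Finset.subset_union_right
      (D.subset_hom hsub))⟩
  choose f hf using hall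
  have hZ : (innerPoints G)ᶜ ∈ U := mem_of_superset hU inter_subset_right
  -- Two selected neighbourhoods share a vertex or an end, which forces their components to be
  -- nested.
  obtain ⟨ω, hω⟩ := exists_end_of_direction f fun Y Y' hYY' => by
    obtain ⟨p, ⟨hp, hp'⟩, hpZ⟩ := U.nonempty_of_mem (inter_mem (inter_mem (hf Y) (hf Y')) hZ)
    rcases vertex_or_end_of_notMem_innerPoints hpZ with ⟨x, rfl⟩ | ⟨ω, rfl⟩
    · rw [EndSpace.vertex_mem_nhd, mem_vertexUnion] at hp hp'
      obtain ⟨C, rfl, hC⟩ := hp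
      obtain ⟨D, rfl, hD⟩ := hp'
      have hsub : (Y : Set V) ⊆ Y' := Finset.coe_subset.2 hYY'
      rw [← SimpleGraph.ComponentCompl.hom_eq_iff_le _ hsub,
        SimpleGraph.ComponentCompl.hom_eq_iff_not_disjoint, Set.not_disjoint_iff]
      exact ⟨x, hD, hC⟩
    · rw [EndSpace.ofEnd_mem_nhd, mem_singleton_iff] at hp hp'
      rw [← hp, ← hp']
      exact ω.component_anti hYY'
  refine ⟨EndSpace.ofEnd ω, ⟨?_, ofEnd_notMem_innerPoints ω⟩, fun W hW => ?_⟩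
  · rw [EndSpace.ofEnd_mem_nhd, hω]
    obtain ⟨p, ⟨hp, hp'⟩, hpZ⟩ := U.nonempty_of_mem (inter_mem (inter_mem (hf X) hU) hZ)
    rcases vertex_or_end_of_notMem_innerPoints hpZ with ⟨x, rfl⟩ | ⟨ω', rfl⟩
    · have hp'' := hp'.1
      rw [EndSpace.vertex_mem_nhd, mem_vertexUnion] at hp hp''
      obtain ⟨C, rfl, hC⟩ := hp
      obtain ⟨D, hD, hxD⟩ := hp''
      rwa [component_eq_of_mem hC hxD]
    · have hp'' := hp'.1
      rw [EndSpace.ofEnd_mem_nhd] at hp hp''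
      rwa [← mem_singleton_iff.1 hp]
  · obtain ⟨Y, hY⟩ := EndSpace.mem_nhds_ofEnd.1 hW
    exact mem_of_superset (hω Y ▸ hf Y) hY

end EndSpace

variable {G : SimpleGraph V}

/-! ### Compactness from compactness off the inner edge points -/

open Filter in
/-- Inner points of a single edge accumulate in the 1-complex. -/
theorem exists_le_nhds_of_single_edge (U : Ultrafilter (G.edgeSet × Ioo (0 : ℝ) 1)) (e : G.edgeSet)
    (he : ∀ᶠ x in (U : Filter (G.edgeSet × Ioo (0 : ℝ) 1)), x.1 = e) :
    ∃ p : Complex G,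
      Tendsto (fun x : G.edgeSet × Ioo (0 : ℝ) 1 => Complex.inner x.1 x.2) U (𝓝 p) := by
  obtain ⟨s, hs, hUs⟩ := isCompact_iff_ultrafilter_le_nhds'.1 (isCompact_Icc (a := (0 : ℝ)) (b := 1))
    (U.map fun x => (x.2 : ℝ))
    (Ultrafilter.mem_map.2 (Filter.univ_mem' fun x => ⟨x.2.2.1.le, x.2.2.2.le⟩))
  have hlim : Tendsto (fun x : G.edgeSet × Ioo (0 : ℝ) 1 => (x.2 : ℝ)) U (𝓝 s) := hUs
  -- `distFrom` measures from the second endvertex only if it differs from the first; the limit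
  -- parameter 1 needs this.
  have hne : (Quot.out (e : Sym2 V)).2 ≠ (Quot.out (e : Sym2 V)).1 := by
    intro h
    have h2 : (e : Sym2 V).IsDiag := by
      rw [← Quot.out_eq (e : Sym2 V)]
      exact Sym2.mk_isDiag_iff.2 h.symm
    exact G.not_isDiag_of_mem_edgeSet e.2 h2
  rcases hs.1.eq_or_lt with rfl | h0
  · refine ⟨Complex.vertex (Quot.out (e : Sym2 V)).1,
      TopologicalSpace.tendsto_nhds_generateFrom_iff.2 ?_⟩
    rintro B (⟨x, i, rfl⟩ | ⟨e', a, b, rfl⟩) hB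
    · rw [vertex_mem_openStar] at hB
      filter_upwards [he, hlim.eventually (gt_mem_nhds (i e).2.1)] with y hy hy'
      rw [mem_preimage, inner_mem_openStar, hy, ← hB, distFrom, if_pos rfl]
      exact ⟨Sym2.out_fst_mem _, hy'⟩
    · exact absurd hB vertex_notMem_edgeInterval
  rcases hs.2.eq_or_lt with rfl | h1
  · refine ⟨Complex.vertex (Quot.out (e : Sym2 V)).2,
      TopologicalSpace.tendsto_nhds_generateFrom_iff.2 ?_⟩
    rintro B (⟨x, i, rfl⟩ | ⟨e', a, b, rfl⟩) hB
    · rw [vertex_mem_openStar] at hB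
      have hi : 1 - (i e : ℝ) < 1 := by linarith [(i e).2.1]
      filter_upwards [he, hlim.eventually (lt_mem_nhds hi)] with y hy hy'
      rw [mem_preimage, inner_mem_openStar, hy, ← hB, distFrom, if_neg hne]
      exact ⟨Sym2.out_snd_mem _, by linarith⟩
    · exact absurd hB vertex_notMem_edgeInterval
  · refine ⟨Complex.inner e ⟨s, h0, h1⟩, TopologicalSpace.tendsto_nhds_generateFrom_iff.2 ?_⟩
    intro B hB hsB
    obtain ⟨a, b, hab, hsub⟩ := exists_edgeInterval_subset hB hsB
    rw [inner_mem_edgeInterval] at hab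
    filter_upwards [he, hlim.eventually (lt_mem_nhds hab.2.1),
      hlim.eventually (gt_mem_nhds hab.2.2)] with y hy hy1 hy2
    exact hsub (inner_mem_edgeInterval.2 ⟨hy, hy1, hy2⟩)

open Filter in
/-- A space that contains `|G|_Ω` is compact if it is compact off the inner edge points, the
vertices are isolated there, and the other points there have arbitrarily small neighbourhoods
that contain, with any vertex, all the edges at that vertex. -/
theorem compactSpace_of_isCompact_compl {K : Type v} [TopologicalSpace K] {h : EndSpace G → K}
    (hinj : Function.Injective h) (hc : Continuous h) (hK : IsCompact (h '' innerPoints G)ᶜ)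
    (hvert : ∀ x : V, ∃ W ∈ 𝓝 (h (EndSpace.ofComplex (Complex.vertex x))),
      W ∩ (h '' innerPoints G)ᶜ ⊆ {h (EndSpace.ofComplex (Complex.vertex x))})
    (hcrude : ∀ p ∈ (h '' innerPoints G)ᶜ, (∀ x, p ≠ h (EndSpace.ofComplex (Complex.vertex x))) →
      ∀ W ∈ 𝓝 p, ∃ M ∈ 𝓝 p, ∀ x, h (EndSpace.ofComplex (Complex.vertex x)) ∈ M →
        h '' innerPointsAt G x ⊆ W) :
    CompactSpace K := by
  refine ⟨isCompact_iff_ultrafilter_le_nhds'.2 fun U _ => ?_⟩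
  by_cases hU : (h '' innerPoints G)ᶜ ∈ U
  · obtain ⟨p, -, hp⟩ := isCompact_iff_ultrafilter_le_nhds'.1 hK U hU
    exact ⟨p, mem_univ _, hp⟩
  rw [Ultrafilter.compl_mem_iff_notMem, not_not] at hU
  let φ : G.edgeSet × Ioo (0 : ℝ) 1 → K := fun x => h (EndSpace.ofComplex (Complex.inner x.1 x.2))
  have hφ : Function.Injective φ := by
    rintro ⟨e, t⟩ ⟨e', t'⟩ hx
    have := hinj hx
    cases this
    rfl
  have hrange : range φ ∈ U := by
    refine mem_of_superset hU ?_
    rintro _ ⟨_, ⟨e, t, rfl⟩, rfl⟩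
    exact ⟨(e, t), rfl⟩
  let U' := U.comap hφ hrange
  have hUU' : map φ (U' : Filter (G.edgeSet × Ioo (0 : ℝ) 1)) = U := by
    rw [Ultrafilter.coe_comap]
    exact map_comap_of_mem hrange
  -- Here `a` selects an endvertex of each edge, and these endvertices converge along the
  -- ultrafilter. At a limit that is not a vertex, `hcrude` makes the inner points converge too; at
  -- a vertex, isolation makes `a` constant on a set of the ultrafilter.
  have key : ∀ a : G.edgeSet × Ioo (0 : ℝ) 1 → V, (∀ x, a x ∈ (x.1 : Sym2 V)) →
      (∃ p, (U : Filter K) ≤ 𝓝 p) ∨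
        ∃ x, ∀ᶠ y in (U' : Filter (G.edgeSet × Ioo (0 : ℝ) 1)), a y = x := by
    intro a ha
    obtain ⟨p, hp, hUp⟩ := isCompact_iff_ultrafilter_le_nhds'.1 hK
      (U'.map fun y => h (EndSpace.ofComplex (Complex.vertex (a y))))
      (Ultrafilter.mem_map.2 (Filter.univ_mem' fun y =>
        mapsTo_compl_image hinj _ (vertex_notMem_innerPoints (a y))))
    have hlim : Tendsto (fun y => h (EndSpace.ofComplex (Complex.vertex (a y)))) U' (𝓝 p) := hUp
    by_cases hx : ∃ x, p = h (EndSpace.ofComplex (Complex.vertex x))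
    · obtain ⟨x, rfl⟩ := hx
      obtain ⟨W, hW, hWs⟩ := hvert x
      refine Or.inr ⟨x, ?_⟩
      filter_upwards [hlim.eventually_mem hW] with y hy
      have := hinj (hWs ⟨hy, mapsTo_compl_image hinj _ (vertex_notMem_innerPoints (a y))⟩)
      cases this
      rfl
    · push Not at hx
      refine Or.inl ⟨p, fun W hW => ?_⟩
      obtain ⟨M, hM, hMW⟩ := hcrude p hp hx W hW
      rw [← hUU', mem_map]
      filter_upwards [hlim.eventually_mem hM] with y hy
      exact hMW _ hy ⟨_, inner_mem_innerPointsAt.2 (ha y), rfl⟩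
  rcases key (fun y => (Quot.out (y.1 : Sym2 V)).1) (fun y => Sym2.out_fst_mem _) with
    ⟨p, hp⟩ | ⟨x, hx⟩
  · exact ⟨p, mem_univ _, hp⟩
  rcases key (fun y => (Quot.out (y.1 : Sym2 V)).2) (fun y => Sym2.out_snd_mem _) with
    ⟨p, hp⟩ | ⟨x', hx'⟩
  · exact ⟨p, mem_univ _, hp⟩
  -- If both endvertices are constant, only one edge remains, as G is simple, and a closed edge is
  -- compact.
  have hedge : ∀ᶠ y in (U' : Filter (G.edgeSet × Ioo (0 : ℝ) 1)), (y.1 : Sym2 V) = s(x, x') := by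
    filter_upwards [hx, hx'] with y hy hy'
    rw [← hy, ← hy']
    exact (Quot.out_eq (y.1 : Sym2 V)).symm
  obtain ⟨y₀, hy₀⟩ := hedge.exists
  obtain ⟨p, hp⟩ := exists_le_nhds_of_single_edge U' y₀.1
    (hedge.mono fun y hy => Subtype.ext (hy.trans hy₀.symm))
  refine ⟨h (EndSpace.ofComplex p), mem_univ _, ?_⟩
  rw [← hUU']
  exact ((hc.comp EndSpace.isOpenEmbedding_ofComplex.continuous).tendsto p).comp hp

/-! ### `Ω`-compactifications -/

/-- A criterion for `Ω`-compactifications in terms of subsets of the space `K`. -/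
theorem IsOmegaCompactification.of_subsets {K : Type v} [TopologicalSpace K] {h : EndSpace G → K}
    (hcomp : CompactSpace K) (hemb : IsEmbedding h) (hdense : DenseRange h)
    (hK : IsCompact (h '' innerPoints G)ᶜ)
    (hK' : (h '' innerPoints G)ᶜ ⊆ closure (h '' (innerPoints G)ᶜ))
    (ht2 : T2Space ↥(h '' innerPoints G)ᶜ) : IsOmegaCompactification h where
  isCompactification := ⟨hcomp, hemb, hdense⟩
  restrict := by
    refine ⟨isCompact_iff_compactSpace.1 hK, hemb.restrict _, fun p => ?_⟩
    rw [IsEmbedding.subtypeVal.closure_eq_preimage_closure_image, mem_preimage, ← range_comp]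
    convert hK' p.2 using 2
    ext q
    constructor
    · rintro ⟨x, rfl⟩
      exact ⟨x, x.2, rfl⟩
    · rintro ⟨x, hx, rfl⟩
      exact ⟨⟨x, hx⟩, rfl⟩
  t2 := ht2

theorem compactSpace_endSpace (hZ : IsCompact (innerPoints G)ᶜ) : CompactSpace (EndSpace G) := by
  refine compactSpace_of_isCompact_compl (h := (id : EndSpace G → EndSpace G))
    Function.injective_id continuous_id (by rwa [image_id]) ?_ ?_
  · intro x
    refine ⟨_, (isOpen_halfStar x).mem_nhds (vertex_mem_halfStar x), ?_⟩
    rintro p ⟨hp, hp'⟩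
    rw [image_id] at hp'
    exact eq_vertex_of_mem_halfStar hp hp'
  · intro p hp hpv W hW
    rw [image_id] at hp
    rcases vertex_or_end_of_notMem_innerPoints hp with ⟨x, rfl⟩ | ⟨ω, rfl⟩
    · exact absurd rfl (hpv x)
    · obtain ⟨X, hX⟩ := EndSpace.mem_nhds_ofEnd.1 hW
      refine ⟨EndSpace.nhd X {ω.component X}, EndSpace.mem_nhds_ofEnd.2 ⟨X, subset_rfl⟩, ?_⟩
      intro x hx
      rw [image_id]
      rintro _ ⟨e, t, hxe, rfl⟩
      exact hX (EndSpace.inner_mem_nhd.2 ⟨x, hxe, EndSpace.vertex_mem_nhd.1 hx⟩)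

/-- If the vertices and ends form a compact set, then `|G|_Ω`, up to homeomorphism, is an
`Ω`-compactification of `G`. -/
theorem isOmegaCompactification_of_homeomorph (hZ : IsCompact (innerPoints G)ᶜ) {K : Type v}
    [TopologicalSpace K] (φ : EndSpace G ≃ₜ K) : IsOmegaCompactification (φ : EndSpace G → K) := by
  have := compactSpace_endSpace hZ
  have himg : ((φ : EndSpace G → K) '' innerPoints G)ᶜ = φ '' (innerPoints G)ᶜ :=
    (image_compl_eq φ.bijective).symm
  refine .of_subsets φ.compactSpace φ.isEmbedding φ.surjective.denseRange ?_ ?_ ?_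
  · rw [himg]
    exact hZ.image φ.continuous
  · rw [himg]
    exact subset_closure
  · rw [himg]
    exact (φ.image (innerPoints G)ᶜ).symm.isEmbedding.t2Space

/-- If the vertices and ends form a compact set, then every `Ω`-compactification of `G` is
equivalent to `|G|_Ω`. -/
theorem areEquivalent_id (hZ : IsCompact (innerPoints G)ᶜ) {K : Type v} [TopologicalSpace K]
    {h : EndSpace G → K} (hK : IsOmegaCompactification h) :
    AreEquivalent h (id : EndSpace G → EndSpace G) := by
  have := isCompact_iff_compactSpace.1 hZ
  have := hK.t2
  have hemb := hK.isCompactification.embedding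
  -- The image of the compact space Z is closed in the Hausdorff space K \ E̊, and dense there.
  have hcl := (isCompact_range hK.restrict.embedding.continuous).isClosed
  have hsurj : Function.Surjective h := by
    intro k
    by_cases hk : k ∈ h '' innerPoints G
    · obtain ⟨x, -, rfl⟩ := hk
      exact ⟨x, rfl⟩
    · have := hK.restrict.dense ⟨k, hk⟩
      rw [hcl.closure_eq] at this
      obtain ⟨x, hx⟩ := this
      exact ⟨x, congrArg Subtype.val hx⟩
  exact ⟨hemb.toHomeomorphOfSurjective hsurj, rfl⟩

/-! ### Toughness and compactness of the space of vertices and ends -/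

/-- A tough induced subgraph contains only finitely many components of `G - Y`. -/
theorem finite_components_of_isTough_induce {S : Set V} (hS : IsTough (G.induce S))
    (Y : Finset V) : {D : G.ComponentCompl (Y : Set V) | (D : Set V) ⊆ S}.Finite := by
  let Y' : Finset S := Y.preimage Subtype.val Subtype.val_injective.injOn
  have := hS Y'
  have hmem : ∀ a : S, a ∉ (Y' : Set S) ↔ (a : V) ∉ (Y : Set V) := by simp [Y']
  let φ : (G.induce S).induce (Y' : Set S)ᶜ →g G.induce (Y : Set V)ᶜ :=
    ⟨fun a => ⟨a.1.1, (hmem a.1).1 a.2⟩, fun h => h⟩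
  -- Every component of G - Y inside `S` is the image of a component of G[S] - Y'.
  refine (finite_range fun c : (G.induce S).ComponentCompl (Y' : Set S) => c.map φ).subset ?_
  intro D hD
  obtain ⟨d, hd, hdD⟩ := SimpleGraph.ComponentCompl.nonempty D
  exact ⟨(G.induce S).componentComplMk (v := ⟨d, hD ⟨hd, hdD⟩⟩) ((hmem _).2 hd), hdD⟩

/-- A component `C` of `G - X` is tough if it contains only finitely many components of `G - Y`
for every finite `Y ⊇ X`. -/
theorem isTough_induce_of_finite_components {X : Finset V} (C : G.ComponentCompl (X : Set V))
    (h : ∀ Y : Finset V, X ⊆ Y → {D : G.ComponentCompl (Y : Set V) | (D : Set V) ⊆ C}.Finite) :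
    IsTough (G.induce (C : Set V)) := by
  classical
  intro Y'
  let Y : Finset V := X ∪ Y'.map (Function.Embedding.subtype _)
  have hmem : ∀ a : (C : Set V), a ∉ (Y' : Set (C : Set V)) ↔ (a : V) ∉ (Y : Set V) := by
    intro a
    have ha : (a : V) ∉ X := SimpleGraph.ComponentCompl.notMem_of_mem a.2
    simp only [Y, Finset.coe_union, mem_union, Finset.mem_coe, ha, false_or, Finset.mem_map,
      Function.Embedding.coe_subtype, not_iff_not]
    exact ⟨fun h => ⟨a, h, rfl⟩, fun ⟨b, hb, hba⟩ => Subtype.ext hba ▸ hb⟩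
  let φ : (G.induce (C : Set V)).induce (Y' : Set (C : Set V))ᶜ →g G.induce (Y : Set V)ᶜ :=
    ⟨fun a => ⟨a.1.1, (hmem a.1).1 a.2⟩, fun h => h⟩
  have hXY : X ⊆ Y := Finset.subset_union_left
  have := (h Y hXY).to_subtype
  -- A walk avoiding `Y ⊇ X` cannot leave `C`, so distinct components of G[C] - Y' lie in distinct
  -- components of G - Y.
  have hwalk : ∀ (c : (G.induce (C : Set V)).ComponentCompl (Y' : Set (C : Set V))) {a b : V}
      (p : G.Walk a b), (∀ z ∈ p.support, z ∉ (Y : Set V)) → (∃ ha : a ∈ (C : Set V), ⟨a, ha⟩ ∈ c) →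
      ∃ hb : b ∈ (C : Set V), ⟨b, hb⟩ ∈ c := by
    intro c a b p
    induction p with
    | nil => exact fun _ h => h
    | @cons a d b hab q ih =>
      rintro hp ⟨ha, hac⟩
      refine ih (fun z hz => hp z (by simp [hz])) ?_
      have hd : d ∉ (Y : Set V) := hp d (by simp)
      have hdC : d ∈ C := SimpleGraph.ComponentCompl.mem_of_adj a d ha (fun hX => hd (hXY hX)) hab
      exact ⟨hdC, SimpleGraph.ComponentCompl.mem_of_adj (⟨a, ha⟩ : (C : Set V)) ⟨d, hdC⟩ hac
        ((hmem _).2 hd) hab⟩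
  have himage : ∀ (c : (G.induce (C : Set V)).ComponentCompl (Y' : Set (C : Set V)))
      (a : (C : Set V)), a ∈ c → (a : V) ∈ (c.map φ : G.ComponentCompl (Y : Set V)) := by
    rintro c a ⟨ha, rfl⟩
    exact ⟨(hmem a).1 ha, rfl⟩
  refine Finite.of_injective (β := {D : G.ComponentCompl (Y : Set V) | (D : Set V) ⊆ C})
    (fun c => ⟨c.map φ, ?_⟩) fun c c' hcc => ?_
  · obtain ⟨a, ha⟩ := SimpleGraph.ComponentCompl.nonempty c
    have hsub : (X : Set V) ⊆ Y := Finset.coe_subset.2 hXY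
    show ((c.map φ : G.ComponentCompl (Y : Set V)) : Set V) ⊆ C
    rw [← SimpleGraph.ComponentCompl.hom_eq_iff_le _ hsub,
      SimpleGraph.ComponentCompl.hom_eq_iff_not_disjoint, Set.not_disjoint_iff]
    exact ⟨a, himage c a ha, a.2⟩
  · obtain ⟨a, ha⟩ := SimpleGraph.ComponentCompl.nonempty c
    obtain ⟨b, hb⟩ := SimpleGraph.ComponentCompl.nonempty c'
    have h1 := himage c a ha
    have h2 := himage c' b hb
    have hcc' : c.map φ = c'.map φ := Subtype.ext_iff.1 hcc
    rw [← hcc'] at h2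
    obtain ⟨p, hp⟩ := exists_walk_in_component _ h1 h2
    obtain ⟨hb', hbc⟩ := hwalk c p (fun z hz => SimpleGraph.ComponentCompl.notMem_of_mem (hp z hz))
      ⟨a.2, ha⟩
    exact component_eq_of_mem hbc hb

/-- The vertices and ends of a tough graph form a compact set. -/
theorem IsTough.isCompact (hG : IsTough G) : IsCompact (innerPoints G)ᶜ := by
  convert isCompact_nhd (G := G) (X := ∅) (𝒞 := univ) fun Y _ => ?_ using 1
  · refine (inter_eq_right.2 fun p hp => ?_).symm
    rcases vertex_or_end_of_notMem_innerPoints hp with ⟨x, rfl⟩ | ⟨ω, rfl⟩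
    · exact EndSpace.vertex_mem_nhd.2 (mem_vertexUnion.2
        ⟨G.componentComplMk (by simp), mem_univ _, G.componentComplMk_mem _⟩)
    · exact EndSpace.ofEnd_mem_nhd.2 (mem_univ _)
  · have := hG Y
    exact toFinite _

theorem vertexUnion_singleton {X : Finset V} (C : G.ComponentCompl (X : Set V)) :
    vertexUnion {C} = (C : Set V) := by
  simp [vertexUnion]

/-- The vertices and ends of an end-tough graph form a locally compact space. -/
theorem IsEndTough.weaklyLocallyCompactSpace (hG : IsEndTough G) :
    WeaklyLocallyCompactSpace ↥(innerPoints G)ᶜ := by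
  refine ⟨fun ⟨p, hp⟩ => ?_⟩
  rcases vertex_or_end_of_notMem_innerPoints hp with ⟨x, rfl⟩ | ⟨ω, rfl⟩
  · refine ⟨{⟨_, hp⟩}, isCompact_singleton, Filter.mem_of_superset
      (((isOpen_halfStar x).preimage continuous_subtype_val).mem_nhds (vertex_mem_halfStar x)) ?_⟩
    rintro ⟨q, hq⟩ hqx
    exact Subtype.ext (eq_vertex_of_mem_halfStar hqx hq)
  · obtain ⟨X, hX⟩ := hG ω
    have hc : IsCompact (EndSpace.nhd X {ω.component X} ∩ (innerPoints G)ᶜ) := by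
      refine isCompact_nhd fun Y _ => ?_
      rw [vertexUnion_singleton]
      exact finite_components_of_isTough_induce hX Y
    refine ⟨Subtype.val ⁻¹' EndSpace.nhd X {ω.component X}, ?_,
      ((EndSpace.isOpen_nhd X _).preimage continuous_subtype_val).mem_nhds
        (EndSpace.ofEnd_mem_nhd.2 (mem_singleton _))⟩
    rw [IsEmbedding.subtypeVal.isCompact_iff, Subtype.image_preimage_coe, inter_comm]
    exact hc

/-- If the vertices and ends of `G` form a locally compact space, then `G` is end-tough. -/
theorem isEndTough_of_locallyCompactSpace (h : LocallyCompactSpace ↥(innerPoints G)ᶜ) :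
    IsEndTough G := by
  intro ω
  obtain ⟨N, hN, hNω⟩ := exists_compact_mem_nhds
    (⟨EndSpace.ofEnd ω, ofEnd_notMem_innerPoints ω⟩ : ↥(innerPoints G)ᶜ)
  rw [nhds_subtype_eq_comap, Filter.mem_comap] at hNω
  obtain ⟨W, hW, hWN⟩ := hNω
  obtain ⟨X, hX⟩ := EndSpace.mem_nhds_ofEnd.1 hW
  refine ⟨X, isTough_induce_of_finite_components _ fun Y hXY => ?_⟩
  -- Every component of G - Y inside C(X, ω) has a vertex, which lies in the compact neighbourhood
  -- `N` of `ω`.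
  refine (finite_components_of_isCompact (hN.image continuous_subtype_val) ?_ Y).subset ?_
  · rintro _ ⟨p, -, rfl⟩
    exact p.2
  · intro D hD
    obtain ⟨x, hx⟩ := D.nonempty
    refine ⟨x, hx, ⟨⟨_, vertex_notMem_innerPoints x⟩, hWN (hX ?_), rfl⟩⟩
    exact EndSpace.vertex_mem_nhd.2 (mem_vertexUnion.2 ⟨_, rfl, hD hx⟩)

theorem isTough_of_isCompact (h : IsCompact (innerPoints G)ᶜ) : IsTough G := by
  intro Y
  refine finite_univ_iff.1 ((finite_components_of_isCompact h subset_rfl Y).subset fun D _ => ?_)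
  obtain ⟨x, hx⟩ := D.nonempty
  exact ⟨x, hx, vertex_notMem_innerPoints x⟩

/-! ### Tangles -/

section Tangles

variable {τ : Set (Set V × Set V)}

theorem IsTangle.mem_or_swap_mem (hτ : IsTangle G τ) {p : Set V × Set V} (hp : IsSeparation G p) :
    p ∈ τ ∨ p.swap ∈ τ := by
  obtain ⟨q, ⟨hq, rfl | rfl⟩, -⟩ := hτ.orientation.2 p hp
  exacts [Or.inl hq, Or.inr hq]

theorem IsTangle.infinite_snd (hτ : IsTangle G τ) {p : Set V × Set V} (hp : p ∈ τ) :
    p.2.Infinite := by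
  intro hfin
  refine hτ.avoids {p} ⟨?_, ?_⟩ (finite_singleton p) (by simpa [starInterior] using hfin)
    (singleton_subset_iff.2 hp)
  · rintro q rfl
    exact hτ.orientation.1 q hp
  · rintro q rfl r rfl hne
    exact absurd rfl hne

/-- Otherwise `q.swap` is in `τ` and contradicts consistency with `p`. Consistency is silent when
`q.swap = p`, but then the big side of `p` lies in the finite separator. -/
theorem IsTangle.mem_of_le (hτ : IsTangle G τ) {p q : Set V × Set V} (hp : p ∈ τ)
    (hq : IsSeparation G q) (h : SepLE q p) : q ∈ τ := by
  by_contra hqτ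
  have hs := (hτ.mem_or_swap_mem hq).resolve_left hqτ
  by_cases hsp : q.swap = p
  · subst hsp
    refine hτ.infinite_snd hs (hq.1.subset fun x hx => ⟨hx, h.1 hx⟩)
  · refine hτ.consistent _ hs _ hp hsp ⟨by simpa using h, ?_⟩
    rw [Prod.swap_swap]
    rintro rfl
    exact hqτ hp

/-- The big sides of any two elements of an `ℵ₀`-tangle have infinite intersection. -/
theorem IsTangle.infinite_inter (hτ : IsTangle G τ) {p q : Set V × Set V} (hp : p ∈ τ)
    (hq : q ∈ τ) : (p.2 ∩ q.2).Infinite := by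
  intro hfin
  have hps := hτ.orientation.1 p hp
  have hqs := hτ.orientation.1 q hq
  -- For `p = (A, B)` and `q = (C, D)` the corner (A ∩ D, B ∪ C) lies below `p`, so it is in `τ`.
  -- With `q` it forms a star of interior (B ∩ D) ∪ (C ∩ D).
  let r : Set V × Set V := (p.1 ∩ q.2, p.2 ∪ q.1)
  have hr : IsSeparation G r := by
    refine ⟨(hps.1.union hqs.1).subset ?_, eq_univ_of_forall fun x => ?_, ?_⟩
    · rintro x ⟨⟨h1, h2⟩, h3 | h3⟩
      exacts [Or.inl ⟨h1, h3⟩, Or.inr ⟨h3, h2⟩]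
    · have h1 : x ∈ p.1 ∪ p.2 := hps.2.1 ▸ mem_univ x
      have h2 : x ∈ q.1 ∪ q.2 := hqs.2.1 ▸ mem_univ x
      simp only [r, mem_union, mem_inter_iff] at *
      tauto
    · rintro x ⟨⟨hx1, hx2⟩, hx3⟩ y ⟨hy1, hy2⟩ hxy
      simp only [r, mem_union, mem_inter_iff, not_or] at hx3 hy1 hy2
      by_cases hy : y ∈ p.1
      · have hyq : y ∉ q.2 := fun h => hy2 ⟨hy, h⟩
        have hyq' : y ∈ q.1 := by
          have : y ∈ q.1 ∪ q.2 := hqs.2.1 ▸ mem_univ y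
          exact this.resolve_right hyq
        exact hqs.2.2 y ⟨hyq', hyq⟩ x ⟨hx2, hx3.2⟩ hxy.symm
      · have hyp : y ∈ p.2 := by
          have : y ∈ p.1 ∪ p.2 := hps.2.1 ▸ mem_univ y
          exact this.resolve_left hy
        exact hps.2.2 x ⟨hx1, hx3.1⟩ y ⟨hyp, hy⟩ hxy
  have hrτ : r ∈ τ := hτ.mem_of_le hp hr ⟨inter_subset_left, subset_union_left⟩
  refine hτ.avoids {r, q} ⟨?_, ?_⟩ (by simp) ?_ (pair_subset hrτ hq)
  · rintro _ (rfl | rfl)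
    exacts [hr, hqs]
  · rintro _ (rfl | rfl) _ (rfl | rfl) hne
    · exact absurd rfl hne
    · exact ⟨inter_subset_right, subset_union_right⟩
    · exact ⟨subset_union_right, inter_subset_right⟩
    · exact absurd rfl hne
  · refine (hfin.union hqs.1).subset fun x hx => ?_
    simp only [starInterior, mem_iInter, mem_insert_iff, mem_singleton_iff, forall_eq_or_imp,
      forall_eq] at hx
    rcases hx with ⟨h1 | h1, h2⟩
    exacts [Or.inl ⟨h1, h2⟩, Or.inr ⟨h1, h2⟩]

theorem isSeparation_sepTowards (X : Finset V) (𝒞 : Set (G.ComponentCompl (X : Set V))) :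
    IsSeparation G (sepTowards X 𝒞) := by
  refine ⟨X.finite_toSet.subset ?_, eq_univ_of_forall fun x => ?_, ?_⟩
  · rintro x ⟨h1, h2 | h2⟩
    exacts [h2, absurd h2 h1]
  · by_cases hx : x ∈ vertexUnion 𝒞
    exacts [Or.inr (Or.inr hx), Or.inl hx]
  · rintro x ⟨hx1, hx2⟩ y ⟨-, hy⟩ hxy
    have hy' : y ∈ vertexUnion 𝒞 := not_not.1 hy
    obtain ⟨C, hC, hyC⟩ := mem_vertexUnion.1 hy'
    refine hx1 (mem_vertexUnion.2 ⟨C, hC, SimpleGraph.ComponentCompl.mem_of_adj y x hyC ?_ hxy.symm⟩)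
    exact fun hX => hx2 (Or.inl hX)

theorem Ends.mem_ultra_tangle (ω : Ends G) {X : Finset V}
    {𝒞 : Set (G.ComponentCompl (X : Set V))} : 𝒞 ∈ ω.tangle.ultra X ↔ ω.component X ∈ 𝒞 := by
  induction ω using Quotient.inductionOn with
  | _ r =>
  show sepTowards X 𝒞 ∈ endTangleSet (Quotient.mk (raySetoid G) r) ↔ _
  rw [mem_endTangleSet_iff]
  have hside : (sepTowards X 𝒞).2 \ (sepTowards X 𝒞).1 = vertexUnion 𝒞 := by
    ext x
    simp [sepTowards]
  rw [hside]
  constructor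
  · rintro ⟨-, h⟩
    obtain ⟨n, hn⟩ := h.inter (Ends.tailIn_component r X)
    obtain ⟨h1, h2⟩ := hn n le_rfl
    obtain ⟨C, hC, hC'⟩ := mem_vertexUnion.1 h1
    rwa [component_eq_of_mem h2 hC']
  · refine fun h => ⟨isSeparation_sepTowards X 𝒞, (Ends.tailIn_component r X).mono fun x hx => ?_⟩
    exact mem_vertexUnion.2 ⟨_, h, hx⟩

theorem Ends.tangle_injective : Function.Injective (Ends.tangle : Ends G → Tangles G) := by
  intro ω ω' h
  refine Ends.ext_component fun X => ?_
  have : {ω'.component X} ∈ ω.tangle.ultra X := h ▸ ω'.mem_ultra_tangle.2 (mem_singleton _)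
  exact mem_singleton_iff.1 (ω.mem_ultra_tangle.1 this)

/-- If `τ` pointed away from each of the finitely many components, these separations would form a
finite star in `τ` with interior inside `X`. -/
theorem IsTangle.exists_component (hτ : IsTangle G τ) {X : Finset V}
    (hX : Finite (G.ComponentCompl (X : Set V))) :
    ∃ C : G.ComponentCompl (X : Set V), sepTowards X {C} ∈ τ := by
  by_contra! hcon
  have hswap : ∀ C : G.ComponentCompl (X : Set V), (sepTowards X {C}).swap ∈ τ := fun C =>
    (hτ.mem_or_swap_mem (isSeparation_sepTowards X {C})).resolve_left (hcon C)
  refine hτ.avoids (range fun C : G.ComponentCompl (X : Set V) => (sepTowards X {C}).swap)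
    ⟨?_, ?_⟩ (finite_range _) (X.finite_toSet.subset fun x hx => ?_) ?_
  · rintro _ ⟨C, rfl⟩
    exact (isSeparation_sepTowards X {C}).swap
  · rintro _ ⟨C, rfl⟩ _ ⟨D, rfl⟩ hne
    have key : ∀ C D : G.ComponentCompl (X : Set V), C ≠ D →
        (X : Set V) ∪ C ⊆ (D : Set V)ᶜ := by
      rintro C D hne x (hx | hx) hxD
      · exact SimpleGraph.ComponentCompl.notMem_of_mem hxD hx
      · exact hne (component_eq_of_mem hx hxD)
    have hCD : C ≠ D := by
      rintro rfl
      exact hne rfl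
    simp only [SepLE, sepTowards, vertexUnion_singleton, Prod.swap]
    exact ⟨key C D hCD, key D C hCD.symm⟩
  · by_contra hxX
    simp only [starInterior, mem_iInter, forall_mem_range] at hx
    have := hx (G.componentComplMk hxX)
    simp only [sepTowards, vertexUnion_singleton, Prod.swap] at this
    exact this (G.componentComplMk_mem hxX)
  · rintro _ ⟨C, rfl⟩
    exact hswap C

/-- In a tough graph, every `ℵ₀`-tangle is an end tangle. -/
theorem IsTough.tangle_surjective (hG : IsTough G) :
    Function.Surjective (Ends.tangle : Ends G → Tangles G) := by
  rintro ⟨τ, hτ⟩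
  -- The components to which `τ` points form a direction, because big sides of a tangle meet
  -- infinitely. The same fact shows that the end of this direction induces `τ`.
  choose f hf using fun X : Finset V => hτ.exists_component (hG X)
  obtain ⟨ω, hω⟩ := exists_end_of_direction f fun X Y hXY => by
    have hsub : (X : Set V) ⊆ Y := Finset.coe_subset.2 hXY
    rw [← SimpleGraph.ComponentCompl.hom_eq_iff_le _ hsub,
      SimpleGraph.ComponentCompl.hom_eq_iff_not_disjoint]
    intro hdisj
    refine hτ.infinite_inter (hf X) (hf Y) ((X.finite_toSet.union Y.finite_toSet).subset ?_)
    rintro x ⟨hx, hy⟩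
    simp only [sepTowards, vertexUnion_singleton] at hx hy
    rcases hx with hx | hx
    · exact Or.inl hx
    rcases hy with hy | hy
    · exact Or.inr hy
    · exact (disjoint_left.1 hdisj hy hx).elim
  have hsub : ω.tangle.1 ⊆ τ := by
    rintro p ⟨hp, h⟩
    refine (hτ.mem_or_swap_mem hp).resolve_right fun hs => ?_
    refine hτ.infinite_inter hs (hf hp.1.toFinset) (hp.1.subset ?_)
    rw [hω] at h
    rintro x ⟨hx1, hx2⟩
    simp only [sepTowards, vertexUnion_singleton, Finite.coe_toFinset] at hx2
    rcases hx2 with hx2 | hx2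
    · exact hx2
    · exact absurd hx1 (h hx2).2
  refine ⟨ω, Subtype.ext (hsub.antisymm fun p hp => ?_)⟩
  by_contra hpω
  have hps := hτ.orientation.1 p hp
  have hs := hsub ((ω.tangle.2.mem_or_swap_mem hps).resolve_left hpω)
  refine hτ.infinite_inter hp hs (hps.1.subset ?_)
  rintro x ⟨h1, h2⟩
  exact ⟨h2, h1⟩

/-! ### Tangles from free ultrafilters on 𝒞_X -/

/-- A walk that avoids the separator stays on its side of a separation. -/
theorem IsSeparation.mem_of_walk {p : Set V × Set V} (hp : IsSeparation G p) {a b : V}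
    (q : G.Walk a b) (hq : ∀ z ∈ q.support, z ∉ p.1 ∩ p.2) (ha : a ∈ p.2 \ p.1) :
    b ∈ p.2 \ p.1 := by
  induction q with
  | nil => exact ha
  | @cons a c b h q ih =>
    refine ih (fun z hz => hq z (by simp [hz])) ?_
    have hc : c ∉ p.1 ∩ p.2 := hq c (by simp)
    have hc' : c ∈ p.1 ∪ p.2 := hp.2.1 ▸ mem_univ c
    by_contra hcon
    refine hp.2.2 c ?_ a ha h.symm
    simp only [mem_inter_iff, mem_union, mem_sdiff] at *
    tauto

/-- The set of separations whose big sides contain almost all components of `G - X` with respect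
to an ultrafilter. -/
def ultrafilterTangle {X : Finset V} (U : Ultrafilter (G.ComponentCompl (X : Set V))) :
    Set (Set V × Set V) :=
  {p | IsSeparation G p ∧ {C : G.ComponentCompl (X : Set V) | (C : Set V) ⊆ p.2 \ p.1} ∈ U}

theorem infinite_of_mem_ultrafilter {α : Type*} {U : Ultrafilter α}
    (hU : (U : Filter α) ≤ Filter.cofinite) {S : Set α} (hS : S ∈ U) : S.Infinite := by
  intro hfin
  exact Ultrafilter.compl_notMem_iff.2 hS (hU hfin.compl_mem_cofinite)

/-- Only finitely many components meet a given finite separator, and every other one lies strictly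
on one side, so a free ultrafilter chooses a side. The interior of a finite star of chosen
separations contains the components of a set in `U`, hence infinitely many. -/
theorem isTangle_ultrafilterTangle {X : Finset V} {U : Ultrafilter (G.ComponentCompl (X : Set V))}
    (hU : (U : Filter (G.ComponentCompl (X : Set V))) ≤ Filter.cofinite) :
    IsTangle G (ultrafilterTangle U) := by
  classical
  have hside : ∀ p, IsSeparation G p → p ∈ ultrafilterTangle U ∨ p.swap ∈ ultrafilterTangle U := by
    intro p hp
    have hfin : {C : G.ComponentCompl (X : Set V) | ∃ x ∈ C, x ∈ p.1 ∩ p.2}.Finite := by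
      -- A component meeting the separator is determined by a vertex in both; `none` is the dummy
      -- value for separator vertices in `X`.
      refine (hp.1.image fun x => if hx : x ∉ (X : Set V) then some (G.componentComplMk hx)
        else none).preimage (f := some) (Option.some_injective _).injOn |>.subset ?_
      rintro C ⟨x, ⟨hx, rfl⟩, hxp⟩
      exact ⟨x, hxp, dif_pos hx⟩
    have hcov : {C : G.ComponentCompl (X : Set V) | ∃ x ∈ C, x ∈ p.1 ∩ p.2}ᶜ ⊆
        {C : G.ComponentCompl (X : Set V) | (C : Set V) ⊆ p.2 \ p.1} ∪
        {C : G.ComponentCompl (X : Set V) | (C : Set V) ⊆ p.1 \ p.2} := by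
      intro C hC
      simp only [mem_compl_iff, mem_ofPred_eq, not_exists, not_and] at hC
      obtain ⟨x, hx⟩ := C.nonempty
      have hxp : x ∈ p.2 \ p.1 ∨ x ∈ p.1 \ p.2 := by
        have h1 := hC x hx
        have h2 : x ∈ p.1 ∪ p.2 := hp.2.1 ▸ mem_univ x
        simp only [mem_inter_iff, mem_union, mem_sdiff] at *
        tauto
      refine hxp.imp (fun h y hy => ?_) fun h y hy => ?_
      · obtain ⟨q, hq⟩ := exists_walk_in_component C hx hy
        exact hp.mem_of_walk q (fun z hz => hC z (hq z hz)) h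
      · obtain ⟨q, hq⟩ := exists_walk_in_component C hx hy
        exact hp.swap.mem_of_walk q (fun z hz h' => hC z (hq z hz) h'.symm) h
    have hmem := Filter.mem_of_superset (hU hfin.compl_mem_cofinite) hcov
    exact (Ultrafilter.union_mem_iff.1 hmem).imp (fun h => ⟨hp, h⟩) fun h => ⟨hp.swap, h⟩
  have hinter : ∀ p ∈ ultrafilterTangle U, ∀ q ∈ ultrafilterTangle U,
      ∃ x, x ∈ (p.2 \ p.1) ∩ (q.2 \ q.1) := by
    intro p hp q hq
    obtain ⟨C, h1, h2⟩ := U.nonempty_of_mem (Filter.inter_mem hp.2 hq.2)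
    obtain ⟨x, hx⟩ := C.nonempty
    exact ⟨x, h1 hx, h2 hx⟩
  have hnot : ∀ p, p ∈ ultrafilterTangle U → p.swap ∉ ultrafilterTangle U := by
    intro p hp hp'
    obtain ⟨x, hx, hx'⟩ := hinter _ hp _ hp'
    exact hx.2 hx'.1
  refine ⟨⟨fun p hp => hp.1, fun p hp => ?_⟩, ?_, ?_⟩
  · rcases hside p hp with h | h
    · refine ⟨p, ⟨h, Or.inl rfl⟩, ?_⟩
      rintro q ⟨hq, rfl | rfl⟩
      exacts [rfl, absurd hq (hnot p h)]
    · refine ⟨p.swap, ⟨h, Or.inr rfl⟩, ?_⟩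
      rintro q ⟨hq, rfl | rfl⟩
      exacts [absurd h (hnot q hq), rfl]
  · rintro p hp q hq - ⟨⟨h1, -⟩, -⟩
    obtain ⟨x, hx, hx'⟩ := hinter _ hp _ hq
    exact hx'.2 (h1 hx.1)
  · intro σ _ hfin hint hsub
    have hbig : {C : G.ComponentCompl (X : Set V) | (C : Set V) ⊆ starInterior σ} ∈ U := by
      have : (⋂ p ∈ σ, {C : G.ComponentCompl (X : Set V) | (C : Set V) ⊆ p.2 \ p.1}) ∈ U :=
        (Filter.biInter_mem hfin).2 fun p hp => (hsub hp).2
      refine Filter.mem_of_superset this fun C hC x hx => ?_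
      simp only [mem_iInter] at hC
      simp only [starInterior, mem_iInter]
      exact fun p hp => (hC p hp hx).1
    have hinf := infinite_of_mem_ultrafilter hU hbig
    refine hinf ?_
    refine Set.Finite.of_finite_image (f := fun C => C.nonempty.some)
      (hint.subset ?_) fun C _ D _ h => ?_
    · rintro _ ⟨C, hC, rfl⟩
      exact hC C.nonempty.some_mem
    · have h' : C.nonempty.some = D.nonempty.some := h
      exact component_eq_of_mem C.nonempty.some_mem (h' ▸ D.nonempty.some_mem)

theorem sepTowards_mem_ultrafilterTangle {X : Finset V}
    {U : Ultrafilter (G.ComponentCompl (X : Set V))} {𝒞 : Set (G.ComponentCompl (X : Set V))} :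
    sepTowards X 𝒞 ∈ ultrafilterTangle U ↔ 𝒞 ∈ U := by
  have : {C : G.ComponentCompl (X : Set V) |
      (C : Set V) ⊆ (sepTowards X 𝒞).2 \ (sepTowards X 𝒞).1} = 𝒞 := by
    ext C
    constructor
    · intro h
      obtain ⟨x, hx⟩ := C.nonempty
      obtain ⟨D, hD, hxD⟩ := mem_vertexUnion.1 (not_not.1 (h hx).2)
      rwa [component_eq_of_mem hx hxD]
    · intro h x hx
      have : x ∈ vertexUnion 𝒞 := mem_vertexUnion.2 ⟨C, h, hx⟩
      exact ⟨Or.inr this, not_not.2 this⟩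
  show _ ∧ _ ↔ _
  rw [this]
  exact and_iff_right (isSeparation_sepTowards X 𝒞)

/-- A graph that is not tough has at least two `ℵ₀`-tangles that are not end tangles. -/
theorem exists_ne_tangles (hG : ¬ IsTough G) :
    ∃ τ τ' : Tangles G, τ ≠ τ' ∧ (∀ ω : Ends G, ω.tangle ≠ τ) ∧ ∀ ω : Ends G, ω.tangle ≠ τ' := by
  simp only [IsTough, not_forall, not_finite_iff_infinite] at hG
  obtain ⟨X, hX⟩ := hG
  have hU : ∀ S : Set (G.ComponentCompl (X : Set V)), S.Infinite →
      ∃ U : Ultrafilter (G.ComponentCompl (X : Set V)),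
        (U : Filter (G.ComponentCompl (X : Set V))) ≤ Filter.cofinite ∧ S ∈ U := by
    intro S hS
    have : (Filter.cofinite ⊓ Filter.principal S).NeBot :=
      Filter.cofinite_inf_principal_neBot_iff.2 hS
    exact ⟨Ultrafilter.of _, (Ultrafilter.of_le _).trans inf_le_left,
      (Ultrafilter.of_le _).trans inf_le_right (Filter.mem_principal_self S)⟩
  -- An end tangle points to the single component C(X, ω), whereas a free ultrafilter contains no
  -- singleton.
  have hend : ∀ U : Ultrafilter (G.ComponentCompl (X : Set V)),
      ∀ hU : (U : Filter (G.ComponentCompl (X : Set V))) ≤ Filter.cofinite, ∀ ω : Ends G,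
      ω.tangle ≠ ⟨ultrafilterTangle U, isTangle_ultrafilterTangle hU⟩ := by
    intro U hU ω h
    have h1 : {ω.component X} ∈ ω.tangle.ultra X := ω.mem_ultra_tangle.2 (mem_singleton _)
    rw [h] at h1
    exact infinite_of_mem_ultrafilter hU (sepTowards_mem_ultrafilterTangle.1 h1)
      (finite_singleton _)
  obtain ⟨S, T, hS, hT, hST⟩ : ∃ S T : Set (G.ComponentCompl (X : Set V)),
      S.Infinite ∧ T.Infinite ∧ Disjoint S T := by
    let f := Infinite.natEmbedding (G.ComponentCompl (X : Set V))
    refine ⟨range fun n => f (2 * n), range fun n => f (2 * n + 1),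
      infinite_range_of_injective fun a b h => ?_, infinite_range_of_injective fun a b h => ?_, ?_⟩
    · have := f.injective h
      omega
    · have := f.injective h
      omega
    · rw [disjoint_left]
      rintro _ ⟨a, rfl⟩ ⟨b, hb⟩
      have := f.injective hb
      omega
  obtain ⟨U₁, h₁, hS₁⟩ := hU S hS
  obtain ⟨U₂, h₂, hT₂⟩ := hU T hT
  refine ⟨⟨_, isTangle_ultrafilterTangle h₁⟩, ⟨_, isTangle_ultrafilterTangle h₂⟩, fun h => ?_,
    hend U₁ h₁, hend U₂ h₂⟩
  have h3 := sepTowards_mem_ultrafilterTangle.2 hS₁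
  have h' : ultrafilterTangle U₁ = ultrafilterTangle U₂ := Subtype.ext_iff.1 h
  rw [h', sepTowards_mem_ultrafilterTangle] at h3
  obtain ⟨C, hC, hC'⟩ := U₂.nonempty_of_mem (Filter.inter_mem h3 hT₂)
  exact disjoint_left.1 hST hC hC'

end Tangles

/-! ### The tangle space -/

theorem toTangleSpace_injective (G : SimpleGraph V) : Function.Injective (toTangleSpace G) := by
  rintro (p | ω) (q | ω') h
  · cases h
    rfl
  · cases h
  · cases h
  · exact congrArg _ (Ends.tangle_injective (TangleSpace.ofTangle.inj h))

/-- The generating sets of |G|_Θ pull back exactly to those of |G|_Ω. -/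
theorem isInducing_toTangleSpace (G : SimpleGraph V) : IsInducing (toTangleSpace G) := by
  have h1 : ∀ U : Set (Complex G),
      toTangleSpace G ⁻¹' (TangleSpace.ofComplex '' U) = EndSpace.ofComplex '' U := by
    intro U
    ext (p | ω) <;> simp [toTangleSpace]
  have h2 : ∀ (X : Finset V) (𝒞 : Set (G.ComponentCompl (X : Set V))),
      toTangleSpace G ⁻¹' TangleSpace.nhd X 𝒞 = EndSpace.nhd X 𝒞 := by
    intro X 𝒞
    ext (p | ω) <;> simp [toTangleSpace, TangleSpace.nhd, EndSpace.nhd, Ends.mem_ultra_tangle]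
  refine ⟨?_⟩
  refine Eq.trans ?_ (induced_generateFrom_eq).symm
  refine congrArg TopologicalSpace.generateFrom (Set.ext fun W => ?_)
  constructor
  · rintro (⟨U, hU, rfl⟩ | ⟨X, 𝒞, rfl⟩)
    · exact ⟨_, Or.inl ⟨U, hU, rfl⟩, h1 U⟩
    · exact ⟨_, Or.inr ⟨X, 𝒞, rfl⟩, h2 X 𝒞⟩
  · rintro ⟨_, ⟨U, hU, rfl⟩ | ⟨X, 𝒞, rfl⟩, rfl⟩
    · exact Or.inl ⟨U, hU, h1 U⟩
    · exact Or.inr ⟨X, 𝒞, h2 X 𝒞⟩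

/-- For a tough graph, `|G|_Ω` and `|G|_Θ` are canonically homeomorphic. -/
noncomputable def IsTough.homeomorphTangleSpace (hG : IsTough G) : EndSpace G ≃ₜ TangleSpace G :=
  IsHomeomorph.homeomorph (toTangleSpace G) (isHomeomorph_iff_isEmbedding_surjective.2
    ⟨⟨isInducing_toTangleSpace G, toTangleSpace_injective G⟩, by
      rintro (p | τ)
      · exact ⟨EndSpace.ofComplex p, rfl⟩
      · obtain ⟨ω, rfl⟩ := hG.tangle_surjective τ
        exact ⟨EndSpace.ofEnd ω, rfl⟩⟩)

theorem not_subsingleton_compl_range_toTangleSpace (hG : ¬ IsTough G) :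
    ¬ (range (toTangleSpace G))ᶜ.Subsingleton := by
  obtain ⟨τ, τ', hne, hτ, hτ'⟩ := exists_ne_tangles hG
  have key : ∀ τ : Tangles G, (∀ ω : Ends G, ω.tangle ≠ τ) →
      TangleSpace.ofTangle τ ∈ (range (toTangleSpace G))ᶜ := by
    rintro τ hτ ⟨p | ω, h⟩
    · cases h
    · exact hτ ω (TangleSpace.ofTangle.inj h)
  exact fun h => hne (TangleSpace.ofTangle.inj (h (key τ hτ) (key τ' hτ')))

/-! ### The crude extension of a compactification of the space of vertices and ends -/

/-- Given a compactification `g` of the space of vertices and ends, the disjoint union of that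
compactification with the inner edge points. -/
def CrudeExtension {L : Type v} {S : Type w} (_ : ↥(innerPoints G)ᶜ → L)
    (_ : innerPoints G ≃ S) : Type (max v w) :=
  L ⊕ S

namespace CrudeExtension

variable {L : Type v} {S : Type w} {g : ↥(innerPoints G)ᶜ → L} {e : innerPoints G ≃ S}

/-- The inclusion of the compactification of the space of vertices and ends. -/
def base (g : ↥(innerPoints G)ᶜ → L) (e : innerPoints G ≃ S) : L → CrudeExtension g e := Sum.inl

open Classical in
/-- The canonical map from `|G|_Ω`. -/
noncomputable def map (g : ↥(innerPoints G)ᶜ → L) (e : innerPoints G ≃ S) (p : EndSpace G) :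
    CrudeExtension g e :=
  if hp : p ∈ innerPoints G then Sum.inr (e ⟨p, hp⟩) else Sum.inl (g ⟨p, hp⟩)

/-- The vertex `x` as a point of the space of vertices and ends. -/
abbrev vtx (G : SimpleGraph V) (x : V) : ↥(innerPoints G)ᶜ :=
  ⟨EndSpace.ofComplex (Complex.vertex x), vertex_notMem_innerPoints x⟩

theorem base_injective : Function.Injective (base g e) := Sum.inl_injective

theorem map_of_notMem {p : EndSpace G} (hp : p ∈ (innerPoints G)ᶜ) :
    map g e p = base g e (g ⟨p, hp⟩) :=
  dif_neg hp

theorem map_of_mem {p : EndSpace G} (hp : p ∈ innerPoints G) :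
    map g e p = Sum.inr (e ⟨p, hp⟩) :=
  dif_pos hp

theorem map_ne_base {p : EndSpace G} (hp : p ∈ innerPoints G) (q : L) :
    map g e p ≠ base g e q := by
  rw [map_of_mem hp]
  exact Sum.inr_ne_inl

theorem map_injective (hg : Function.Injective g) : Function.Injective (map g e) := by
  intro p q h
  by_cases hp : p ∈ innerPoints G
  · by_cases hq : q ∈ innerPoints G
    · rw [map_of_mem hp, map_of_mem hq] at h
      exact congrArg Subtype.val (e.injective (Sum.inr.inj h))
    · rw [map_of_notMem (g := g) (e := e) hq] at h
      exact absurd h (map_ne_base hp _)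
  · by_cases hq : q ∈ innerPoints G
    · rw [map_of_notMem (g := g) (e := e) hp] at h
      exact absurd h.symm (map_ne_base hq _)
    · rw [map_of_notMem (g := g) (e := e) hp, map_of_notMem (g := g) (e := e) hq] at h
      exact congrArg Subtype.val (hg (base_injective h))

theorem compl_image_innerPoints : (map g e '' innerPoints G)ᶜ = range (base g e) := by
  ext (p | s)
  · refine iff_of_true ?_ ⟨p, rfl⟩
    rintro ⟨x, hx, h⟩
    exact map_ne_base hx p h
  · refine iff_of_false (fun h => h ⟨e.symm s, (e.symm s).2, ?_⟩) ?_
    · rw [map_of_mem (e.symm s).2]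
      exact congrArg Sum.inr (e.apply_symm_apply s)
    · rintro ⟨p, h⟩
      cases h

/-- The crude set spanned by a set `M` of points off the inner edge points. -/
def hull (g : ↥(innerPoints G)ᶜ → L) (e : innerPoints G ≃ S) (M : Set L) :
    Set (CrudeExtension g e) :=
  base g e '' M ∪ ⋃ x ∈ {x | g (vtx G x) ∈ M}, map g e '' innerPointsAt G x

theorem base_mem_hull {M : Set L} {p : L} : base g e p ∈ hull g e M ↔ p ∈ M := by
  constructor
  · rintro (⟨q, hq, h⟩ | h)
    · rwa [← base_injective h]
    · simp only [mem_iUnion] at h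
      obtain ⟨x, -, y, hy, h⟩ := h
      exact absurd h (map_ne_base (innerPointsAt_subset x hy) p)
  · exact fun h => Or.inl ⟨p, h, rfl⟩

theorem inner_mem_hull (hg : Function.Injective g) {M : Set L} {f : G.edgeSet}
    {t : Ioo (0 : ℝ) 1} : map g e (EndSpace.ofComplex (Complex.inner f t)) ∈ hull g e M ↔
      ∃ x ∈ (f : Sym2 V), g (vtx G x) ∈ M := by
  constructor
  · rintro (⟨q, hq, h⟩ | h)
    · exact absurd h.symm (map_ne_base (inner_mem_innerPoints f t) q)
    · simp only [mem_iUnion] at h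
      obtain ⟨x, hx, y, hy, h⟩ := h
      rw [map_injective hg h] at hy
      exact ⟨x, inner_mem_innerPointsAt.1 hy, hx⟩
  · rintro ⟨x, hxf, hx⟩
    exact Or.inr (mem_biUnion hx ⟨_, inner_mem_innerPointsAt.2 hxf, rfl⟩)

theorem map_preimage_hull_subset (hg : Function.Injective g) {X : Finset V}
    {𝒞 : Set (G.ComponentCompl (X : Set V))} {M : Set L}
    (hM : g ⁻¹' M ⊆ Subtype.val ⁻¹' EndSpace.nhd X 𝒞) :
    map g e ⁻¹' hull g e M ⊆ EndSpace.nhd X 𝒞 := by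
  intro p hp
  by_cases hpi : p ∈ innerPoints G
  · obtain ⟨f, t, rfl⟩ := hpi
    obtain ⟨x, hxf, hx⟩ := (inner_mem_hull hg).1 hp
    exact EndSpace.inner_mem_nhd.2 ⟨x, hxf, EndSpace.vertex_mem_nhd.1 (hM hx)⟩
  · rw [mem_preimage, map_of_notMem (g := g) (e := e) hpi, base_mem_hull] at hp
    exact hM hp

theorem isCrudeSet_hull (hg : Function.Injective g) (M : Set L) :
    IsCrudeSet (map g e) (hull g e M) := by
  have hv : ∀ x, map g e (EndSpace.ofComplex (Complex.vertex x)) ∈ hull g e M ↔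
      g (vtx G x) ∈ M := fun x => by
    rw [map_of_notMem (vertex_notMem_innerPoints x), base_mem_hull]
  refine subset_antisymm ?_ ?_
  · rintro _ ⟨hp, _, ⟨f, t, rfl⟩, rfl⟩
    obtain ⟨x, hxf, hx⟩ := (inner_mem_hull hg).1 hp
    exact mem_biUnion ((hv x).2 hx) ⟨_, inner_mem_innerPointsAt.2 hxf, rfl⟩
  · refine iUnion₂_subset fun x hx => subset_inter ?_ (image_mono (innerPointsAt_subset x))
    rintro _ ⟨_, ⟨f, t, hxf, rfl⟩, rfl⟩
    exact (inner_mem_hull hg).2 ⟨x, hxf, (hv x).1 hx⟩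

variable [TopologicalSpace L]

/-- A neighbourhood of a point of `L` that is not a vertex must contain the hull of an open set of
`L` around it. Vertices are exempt: requiring whole edges there would destroy the topology of the
1-complex. -/
instance : TopologicalSpace (CrudeExtension g e) where
  IsOpen U := IsOpen ((fun c => map g e (EndSpace.ofComplex c)) ⁻¹' U) ∧
    ∀ p, (∀ x, p ≠ g (vtx G x)) → base g e p ∈ U → ∃ M : Set L, IsOpen M ∧ p ∈ M ∧
      base g e '' M ⊆ U ∧ ∀ x, g (vtx G x) ∈ M → map g e '' innerPointsAt G x ⊆ U
  isOpen_univ := ⟨isOpen_univ, fun p _ _ =>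
    ⟨univ, isOpen_univ, mem_univ _, subset_univ _, fun _ _ => subset_univ _⟩⟩
  isOpen_inter := by
    rintro U W ⟨h1, h2⟩ ⟨h3, h4⟩
    refine ⟨h1.inter h3, fun p hp hpU => ?_⟩
    obtain ⟨M, hM, hpM, hMU, hMe⟩ := h2 p hp hpU.1
    obtain ⟨N, hN, hpN, hNU, hNe⟩ := h4 p hp hpU.2
    exact ⟨M ∩ N, hM.inter hN, ⟨hpM, hpN⟩,
      subset_inter ((image_mono inter_subset_left).trans hMU)
        ((image_mono inter_subset_right).trans hNU),
      fun x hx => subset_inter (hMe x hx.1) (hNe x hx.2)⟩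
  isOpen_sUnion := by
    intro s hs
    refine ⟨?_, fun p hp hpU => ?_⟩
    · rw [preimage_sUnion]
      exact isOpen_biUnion fun t ht => (hs t ht).1
    · obtain ⟨t, ht, hpt⟩ := hpU
      obtain ⟨M, hM, hpM, hMU, hMe⟩ := (hs t ht).2 p hp hpt
      exact ⟨M, hM, hpM, hMU.trans (subset_sUnion_of_mem ht),
        fun x hx => (hMe x hx).trans (subset_sUnion_of_mem ht)⟩

theorem isOpen_iff {U : Set (CrudeExtension g e)} :
    IsOpen U ↔ IsOpen ((fun c => map g e (EndSpace.ofComplex c)) ⁻¹' U) ∧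
      ∀ p, (∀ x, p ≠ g (vtx G x)) → base g e p ∈ U → ∃ M : Set L, IsOpen M ∧ p ∈ M ∧
        base g e '' M ⊆ U ∧ ∀ x, g (vtx G x) ∈ M → map g e '' innerPointsAt G x ⊆ U :=
  Iff.rfl

theorem isOpen_hull (hg : Function.Injective g) {M : Set L} (hM : IsOpen M) :
    IsOpen (hull g e M) := by
  refine isOpen_iff.2 ⟨isOpen_of_edges ?_ ?_, fun p _ hp => ⟨M, hM, base_mem_hull.1 hp, ?_, ?_⟩⟩
  · intro x hx f t hxf
    rw [mem_preimage, map_of_notMem (vertex_notMem_innerPoints x), base_mem_hull] at hx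
    exact (inner_mem_hull hg).2 ⟨x, hxf, hx⟩
  · exact fun f t s h => (inner_mem_hull hg).2 ((inner_mem_hull hg).1 h)
  · exact subset_union_left
  · exact fun x hx => (subset_biUnion_of_mem (u := fun x => map g e '' innerPointsAt G x) hx).trans
      subset_union_right

theorem isOpen_image_ofComplex (hg : Function.Injective g) {U : Set (Complex G)} (hU : IsOpen U) :
    IsOpen (map g e '' (EndSpace.ofComplex '' U)) := by
  refine isOpen_iff.2 ⟨?_, ?_⟩
  · convert hU using 1
    ext c
    constructor
    · rintro ⟨_, ⟨d, hd, rfl⟩, h⟩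
      rwa [← EndSpace.ofComplex_injective (map_injective hg h)]
    · exact fun h => ⟨_, ⟨c, h, rfl⟩, rfl⟩
  · rintro p hp ⟨_, ⟨(x | ⟨f, t⟩), hd, rfl⟩, h⟩
    · rw [map_of_notMem (vertex_notMem_innerPoints x)] at h
      exact absurd (base_injective h).symm (hp x)
    · exact absurd h (map_ne_base (inner_mem_innerPoints f t) p)

/-- Isolated points stay isolated in a Hausdorff compactification: by density, an open set whose
trace is the single point `x` lies in the closure of that point. -/
theorem isOpen_singleton_vtx [T2Space L] (hg : IsCompactification g) (x : V) :
    IsOpen {g (vtx G x)} := by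
  have hopen : IsOpen (Subtype.val ⁻¹' halfStar G x : Set ↥(innerPoints G)ᶜ) :=
    (isOpen_halfStar x).preimage continuous_subtype_val
  obtain ⟨W, hW, hWx⟩ := hg.embedding.isInducing.isOpen_iff.1 hopen
  have hsub : W ⊆ {g (vtx G x)} := by
    refine (hg.dense.open_subset_closure_inter hW).trans ?_
    refine (closure_mono ?_).trans (isClosed_singleton.closure_eq).subset
    rintro _ ⟨hW', p, rfl⟩
    have hp : p ∈ (Subtype.val ⁻¹' halfStar G x : Set ↥(innerPoints G)ᶜ) := hWx ▸ hW'
    exact congrArg g (Subtype.ext (eq_vertex_of_mem_halfStar hp p.2))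
  have hmem : g (vtx G x) ∈ W := by
    have : vtx G x ∈ g ⁻¹' W := hWx ▸ vertex_mem_halfStar x
    exact this
  rwa [← hsub.antisymm (singleton_subset_iff.2 hmem)]

theorem continuous_base [T2Space L] (hg : IsCompactification g) : Continuous (base g e) := by
  refine continuous_def.2 fun U hU => isOpen_iff_mem_nhds.2 fun p hp => ?_
  by_cases hx : ∃ x, p = g (vtx G x)
  · obtain ⟨x, rfl⟩ := hx
    refine Filter.mem_of_superset ((isOpen_singleton_vtx hg x).mem_nhds rfl) ?_
    rintro _ rfl
    exact hp
  · push Not at hx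
    obtain ⟨M, hM, hpM, hMU, -⟩ := (isOpen_iff.1 hU).2 p hx hp
    exact Filter.mem_of_superset (hM.mem_nhds hpM) (image_subset_iff.1 hMU)

theorem isEmbedding_base [T2Space L] (hg : IsCompactification g) : IsEmbedding (base g e) := by
  refine ⟨⟨le_antisymm (continuous_base hg).le_induced fun M hM => ?_⟩, base_injective⟩
  refine ⟨hull g e M, isOpen_hull hg.embedding.injective hM, ?_⟩
  ext p
  exact base_mem_hull

theorem isEmbedding_map (hg : IsCompactification g) : IsEmbedding (map g e) := by
  have hinj := hg.embedding.injective
  have hcont : Continuous (map g e) := by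
    refine continuous_def.2 fun U hU => isOpen_iff_mem_nhds.2 fun p hp => ?_
    rcases p with c | ω
    · exact EndSpace.isOpenEmbedding_ofComplex.image_mem_nhds.2
        ((isOpen_iff.1 hU).1.mem_nhds hp) |> (Filter.mem_of_superset · (by
          rintro _ ⟨c, hc, rfl⟩
          exact hc))
    · rw [mem_preimage, map_of_notMem (ofEnd_notMem_innerPoints ω)] at hp
      obtain ⟨M, hM, hωM, hMU, hMe⟩ := (isOpen_iff.1 hU).2 _ (fun x h => by
        have := congrArg Subtype.val (hinj h)
        cases this) hp
      obtain ⟨O, hO, hOM⟩ := isOpen_induced_iff.1 (hM.preimage hg.embedding.continuous)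
      have hωO : EndSpace.ofEnd ω ∈ O := by
        have : (⟨EndSpace.ofEnd ω, ofEnd_notMem_innerPoints ω⟩ : ↥(innerPoints G)ᶜ) ∈
          Subtype.val ⁻¹' O := hOM ▸ hωM
        exact this
      obtain ⟨X, hX⟩ := EndSpace.mem_nhds_ofEnd.1 (hO.mem_nhds hωO)
      refine EndSpace.mem_nhds_ofEnd.2 ⟨X, fun q hq => ?_⟩
      have hOM' : ∀ z : ↥(innerPoints G)ᶜ, (z : EndSpace G) ∈ O → g z ∈ M := fun z hz => by
        have : z ∈ g ⁻¹' M := hOM ▸ hz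
        exact this
      by_cases hqi : q ∈ innerPoints G
      · obtain ⟨f, t, rfl⟩ := hqi
        obtain ⟨x, hxf, hx⟩ := EndSpace.inner_mem_nhd.1 hq
        exact hMe x (hOM' (vtx G x) (hX (EndSpace.vertex_mem_nhd.2 hx)))
          ⟨_, inner_mem_innerPointsAt.2 hxf, rfl⟩
      · rw [mem_preimage, map_of_notMem (g := g) (e := e) hqi]
        exact hMU ⟨_, hOM' ⟨q, hqi⟩ (hX hq), rfl⟩
  refine ⟨⟨le_antisymm hcont.le_induced fun W hW => ?_⟩, map_injective hinj⟩
  -- This is the largest open set pulling back into `W`. It covers points of the 1-complex through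
  -- open sets of G, and ends through hulls.
  refine ⟨⋃₀ {O | IsOpen O ∧ map g e ⁻¹' O ⊆ W}, isOpen_sUnion fun O hO => hO.1, ?_⟩
  refine subset_antisymm ?_ fun p hp => ?_
  · rw [preimage_sUnion]
    exact iUnion₂_subset fun O hO => hO.2
  rcases p with c | ω
  · refine ⟨_, ⟨isOpen_image_ofComplex hinj
      (EndSpace.isOpenEmbedding_ofComplex.continuous.isOpen_preimage W hW), ?_⟩,
      mem_image_of_mem _ (mem_image_of_mem _ hp)⟩
    rw [preimage_image_eq _ (map_injective hinj)]
    exact image_preimage_subset _ _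
  · obtain ⟨X, hX⟩ := EndSpace.mem_nhds_ofEnd.1 (IsOpen.mem_nhds hW hp)
    obtain ⟨M, hM, hMX⟩ := hg.embedding.isInducing.isOpen_iff.1
      ((EndSpace.isOpen_nhd X {ω.component X}).preimage continuous_subtype_val)
    refine ⟨_, ⟨isOpen_hull hinj hM, (map_preimage_hull_subset hinj hMX.subset).trans hX⟩, ?_⟩
    rw [map_of_notMem (ofEnd_notMem_innerPoints ω), base_mem_hull]
    have : (⟨EndSpace.ofEnd ω, ofEnd_notMem_innerPoints ω⟩ : ↥(innerPoints G)ᶜ) ∈ g ⁻¹' M :=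
      hMX ▸ EndSpace.ofEnd_mem_nhd.2 (mem_singleton _)
    exact this

/-- Hulls of open sets are crude and open, and by definition of the topology they form neighbourhood
bases at the points of `L` that are not vertices. -/
theorem isCrude_map (hg : IsCompactification g) : IsCrude (map g e) := by
  have hinj := hg.embedding.injective
  refine ⟨{W | ∃ M, IsOpen M ∧ W = hull g e M}, ?_,
    TopologicalSpace.isTopologicalBasis_of_isOpen_of_nhds ?_ ?_⟩
  · rintro _ ⟨M, -, rfl⟩
    exact isCrudeSet_hull hinj M
  · rintro _ (⟨U, hU, rfl⟩ | ⟨M, hM, rfl⟩)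
    · exact isOpen_image_ofComplex hinj ((isTopologicalBasis_basicOpens G).isOpen hU)
    · exact isOpen_hull hinj hM
  · intro p U hp hU
    by_cases hc : ∃ c, p = map g e (EndSpace.ofComplex c)
    · obtain ⟨c, rfl⟩ := hc
      obtain ⟨B, hB, hcB, hBU⟩ :=
        (isTopologicalBasis_basicOpens G).exists_subset_of_mem_open hp (isOpen_iff.1 hU).1
      refine ⟨_, Or.inl ⟨B, hB, rfl⟩, ⟨_, ⟨c, hcB, rfl⟩, rfl⟩, ?_⟩
      rintro _ ⟨_, ⟨d, hd, rfl⟩, rfl⟩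
      exact hBU hd
    · have hpr : p ∈ range (base g e) := by
        rw [← compl_image_innerPoints]
        rintro ⟨_, ⟨f, t, rfl⟩, h⟩
        exact hc ⟨_, h.symm⟩
      obtain ⟨q, rfl⟩ := hpr
      obtain ⟨M, hM, hqM, hMU, hMe⟩ := (isOpen_iff.1 hU).2 q (fun x h => hc ⟨Complex.vertex x, by
        rw [map_of_notMem (vertex_notMem_innerPoints x), h]⟩) hp
      exact ⟨_, Or.inr ⟨M, hM, rfl⟩, base_mem_hull.2 hqM,
        union_subset hMU (iUnion₂_subset fun x hx => hMe x hx)⟩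

/-- Compactness passes from `L` to the extension by `compactSpace_of_isCompact_compl`, the hulls
being the neighbourhoods that carry edges along with their vertices. -/
theorem isOmegaCompactification_map [T2Space L] (hg : IsCompactification g) :
    IsOmegaCompactification (map g e) := by
  have hinj := hg.embedding.injective
  have hbase := isEmbedding_base (e := e) hg
  have hemb := isEmbedding_map (e := e) hg
  have := hg.compact
  have hK : IsCompact (map g e '' innerPoints G)ᶜ := by
    rw [compl_image_innerPoints]
    exact isCompact_range hbase.continuous
  have hdense : (map g e '' innerPoints G)ᶜ ⊆ closure (map g e '' (innerPoints G)ᶜ) := by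
    rw [compl_image_innerPoints]
    have himg : base g e '' range g ⊆ map g e '' (innerPoints G)ᶜ := by
      rintro _ ⟨_, ⟨z, rfl⟩, rfl⟩
      exact ⟨z, z.2, map_of_notMem z.2⟩
    rintro _ ⟨q, rfl⟩
    exact closure_mono himg (image_closure_subset_closure_image hbase.continuous
      ⟨q, hg.dense q, rfl⟩)
  refine .of_subsets ?_ hemb ?_ hK hdense ?_
  · refine compactSpace_of_isCompact_compl hemb.injective hemb.continuous hK ?_ ?_
    · intro x
      rw [map_of_notMem (vertex_notMem_innerPoints x)]
      refine ⟨_, (isOpen_hull hinj (isOpen_singleton_vtx hg x)).mem_nhds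
        (base_mem_hull.2 (mem_singleton _)), ?_⟩
      rw [compl_image_innerPoints]
      rintro _ ⟨h, q, rfl⟩
      rw [base_mem_hull.1 h]
      rfl
    · intro p hp hpx W hW
      rw [compl_image_innerPoints] at hp
      obtain ⟨q, rfl⟩ := hp
      obtain ⟨U, hUW, hU, hqU⟩ := mem_nhds_iff.1 hW
      obtain ⟨M, hM, hqM, -, hMe⟩ := (isOpen_iff.1 hU).2 q (fun x h => hpx x (by
        rw [map_of_notMem (vertex_notMem_innerPoints x), h])) hqU
      refine ⟨_, (isOpen_hull hinj hM).mem_nhds (base_mem_hull.2 hqM), fun x hx => ?_⟩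
      rw [map_of_notMem (vertex_notMem_innerPoints x), base_mem_hull] at hx
      exact (hMe x hx).trans hUW
  · intro p
    by_cases hp : p ∈ map g e '' innerPoints G
    · exact subset_closure (image_subset_range _ _ hp)
    · exact closure_mono (image_subset_range _ _) (hdense hp)
  · rw [compl_image_innerPoints]
    exact hbase.toHomeomorph.symm.isEmbedding.t2Space

end CrudeExtension

/-! ### Remainders, coarsest Ω-compactifications and crude neighbourhoods -/

section

variable {K : Type v} {h : EndSpace G → K}

/-- The restriction of a map of `|G|_Ω` to the space of vertices and ends. -/
abbrev restrictToCompl (hinj : Function.Injective h) :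
    ↥(innerPoints G)ᶜ → ↥(h '' innerPoints G)ᶜ :=
  (mapsTo_compl_image hinj (innerPoints G)).restrict h (innerPoints G)ᶜ (h '' innerPoints G)ᶜ

theorem mem_range_restrictToCompl (hinj : Function.Injective h) {p : ↥(h '' innerPoints G)ᶜ} :
    p ∈ range (restrictToCompl hinj) ↔ (p : K) ∈ range h := by
  constructor
  · rintro ⟨z, rfl⟩
    exact ⟨z, rfl⟩
  · rintro ⟨x, hx⟩
    have hxi : x ∈ (innerPoints G)ᶜ := fun hxi => p.2 ⟨x, hxi, hx⟩
    exact ⟨⟨x, hxi⟩, Subtype.ext hx⟩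

theorem IsCrudeSet.innerPointsAt_subset {M : Set K} (hM : IsCrudeSet h M) {x : V}
    (hx : h (EndSpace.ofComplex (Complex.vertex x)) ∈ M) : h '' innerPointsAt G x ⊆ M := by
  have : h '' innerPointsAt G x ⊆ M ∩ h '' innerPoints G := by
    rw [hM]
    exact subset_biUnion_of_mem (u := fun x => h '' innerPointsAt G x) hx
  exact this.trans inter_subset_left

theorem IsCrudeSet.exists_vertex {M : Set K} (hM : IsCrudeSet h M) {k : K} (hk : k ∈ M)
    (hk' : k ∈ h '' innerPoints G) : ∃ x, h (EndSpace.ofComplex (Complex.vertex x)) ∈ M ∧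
      k ∈ h '' innerPointsAt G x := by
  have : k ∈ M ∩ h '' innerPoints G := ⟨hk, hk'⟩
  rw [hM] at this
  simpa using this

variable [TopologicalSpace K]

/-- A graph that has an `Ω`-compactification with at most one additional point is end-tough. -/
theorem IsOmegaCompactification.isEndTough (hK : IsOmegaCompactification h)
    (hr : (range h)ᶜ.Subsingleton) : IsEndTough G := by
  have := hK.t2
  refine isEndTough_of_locallyCompactSpace (hK.restrict.locallyCompactSpace ?_)
  intro p hp q hq
  have hinj := hK.isCompactification.embedding.injective
  exact Subtype.ext (hr (fun h => hp ((mem_range_restrictToCompl hinj).2 h))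
    fun h => hq ((mem_range_restrictToCompl hinj).2 h))

/-- An `Ω`-compactification that is coarser than every crude one has at most one additional
point. -/
theorem IsOmegaCompactification.subsingleton_compl_range (hK : IsOmegaCompactification h)
    (hcoarse : ∀ (K' : Type (max v w)) [TopologicalSpace K'] (h' : EndSpace G → K'),
      IsOmegaCompactification h' → IsCrude h' → IsCoarser h h') : (range h)ᶜ.Subsingleton := by
  have := hK.t2
  have hemb := hK.isCompactification.embedding
  have hinj := hemb.injective
  intro a ha b hb
  have hcompl : ∀ a ∈ (range h)ᶜ, a ∈ (h '' innerPoints G)ᶜ :=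
    fun a ha ha' => ha (image_subset_range _ _ ha')
  let p : ↥(h '' innerPoints G)ᶜ := ⟨a, hcompl a ha⟩
  let q : ↥(h '' innerPoints G)ᶜ := ⟨b, hcompl b hb⟩
  have hg := hK.restrict.identify (p := p) (q := q)
    (fun h => ha ((mem_range_restrictToCompl hinj).1 h))
    (fun h => hb ((mem_range_restrictToCompl hinj).1 h))
  -- The copy of E̊ is lifted so that the extension lives in the universe over which `hcoarse`
  -- ranges.
  let e : innerPoints G ≃ ULift.{w} (h '' innerPoints G) :=
    (Equiv.Set.image h (innerPoints G) hinj).trans Equiv.ulift.symm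
  obtain ⟨f, hf, hfh⟩ := hcoarse _ (CrudeExtension.map _ e)
    (CrudeExtension.isOmegaCompactification_map hg) (CrudeExtension.isCrude_map hg)
  let π : ↥(h '' innerPoints G)ᶜ → Quotient (identify p q) := Quotient.mk _
  have hbase := CrudeExtension.continuous_base (e := e) hg
  have hbase_map : ∀ z : ↥(innerPoints G)ᶜ,
      f (CrudeExtension.base _ e (π (restrictToCompl hinj z))) = h z := by
    intro z
    rw [← congrFun hfh z, Function.comp_apply, CrudeExtension.map_of_notMem z.2]
    rfl
  -- E̊ is open in |G|_Ω, so it is the trace of an open `W`. If `f` sent a point of the quotient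
  -- into E̊, density would give a vertex or end mapped into `W`, though `f` fixes vertices and
  -- ends.
  have hmaps : ∀ y, f (CrudeExtension.base _ e y) ∈ (h '' innerPoints G)ᶜ := by
    rintro y ⟨x, hx, hxy⟩
    obtain ⟨W, hW, hWi⟩ := hemb.isInducing.isOpen_iff.1 (isOpen_innerPoints G)
    have hxW : h x ∈ W := by
      exact hWi.superset hx
    obtain ⟨z, hz⟩ := hg.dense.exists_mem_open (hW.preimage (hf.comp hbase)) ⟨y, by
      rw [mem_preimage, Function.comp_apply, ← hxy]
      exact hxW⟩
    have hz' : f (CrudeExtension.base _ e (π (restrictToCompl hinj z))) ∈ W := hz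
    rw [hbase_map] at hz'
    exact z.2 (hWi.subset hz')
  -- `F` fixes the dense image of Z, so it is the identity, yet it factors through the
  -- identification of `p` with `q`.
  let F : ↥(h '' innerPoints G)ᶜ → ↥(h '' innerPoints G)ᶜ :=
    fun y => ⟨f (CrudeExtension.base _ e (π y)), hmaps _⟩
  have hF : Continuous F := ((hf.comp hbase).comp continuous_quotient_mk').subtype_mk _
  have hFid : F = id := hK.restrict.dense.equalizer hF continuous_id (funext fun z =>
    Subtype.ext (hbase_map z))
  have hπ : π p = π q := Quotient.sound (Or.inr ⟨Or.inl rfl, Or.inr rfl⟩)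
  have hpq : F p = F q := Subtype.ext (congrArg (fun y => f (CrudeExtension.base _ e y)) hπ)
  rw [hFid] at hpq
  exact congrArg Subtype.val hpq

/-- In a crude space, every point outside the 1-complex has arbitrarily small crude open
neighbourhoods. -/
theorem IsCrude.exists_crude_subset (hK : IsCrude h) {k : K}
    (hk : ∀ c, k ≠ h (EndSpace.ofComplex c)) {W : Set K} (hW : IsOpen W) (hkW : k ∈ W) :
    ∃ M, IsOpen M ∧ IsCrudeSet h M ∧ k ∈ M ∧ M ⊆ W := by
  obtain ⟨𝓜, hcrude, hbasis⟩ := hK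
  obtain ⟨M, hM, hkM, hMW⟩ := hbasis.exists_subset_of_mem_open hkW hW
  rcases hM with ⟨U, -, rfl⟩ | hM
  · obtain ⟨_, ⟨c, -, rfl⟩, rfl⟩ := hkM
    exact absurd rfl (hk c)
  · exact ⟨M, hbasis.isOpen (Or.inr hM), hcrude M hM, hkM, hMW⟩

theorem IsCrude.isOpen_image (hK : IsCrude h) {U : Set (Complex G)} (hU : IsOpen U) :
    IsOpen (h '' (EndSpace.ofComplex '' U)) := by
  obtain ⟨𝓜, -, hbasis⟩ := hK
  rw [isOpen_iff_mem_nhds]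
  rintro _ ⟨_, ⟨c, hc, rfl⟩, rfl⟩
  obtain ⟨B, hB, hcB, hBU⟩ := (isTopologicalBasis_basicOpens G).exists_subset_of_mem_open hc hU
  exact Filter.mem_of_superset ((hbasis.isOpen (Or.inl ⟨B, hB, rfl⟩)).mem_nhds
    ⟨_, ⟨c, hcB, rfl⟩, rfl⟩) (image_mono (image_mono hBU))

end

/-! ### The one-point crude compactification -/

section OnePoint

/-- The canonical map from `|G|_Ω` to the crude extension of the one-point compactification of the
space of vertices and ends. -/
noncomputable abbrev onePointMap (G : SimpleGraph V) :
    EndSpace G → CrudeExtension ((↑) : ↥(innerPoints G)ᶜ → OnePoint ↥(innerPoints G)ᶜ)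
      (Equiv.refl (innerPoints G)) :=
  CrudeExtension.map _ _

/-- The additional point of the one-point crude compactification. -/
abbrev onePointInfty (G : SimpleGraph V) :
    CrudeExtension ((↑) : ↥(innerPoints G)ᶜ → OnePoint ↥(innerPoints G)ᶜ)
      (Equiv.refl (innerPoints G)) :=
  CrudeExtension.base _ _ OnePoint.infty

theorem isCompactification_onePoint_coe {X : Type*} [TopologicalSpace X] [NoncompactSpace X] :
    IsCompactification ((↑) : X → OnePoint X) :=
  ⟨inferInstance, OnePoint.isOpenEmbedding_coe.isEmbedding, OnePoint.denseRange_coe⟩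

theorem compl_range_onePointMap : (range (onePointMap G))ᶜ = {onePointInfty G} := by
  ext (p | s)
  · induction p using OnePoint.rec with
    | infty =>
      refine iff_of_true ?_ rfl
      rintro ⟨x, hx⟩
      by_cases hxi : x ∈ innerPoints G
      · exact CrudeExtension.map_ne_base hxi _ hx
      · exact OnePoint.coe_ne_infty _
          (CrudeExtension.base_injective ((CrudeExtension.map_of_notMem hxi).symm.trans hx))
    | coe z =>
      refine iff_of_false (fun h => h ⟨z, CrudeExtension.map_of_notMem z.2⟩) fun h => ?_
      exact OnePoint.coe_ne_infty _ (CrudeExtension.base_injective h)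
  · refine iff_of_false (fun h => h ⟨s, CrudeExtension.map_of_mem s.2⟩) fun h => ?_
    cases h

/-- The one-point crude compactification is a quotient of every crude `Ω`-compactification. -/
theorem isQuotientOf_onePointMap [WeaklyLocallyCompactSpace ↥(innerPoints G)ᶜ]
    [NoncompactSpace ↥(innerPoints G)ᶜ] {K : Type v} [TopologicalSpace K] {h : EndSpace G → K}
    (hK : IsOmegaCompactification h) (hcr : IsCrude h) : IsQuotientOf (onePointMap G) h := by
  have := hK.t2
  have := hK.restrict.compact
  have hinj := hK.isCompactification.embedding.injective
  have hcont := hK.isCompactification.embedding.continuous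
  have hrinj : Function.Injective (restrictToCompl hinj) := hK.restrict.embedding.injective
  -- All points outside |G|_Ω go to ∞. On K \ E̊ this is the canonical map `f₀` to the one-point
  -- compactification of Z, as `hff₀` records.
  let f : K → _ := Function.extend h (onePointMap G) fun _ => onePointInfty G
  have hfh : ∀ x, f (h x) = onePointMap G x := hinj.extend_apply _ _
  have hfr : ∀ k ∉ range h, f k = onePointInfty G := Function.extend_apply' _ _
  let f₀ : ↥(h '' innerPoints G)ᶜ → OnePoint ↥(innerPoints G)ᶜ :=
    Function.extend (restrictToCompl hinj) (↑) fun _ => OnePoint.infty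
  have hf₀ : Continuous f₀ := hK.restrict.continuous_extend_infty
  have hf₀z : ∀ z, f₀ (restrictToCompl hinj z) = z := hrinj.extend_apply _ _
  have hff₀ : ∀ k : ↥(h '' innerPoints G)ᶜ, f k = CrudeExtension.base _ _ (f₀ k) := by
    intro k
    by_cases hk : k ∈ range (restrictToCompl hinj)
    · obtain ⟨z, rfl⟩ := hk
      rw [hf₀z]
      exact (hfh z).trans (CrudeExtension.map_of_notMem z.2)
    · rw [hfr _ fun h => hk ((mem_range_restrictToCompl hinj).2 h)]
      have hk' : f₀ k = OnePoint.infty := Function.extend_apply' _ _ _ hk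
      rw [hk']
  have hnotin : ∀ {k : K} c, k ∈ (h '' innerPoints G)ᶜ → k = h (EndSpace.ofComplex c) →
      ∃ x, c = Complex.vertex x := by
    rintro k (x | ⟨e, t⟩) hk rfl
    · exact ⟨x, rfl⟩
    · exact absurd ⟨_, inner_mem_innerPoints e t, rfl⟩ hk
  have hmapv : ∀ x : V, onePointMap G (EndSpace.ofComplex (Complex.vertex x)) =
      CrudeExtension.base _ _ (CrudeExtension.vtx G x : OnePoint ↥(innerPoints G)ᶜ) := fun x =>
    CrudeExtension.map_of_notMem (vertex_notMem_innerPoints x)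
  -- The target need not be Hausdorff, so compactness alone does not make `f` a quotient map.
  refine ⟨f, (isQuotientMap_iff _).2 (And.symm ⟨?_, isCoinducing_iff.2 fun U =>
    Iff.symm ⟨fun hU => ?_, fun hU => ?_⟩⟩), funext hfh⟩
  · intro y
    by_cases hy : y ∈ range (onePointMap G)
    · obtain ⟨x, rfl⟩ := hy
      exact ⟨h x, hfh x⟩
    · have hy' : y ∈ (range (onePointMap G))ᶜ := hy
      rw [compl_range_onePointMap] at hy'
      obtain rfl := mem_singleton_iff.1 hy'
      -- If no point went to ∞, Z would fill the compact space K \ E̊.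
      by_contra! hcon
      have hsurj : range (restrictToCompl hinj) = univ := eq_univ_of_forall fun k => by
        by_contra hk
        exact hcon k (hfr _ fun h => hk ((mem_range_restrictToCompl hinj).2 h))
      refine noncompact_univ ↥(innerPoints G)ᶜ ?_
      rw [hK.restrict.embedding.isCompact_iff, image_univ, hsurj]
      exact isCompact_univ
  · refine isOpen_iff_mem_nhds.2 fun k hk => ?_
    by_cases hkc : ∃ c, k = h (EndSpace.ofComplex c)
    · obtain ⟨c, rfl⟩ := hkc
      rw [mem_preimage, hfh] at hk
      refine Filter.mem_of_superset ((hcr.isOpen_image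
        (CrudeExtension.isOpen_iff.1 hU).1).mem_nhds ⟨_, ⟨c, hk, rfl⟩, rfl⟩) ?_
      rintro _ ⟨_, ⟨d, hd, rfl⟩, rfl⟩
      rw [mem_preimage, hfh]
      exact hd
    · push Not at hkc
      have hki : k ∈ (h '' innerPoints G)ᶜ := by
        rintro ⟨_, ⟨e, t, rfl⟩, rfl⟩
        exact hkc _ rfl
      rw [mem_preimage, hff₀ ⟨k, hki⟩] at hk
      obtain ⟨M, hM, hkM, hMU, hMe⟩ := (CrudeExtension.isOpen_iff.1 hU).2 _ (fun x hx => by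
        have h1 : f k = f (h (EndSpace.ofComplex (Complex.vertex x))) := by
          rw [hff₀ ⟨k, hki⟩, hx, hfh, hmapv]
        by_cases hkr : k ∈ range h
        · obtain ⟨y, rfl⟩ := hkr
          rw [hfh, hfh] at h1
          exact hkc _ (congrArg h (CrudeExtension.map_injective OnePoint.coe_injective h1))
        · rw [hfr k hkr, hfh, hmapv] at h1
          exact OnePoint.infty_ne_coe _ (CrudeExtension.base_injective h1)) hk
      -- `f₀` controls only K \ E̊. Inside `W` a crude set `B` controls the edges: each of its inner
      -- points is on an edge at a vertex of `B`, that vertex is mapped into `M`, and `hMe` applies.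
      obtain ⟨W, hW, hWM⟩ := isOpen_induced_iff.1 (hM.preimage hf₀)
      have hWM' : ∀ k : ↥(h '' innerPoints G)ᶜ, (k : K) ∈ W ↔ f₀ k ∈ M := fun k =>
        Set.ext_iff.1 hWM k
      obtain ⟨B, hB, hBcr, hkB, hBW⟩ := hcr.exists_crude_subset hkc hW
        ((hWM' ⟨k, hki⟩).2 hkM)
      refine Filter.mem_of_superset (hB.mem_nhds hkB) fun y hy => ?_
      by_cases hyi : y ∈ h '' innerPoints G
      · obtain ⟨x, hx, q, hq, rfl⟩ := hBcr.exists_vertex hy hyi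
        rw [mem_preimage, hfh]
        refine hMe x ?_ ⟨q, hq, rfl⟩
        have := (hWM' (restrictToCompl hinj (CrudeExtension.vtx G x))).1 (hBW hx)
        rwa [hf₀z] at this
      · rw [mem_preimage, hff₀ ⟨y, hyi⟩]
        exact hMU ⟨_, (hWM' ⟨y, hyi⟩).1 (hBW hy), rfl⟩
  · have hUpre : onePointMap G ⁻¹' U = h ⁻¹' (f ⁻¹' U) := by
      ext x
      rw [mem_preimage, mem_preimage, mem_preimage, hfh]
    have hUopen : IsOpen (onePointMap G ⁻¹' U) := hUpre ▸ hU.preimage hcont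
    refine CrudeExtension.isOpen_iff.2
      ⟨hUopen.preimage EndSpace.isOpenEmbedding_ofComplex.continuous, fun p hp hpU => ?_⟩
    induction p using OnePoint.rec with
    | infty =>
      -- Any vertex in `N` lies in a crude subset of `f ⁻¹' U`, so its edges are mapped into `U`. As
      -- `N` contains the remainder, what it misses of K \ E̊ is a compact set `F` of vertices and
      -- ends, whose complement is the required neighbourhood of ∞.
      let N : Set K := ⋃₀ {M | IsOpen M ∧ IsCrudeSet h M ∧ M ⊆ f ⁻¹' U}
      have hN : IsOpen N := isOpen_sUnion fun M hM => hM.1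
      have hNU : N ⊆ f ⁻¹' U := sUnion_subset fun M hM => hM.2.2
      have hrN : (range h)ᶜ ⊆ N := by
        intro k hk
        obtain ⟨M, hM, hMc, hkM, hMU⟩ := hcr.exists_crude_subset
          (fun c hc => hk ⟨_, hc.symm⟩) hU (by rw [mem_preimage, hfr k hk]; exact hpU)
        exact ⟨M, ⟨hM, hMc, hMU⟩, hkM⟩
      let F : Set ↥(innerPoints G)ᶜ := restrictToCompl hinj ⁻¹' (Subtype.val ⁻¹' N)ᶜ
      have hF : IsCompact F := by
        rw [hK.restrict.embedding.isCompact_iff, image_preimage_eq_of_subset]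
        · exact (hN.preimage continuous_subtype_val).isClosed_compl.isCompact
        · intro k hk
          by_contra hkr
          exact hk (hrN fun h => hkr ((mem_range_restrictToCompl hinj).2 h))
      refine ⟨(OnePoint.some '' F)ᶜ, OnePoint.isOpen_compl_image_coe.2 ⟨hF.isClosed, hF⟩,
        fun h => OnePoint.infty_notMem_image_coe h, ?_, ?_⟩
      · rintro _ ⟨y, hy, rfl⟩
        induction y using OnePoint.rec with
        | infty => exact hpU
        | coe z =>
          have hz : h z ∈ N := by
            by_contra hz
            exact hy ⟨z, hz, rfl⟩
          have := hNU hz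
          rw [mem_preimage, hfh, onePointMap, CrudeExtension.map_of_notMem z.2] at this
          exact this
      · intro x hx
        have hz : h (EndSpace.ofComplex (Complex.vertex x)) ∈ N := by
          by_contra hz
          exact hx ⟨CrudeExtension.vtx G x, hz, rfl⟩
        obtain ⟨M, ⟨-, hMc, hMU⟩, hxM⟩ := hz
        rintro _ ⟨q, hq, rfl⟩
        have := hMU (hMc.innerPointsAt_subset hxM ⟨q, hq, rfl⟩)
        rwa [mem_preimage, hfh] at this
    | coe z =>
      obtain ⟨z, hz⟩ := z
      rcases vertex_or_end_of_notMem_innerPoints hz with ⟨x, rfl⟩ | ⟨ω, rfl⟩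
      · exact absurd rfl (hp x)
      have hωU : EndSpace.ofEnd ω ∈ onePointMap G ⁻¹' U := by
        rw [mem_preimage, onePointMap, CrudeExtension.map_of_notMem hz]
        exact hpU
      obtain ⟨X, hX⟩ := EndSpace.mem_nhds_ofEnd.1 (hUopen.mem_nhds hωU)
      refine ⟨(↑) '' (Subtype.val ⁻¹' EndSpace.nhd X {ω.component X} : Set ↥(innerPoints G)ᶜ),
        OnePoint.isOpen_image_coe.2 ((EndSpace.isOpen_nhd X _).preimage continuous_subtype_val),
        ⟨_, EndSpace.ofEnd_mem_nhd.2 (mem_singleton _), rfl⟩, ?_, ?_⟩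
      · rintro _ ⟨_, ⟨y, hy, rfl⟩, rfl⟩
        have := hX hy
        rwa [mem_preimage, onePointMap, CrudeExtension.map_of_notMem y.2] at this
      · rintro x ⟨y, hy, hyx⟩
        rw [OnePoint.coe_injective hyx] at hy
        rintro _ ⟨_, ⟨e, t, hxe, rfl⟩, rfl⟩
        exact hX (EndSpace.inner_mem_nhd.2 ⟨x, hxe, EndSpace.vertex_mem_nhd.1 hy⟩)

end OnePoint

end GraphEnds

open GraphEnds

/-! ### Assembly of the cases -/

theorem theorem3p12 {V : Type u} (G : SimpleGraph V) :
    -- the tough case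
    (IsTough G →
      IsOmegaCompactification (id : EndSpace G → EndSpace G) ∧
      ∀ (K : Type w) [TopologicalSpace K] (h : EndSpace G → K),
        IsOmegaCompactification h → AreEquivalent h (id : EndSpace G → EndSpace G)) ∧
    -- the case of an end-tough graph that is not tough
    (¬ IsTough G → IsEndTough G →
      ∃ (K : Type u) (_ : TopologicalSpace K) (h : EndSpace G → K),
        IsOmegaCompactification h ∧ IsCrude h ∧ (∃ p, (Set.range h)ᶜ = {p}) ∧
        IsCoarsestCrudeOmega.{u, u, w} h ∧
        (∀ (K' : Type w) [TopologicalSpace K'] (h' : EndSpace G → K'),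
          IsOmegaCompactification h' → IsCrude h' → IsQuotientOf h h') ∧
        ¬ AreEquivalent h (toTangleSpace G)) ∧
    -- the case of a graph that is neither tough nor end-tough
    (¬ IsTough G → ¬ IsEndTough G →
      (∀ (K : Type w) [TopologicalSpace K] (h : EndSpace G → K),
        IsOmegaCompactification h → ¬ (Set.range h)ᶜ.Subsingleton) ∧
      (¬ ∃ (K : Type w) (_ : TopologicalSpace K) (h : EndSpace G → K),
        IsCoarsestOmega.{u, w, w} h) ∧
      ¬ ∃ (K : Type w) (_ : TopologicalSpace K) (h : EndSpace G → K),
        IsCoarsestCrudeOmega.{u, w, w} h) ∧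
    -- when the tangle compactification is the coarsest
    (IsCoarsestOmega.{u, u, max u w} (toTangleSpace G) ↔ IsTough G) := by
  refine ⟨fun hG => ⟨isOmegaCompactification_of_homeomorph hG.isCompact (Homeomorph.refl _),
    fun K _ h hK => areEquivalent_id hG.isCompact hK⟩, fun hG hG' => ?_, fun _ hG => ⟨?_, ?_, ?_⟩,
    ⟨fun h => ?_, fun hG => ⟨?_, ?_⟩⟩⟩
  · have := hG'.weaklyLocallyCompactSpace
    have : NoncompactSpace ↥(innerPoints G)ᶜ := by
      rw [← not_compactSpace_iff, ← isCompact_iff_compactSpace]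
      exact fun h => hG (isTough_of_isCompact h)
    have hg : IsCompactification ((↑) : ↥(innerPoints G)ᶜ → OnePoint ↥(innerPoints G)ᶜ) :=
      isCompactification_onePoint_coe
    have hΩ := CrudeExtension.isOmegaCompactification_map (e := Equiv.refl (innerPoints G)) hg
    have hcr := CrudeExtension.isCrude_map (e := Equiv.refl (innerPoints G)) hg
    refine ⟨_, _, onePointMap G, hΩ, hcr, ⟨_, compl_range_onePointMap⟩, ⟨hΩ, hcr, ?_⟩, ?_, ?_⟩
    · intro K' _ h' hK' hcr'
      obtain ⟨f, hf, hfh⟩ := isQuotientOf_onePointMap hK' hcr'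
      exact ⟨f, hf.continuous, hfh⟩
    · exact fun K' _ h' hK' hcr' => isQuotientOf_onePointMap hK' hcr'
    · rintro ⟨f, hf⟩
      -- A homeomorphism over |G|_Ω would map the at least two remainder points of |G|_Θ to the
      -- single point ∞.
      refine not_subsingleton_compl_range_toTangleSpace hG fun a ha b hb => ?_
      have key : ∀ a ∈ (Set.range (toTangleSpace G))ᶜ, f a = onePointInfty G := by
        intro a ha
        have : f a ∈ (Set.range (onePointMap G))ᶜ := by
          rintro ⟨x, hx⟩
          rw [← hf] at hx
          exact ha ⟨x, f.injective hx⟩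
        rwa [compl_range_onePointMap] at this
      exact f.injective ((key a ha).trans (key b hb).symm)
  · exact fun K _ h hK hr => hG (hK.isEndTough hr)
  · rintro ⟨K, _, h, hK, hcoarse⟩
    exact hG (hK.isEndTough (hK.subsingleton_compl_range.{u, w, w}
      fun K' _ h' hK' _ => hcoarse K' h' hK'))
  · rintro ⟨K, _, h, hK, -, hcoarse⟩
    exact hG (hK.isEndTough (hK.subsingleton_compl_range.{u, w, w} hcoarse))
  · by_contra hG
    exact not_subsingleton_compl_range_toTangleSpace hG (h.1.subsingleton_compl_range.{u, u, w}
      fun K' _ h' hK' _ => h.2 K' h' hK')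
  · exact isOmegaCompactification_of_homeomorph hG.isCompact hG.homeomorphTangleSpace
  · intro K' _ h' hK'
    obtain ⟨φ, hφ⟩ := areEquivalent_id hG.isCompact hK'
    refine ⟨hG.homeomorphTangleSpace ∘ φ.symm,
      hG.homeomorphTangleSpace.continuous.comp φ.symm.continuous, funext fun x => ?_⟩
    rw [← hφ]
    simp only [Function.comp_apply, id, φ.symm_apply_apply]
    rfl
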